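/- Let $\mathbb T=\mathbb R/2\pi\mathbb Z$ and fix constants $e,m_+,T_+,T_->0$. Write $\langle a\rangle=(1+a^2)^{1/2}$, $\langle a,b\rangle=(1+a^2+b^2)^{1/2}$. For $f$ on $\mathbb T\times\mathbb R$ put $$\widehat f(k,\xi)=\frac1{2\pi}\iint_{\mathbb T\times\mathbb R}e^{-i(kx+\xi y)}f\,dx\,dy,\qquad \|f\|_{H^r_xH^s_y}^2=\sum_{k\in\mathbb Z}\int_{\mathbb R}\langle k\rangle^{2r}\langle\xi\rangle^{2s}|\widehat f|^2d\xi,\qquad \|f\|_{H^s}^2=\sum_{k\in\mathbb Z}\int_{\mathbb R}\langle k,\xi\rangle^{2s}|\widehat f|^2d\xi .$$ Let $(\eta,u,\phi)$, $u=(u^x,u^y)$, be a smooth real-valued solution on $[0,\infty)\times\mathbb T\times\mathbb R$ (that is, $C^\infty$ up to $t=0$, with $\eta,u^x,u^y,\phi\in L^\infty_{loc}([0,\infty);L^2(\mathbb T\times\mathbb R))$) of the ion Euler–Poisson system linearized around the Couette flow, $$\partial_t\eta+y\partial_x\eta+\nabla\cdot u=0,\qquad \partial_tu+y\partial_xu+\begin{pmatrix}u^y\\0\end{pmatrix}+\frac{T_+}{m_+}\nabla\eta=-\frac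 e{m_+}\nabla\phi,\qquad \Delta\phi=4\pi e\Big(\frac e{T_-}\phi-\eta\Big).$$ Let $\psi=\nabla\cdot u$, $\omega=\nabla^\perp\cdot u=-\partial_yu^x+\partial_xu^y$, let $\mathbb Q[u]=\nabla\Delta^{-1}\psi$ and $\mathbb P[u]=\nabla^\perp\Delta^{-1}\omega$ (with $\nabla^\perp=(-\partial_y,\partial_x)^\top$) be the compressible and solenoidal parts of $u$, and let $\eta^{in},\psi^{in},\omega^{in}$ be the values of $\eta,\psi,\omega$ at $t=0$. Suppose that $\eta^{in},\omega^{in}\in H^1_xH^2_y$, that $\psi^{in}\in H^{-1/2}_xL^2_y$, and that the averages in $x$ of $\eta^{in},\psi^{in},\omega^{in}$ vanish for every $y$. Then there is a constant $C>0$, depending only on $e,m_+,T_+,T_-$, such that for all $t\ge0$ $$\begin{aligned}\|\mathbb P[u]^x(t)\|_{L^2}+\|\phi(t)\|_{L^2}\le C\Big[&\sqrt{\tfrac{m_+}{T_+}}\,\langle t\rangle^{-1/2}\Big(\big\|\sqrt{\tfrac{T_+}{m_+}}\,\eta^{in}\big\|_{H^{-1/2}_xL^2_y}+\|\eta^{in}+\omega^{in}\|_{H^{-1/2}_xH^{1/2}_y}\Big)\\&+\langle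 t\rangle^{-1}\|\eta^{in}+\omega^{in}\|_{H^{-1}_xH^1_y}+\sqrt{\tfrac{m_+}{T_+}}\,\langle t\rangle^{-1/2}\|\psi^{in}\|_{H^{-1/2}_xH^{-1}_y}\Big],\end{aligned}$$ $$\begin{aligned}\|\mathbb P[u]^y(t)\|_{L^2}\le C\Big[&\sqrt{\tfrac{m_+}{T_+}}\,\langle t\rangle^{-3/2}\Big(\big\|\sqrt{\tfrac{T_+}{m_+}}\,\eta^{in}\big\|_{H^{-1/2}_xH^1_y}+\|\eta^{in}+\omega^{in}\|_{H^{-1/2}_xH^{3/2}_y}\Big)\\&+\langle t\rangle^{-2}\|\eta^{in}+\omega^{in}\|_{H^{-1}_xH^2_y}+\sqrt{\tfrac{m_+}{T_+}}\,\langle t\rangle^{-3/2}\|\psi^{in}\|_{H^{-1/2}_xL^2_y}\Big],\end{aligned}$$ $$\|\mathbb Q[u](t)\|_{L^2}+\sqrt{\tfrac{T_+}{m_+}}\,\|\eta(t)\|_{L^2}\le C\,\langle t\rangle^{1/2}\Big(\big\|\sqrt{\tfrac{T_+}{m_+}}\,\eta^{in}\big\|_{L^2}+\|\psi^{in}\|_{H^{-1}}+\|\eta^{in}+\omega^{in}\|_{H^1}\Big).$$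 -/

import Mathlib

open MeasureTheory
open scoped ContDiff ENNReal FourierTransform

noncomputable section

namespace EulerPoisson

/-! Functions on the cylinder `𝕋 × ℝ`, `𝕋 = ℝ / 2πℤ`, are functions of `(x, y) : ℝ × ℝ` that are
`2π`-periodic in `x`; norms integrate over one period `0 < x ≤ 2π`. -/

/-- The measure `dx dy` on one period `(0, 2π] × ℝ` of the cylinder. -/
def cylMeasure : Measure (ℝ × ℝ) :=
  (volume.restrict (Set.Ioc 0 (2 * Real.pi))).prod volume

/-- The `L²(𝕋 × ℝ)` norm, with values in `[0, ∞]`. -/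
def l2Norm (f : ℝ → ℝ → ℝ) : ℝ≥0∞ :=
  eLpNorm (fun p : ℝ × ℝ => f p.1 p.2) 2 cylMeasure

/-- The average of `f` in the `x` direction. -/
def xAverage (f : ℝ → ℝ → ℝ) (y : ℝ) : ℝ :=
  (1 / (2 * Real.pi)) * ∫ x in (0 : ℝ)..(2 * Real.pi), f x y

/-- The `x`-mode `y ↦ ∫_𝕋 e^{-ikx} f(x, y) dx`. -/
def xMode (f : ℝ → ℝ → ℝ) (k : ℤ) (y : ℝ) : ℂ :=
  ∫ x in (0 : ℝ)..(2 * Real.pi), Complex.exp (-(Complex.I * k * x)) * (f x y : ℂ)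

/-- All `x`-modes of `f` are square integrable in `y`. -/
def HasL2Modes (f : ℝ → ℝ → ℝ) : Prop :=
  ∀ k : ℤ, MemLp (xMode f k) 2 (volume : Measure ℝ)

open Classical in
/-- The Fourier transform `f̂(k, ξ) = (2π)⁻¹ ∬ e^{-i(kx + ξy)} f(x, y) dx dy`. The integral in `y` is
the `L²(ℝ)` Fourier transform of the mode (Mathlib's kernel is `e^{-2πi yζ}`, so `ζ = ξ / 2π`).
It is only meaningful when `HasL2Modes f`, and only used then. -/
def fourierHat (f : ℝ → ℝ → ℝ) (k : ℤ) (ξ : ℝ) : ℂ :=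
  if h : MemLp (xMode f k) 2 (volume : Measure ℝ) then
    (1 / (2 * Real.pi) : ℂ) * (𝓕 (h.toLp (xMode f k)) : Lp ℂ 2 (volume : Measure ℝ)) (ξ / (2 * Real.pi))
  else 0

open Classical in
/-- The norm of the anisotropic Sobolev space `H^r_x H^s_y`, with values in `[0, ∞]`:
`‖f‖² = ∑_k ∫ ⟨k⟩^{2r} ⟨ξ⟩^{2s} |f̂(k, ξ)|² dξ`. It is set to `∞` when some `x`-mode is not in `L²(ℝ)`;
for `s ≥ 0` such an `f` is not in the space. -/
def anisoNorm (r s : ℝ) (f : ℝ → ℝ → ℝ) : ℝ≥0∞ :=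
  if HasL2Modes f then
    (∑' k : ℤ, ∫⁻ ξ : ℝ,
      ENNReal.ofReal ((1 + (k : ℝ) ^ 2) ^ r * (1 + ξ ^ 2) ^ s) * ‖fourierHat f k ξ‖ₑ ^ 2) ^ (1 / 2 : ℝ)
  else ⊤

open Classical in
/-- The norm of the isotropic Sobolev space `H^s`, with values in `[0, ∞]`:
`‖f‖² = ∑_k ∫ ⟨k, ξ⟩^{2s} |f̂(k, ξ)|² dξ`, with the same convention on modes. -/
def sobolevNorm (s : ℝ) (f : ℝ → ℝ → ℝ) : ℝ≥0∞ :=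
  if HasL2Modes f then
    (∑' k : ℤ, ∫⁻ ξ : ℝ,
      ENNReal.ofReal ((1 + (k : ℝ) ^ 2 + ξ ^ 2) ^ s) * ‖fourierHat f k ξ‖ₑ ^ 2) ^ (1 / 2 : ℝ)
  else ⊤

/-- `f ∈ H^r_x H^s_y`. -/
def MemAniso (r s : ℝ) (f : ℝ → ℝ → ℝ) : Prop := anisoNorm r s f < ⊤

/-- The divergence `∂_x v + ∂_y w` of the planar field `(v, w)`. -/
def divergence (v w : ℝ → ℝ → ℝ) (x y : ℝ) : ℝ :=
  deriv (fun x' => v x' y) x + deriv (fun y' => w x y') y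

/-- The vorticity `∇^⊥ · (v, w) = -∂_y v + ∂_x w` of the planar field `(v, w)`. -/
def vorticity (v w : ℝ → ℝ → ℝ) (x y : ℝ) : ℝ :=
  -deriv (fun y' => v x y') y + deriv (fun x' => w x' y) x

/-- The Laplacian `∂_xx f + ∂_yy f`. -/
def laplacian (f : ℝ → ℝ → ℝ) (x y : ℝ) : ℝ :=
  iteratedDeriv 2 (fun x' => f x' y) x + iteratedDeriv 2 (fun y' => f x y') y

/-! ### Helmholtz projections of an `L²` field `(v, w)`, on the Fourier side -/

/-- Fourier transform of `∇ · (v, w)`, that is, `ik v̂ + iξ ŵ`. -/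
def divHat (v w : ℝ → ℝ → ℝ) (k : ℤ) (ξ : ℝ) : ℂ :=
  Complex.I * k * fourierHat v k ξ + Complex.I * ξ * fourierHat w k ξ

/-- Fourier transform of `∇^⊥ · (v, w)`, that is, `-iξ v̂ + ik ŵ`. -/
def vortHat (v w : ℝ → ℝ → ℝ) (k : ℤ) (ξ : ℝ) : ℂ :=
  -(Complex.I * ξ) * fourierHat v k ξ + Complex.I * k * fourierHat w k ξ

/-- The Fourier multiplier of `Δ⁻¹`. -/
def invLaplaceSymbol (k : ℤ) (ξ : ℝ) : ℂ := -1 / ((k : ℂ) ^ 2 + (ξ : ℂ) ^ 2)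

/-- Fourier transform of `ℙ[(v, w)]^x = -∂_y Δ⁻¹ ∇^⊥ · (v, w)`. -/
def solenoidalXHat (v w : ℝ → ℝ → ℝ) (k : ℤ) (ξ : ℝ) : ℂ :=
  -(Complex.I * ξ) * (invLaplaceSymbol k ξ * vortHat v w k ξ)

/-- Fourier transform of `ℙ[(v, w)]^y = ∂_x Δ⁻¹ ∇^⊥ · (v, w)`. -/
def solenoidalYHat (v w : ℝ → ℝ → ℝ) (k : ℤ) (ξ : ℝ) : ℂ :=
  Complex.I * k * (invLaplaceSymbol k ξ * vortHat v w k ξ)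

/-- Fourier transform of `ℚ[(v, w)]^x = ∂_x Δ⁻¹ ∇ · (v, w)`. -/
def compressibleXHat (v w : ℝ → ℝ → ℝ) (k : ℤ) (ξ : ℝ) : ℂ :=
  Complex.I * k * (invLaplaceSymbol k ξ * divHat v w k ξ)

/-- Fourier transform of `ℚ[(v, w)]^y = ∂_y Δ⁻¹ ∇ · (v, w)`. -/
def compressibleYHat (v w : ℝ → ℝ → ℝ) (k : ℤ) (ξ : ℝ) : ℂ :=
  Complex.I * ξ * (invLaplaceSymbol k ξ * divHat v w k ξ)

/-- `‖ℙ[(v, w)]^x‖_{L²}`, by Plancherel (`f ↦ f̂` is an isometry of `L²(𝕋 × ℝ)` onto `L²(ℤ × ℝ)`). -/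
def solenoidalXNorm (v w : ℝ → ℝ → ℝ) : ℝ≥0∞ :=
  (∑' k : ℤ, ∫⁻ ξ : ℝ, ‖solenoidalXHat v w k ξ‖ₑ ^ 2) ^ (1 / 2 : ℝ)

/-- `‖ℙ[(v, w)]^y‖_{L²}`. -/
def solenoidalYNorm (v w : ℝ → ℝ → ℝ) : ℝ≥0∞ :=
  (∑' k : ℤ, ∫⁻ ξ : ℝ, ‖solenoidalYHat v w k ξ‖ₑ ^ 2) ^ (1 / 2 : ℝ)

/-- `‖ℚ[(v, w)]‖_{L²}` of the vector field `ℚ[(v, w)]`. -/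
def compressibleNorm (v w : ℝ → ℝ → ℝ) : ℝ≥0∞ :=
  (∑' k : ℤ, ∫⁻ ξ : ℝ,
    (‖compressibleXHat v w k ξ‖ₑ ^ 2 + ‖compressibleYHat v w k ξ‖ₑ ^ 2)) ^ (1 / 2 : ℝ)

/-! ### The linearized ion system -/

/-- `f(t, x, y)` is `C^∞` on `[0, ∞) × ℝ × ℝ`, up to and including `t = 0`, and `2π`-periodic
in `x`. -/
def SmoothOnCylinder (f : ℝ → ℝ → ℝ → ℝ) : Prop :=
  ContDiffOn ℝ ∞ (fun p : ℝ × ℝ × ℝ => f p.1 p.2.1 p.2.2) (Set.Ici 0 ×ˢ Set.univ) ∧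
    ∀ t x y : ℝ, 0 ≤ t → f t (x + 2 * Real.pi) y = f t x y

/-- `f ∈ L^∞_loc([0, ∞); L²(𝕋 × ℝ))`. -/
def LocallyBoundedInL2 (f : ℝ → ℝ → ℝ → ℝ) : Prop :=
  ∀ T : ℝ, ∃ M : ℝ, ∀ t : ℝ, 0 ≤ t → t ≤ T → l2Norm (f t) ≤ ENNReal.ofReal M

/-- `(η, u, φ)`, `u = (ux, uy)`, is a smooth finite-energy solution on `[0, ∞) × 𝕋 × ℝ` of the
linearized ion Euler–Poisson system around the Couette flow, with charge `e`, ion mass `m`, ion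
temperature `Tp` and electron temperature `Tm`. -/
structure IsSmoothSolution (e m Tp Tm : ℝ) (η ux uy φ : ℝ → ℝ → ℝ → ℝ) : Prop where
  smooth_η : SmoothOnCylinder η
  smooth_ux : SmoothOnCylinder ux
  smooth_uy : SmoothOnCylinder uy
  smooth_φ : SmoothOnCylinder φ
  l2_η : LocallyBoundedInL2 η
  l2_ux : LocallyBoundedInL2 ux
  l2_uy : LocallyBoundedInL2 uy
  l2_φ : LocallyBoundedInL2 φ
  /-- `∂_t η + y ∂_x η + ∇ · u = 0`. -/
  continuity_eq : ∀ t x y : ℝ, 0 < t →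
    deriv (fun s => η s x y) t + y * deriv (fun x' => η t x' y) x
      + divergence (ux t) (uy t) x y = 0
  /-- `∂_t u^x + y ∂_x u^x + u^y + (T₊/m) ∂_x η = -(e/m) ∂_x φ`. -/
  momentum_x : ∀ t x y : ℝ, 0 < t →
    deriv (fun s => ux s x y) t + y * deriv (fun x' => ux t x' y) x + uy t x y
      + (Tp / m) * deriv (fun x' => η t x' y) x
      = -(e / m) * deriv (fun x' => φ t x' y) x
  /-- `∂_t u^y + y ∂_x u^y + (T₊/m) ∂_y η = -(e/m) ∂_y φ`. -/
  momentum_y : ∀ t x y : ℝ, 0 < t →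
    deriv (fun s => uy s x y) t + y * deriv (fun x' => uy t x' y) x
      + (Tp / m) * deriv (fun y' => η t x y') y
      = -(e / m) * deriv (fun y' => φ t x y') y
  /-- `Δφ = 4πe ((e/T₋) φ - η)`. -/
  poisson_eq : ∀ t x y : ℝ, 0 ≤ t →
    laplacian (φ t) x y = 4 * Real.pi * e * ((e / Tm) * φ t x y - η t x y)

/-- The bracket `⟨a⟩ = (1 + a²)^{1/2}`. -/
def bracket (a : ℝ) : ℝ := Real.sqrt (1 + a ^ 2)

/-- A real power `⟨t⟩^p` as an extended nonnegative number. -/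
def bracketPow (t p : ℝ) : ℝ≥0∞ := ENNReal.ofReal (bracket t ^ p)

end EulerPoisson

end

/-!
The proof is an energy estimate for each Fourier mode, in the frame moving with the Couette flow.

At time `t` the flow has carried the frequency `(k, ξ)` to `(k, ξ - kt)`, of squared length
`p = k² + (ξ - kt)²`. Write `N`, `Ψ`, `Ω` for the transforms of the density, the divergence and the
vorticity there. The sum `Γ = N + Ω` is conserved, Poisson's equation expresses the potential by
`N`, and what remains is an oscillator
`N' = -Ψ`, `Ψ' = 2νΨ + PN - 2(k²/p)Γ`, where `ν = -k(ξ - kt)/p = p'/(2p)` and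
`P = p (T₊/m₊ + κ/(p + d)) + 2k²/p`, with `κ = 4πe²/m₊` and `d = 4πe²/T₋`.
To leading order the energy `P N² + Ψ²` grows at the average rate `3ν`. Hence the weight `p^(-3/2)`,
and the cross term `ν N Ψ`, which removes the oscillating part of the rate. The growth rate that is
left is a multiple of `k²/p`, the time derivative of `arctan (t - ξ/k)`, so its integral is bounded
uniformly in the frequency. This is `mode_energy_bound`: `p^(-1/2) N² + p^(-3/2) Ψ²` is bounded by
its initial value and `|k|⁻³ Γ²`.

The solution only has finite energy: at a fixed frequency its transform is not a
classical function of time. The equations are therefore localized by a cutoff in `y`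
(`localized_mode_bound`). The localized transforms solve the equations of the mode up to terms with
derivatives of the cutoff. These vanish in `L²` of the frequency as the cutoff widens, and the
estimate passes to the limit for almost every frequency, along a subsequence
(`ae_exists_cutoff_seq`, `mode_estimate_ae`). The modes `k = 0` have no such estimate. The averages
of the velocity vanish initially, being constant in `y` and square integrable, and a crude Grönwall
argument keeps the modes zero (`zero_mode_ae`).

The decay comes from `k⁴ (1 + t²) ≤ 2 p p₀` and the growth from `p ≤ 2 (1 + t²) p₀`, where `p₀` is
the value of `p` at time `0`: a negative power of `p` is traded for decay in time at the price of
derivatives of the data (`WeightRelations`, `mode_decay_ae`). Plancherel's theorem turns the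
pointwise bounds into bounds of the norms.
-/

/-! ### Energy estimate for a single Fourier mode -/

namespace EulerPoisson

open Set

/-- Grönwall's inequality with an integrating factor `exp (-a)` whose exponent is bounded by `A`. -/
theorem gronwall_bounded_exponent {t A : ℝ} (ht : 0 ≤ t) {H H' a a' F : ℝ → ℝ}
    (hHc : Continuous H) (hac : Continuous a) (hFc : Continuous F)
    (hH : ∀ s ∈ Ioo 0 t, HasDerivAt H (H' s) s) (ha : ∀ s ∈ Ioo 0 t, HasDerivAt a (a' s) s)
    (hA : ∀ s ∈ Icc 0 t, |a s| ≤ A) (hF : ∀ s, 0 ≤ F s)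
    (hle : ∀ s ∈ Ioo 0 t, H' s ≤ a' s * H s + F s) (H0 : 0 ≤ H 0) :
    H t ≤ Real.exp (2 * A) * (H 0 + ∫ s in (0 : ℝ)..t, F s) := by
  set K : ℝ → ℝ := fun s => H s * Real.exp (-a s) - Real.exp A * ∫ r in (0 : ℝ)..s, F r with hK
  have hKc : ContinuousOn K (Icc 0 t) := by
    apply Continuous.continuousOn
    have : Continuous fun s => ∫ r in (0 : ℝ)..s, F r :=
      intervalIntegral.continuous_primitive (fun _ _ => hFc.intervalIntegrable _ _) 0
    fun_prop
  have hKd : ∀ s ∈ Ioo 0 t, HasDerivAt K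
      (H' s * Real.exp (-a s) + H s * (Real.exp (-a s) * (-a' s)) - Real.exp A * F s) s := by
    intro s hs
    have h1 := (hH s hs).mul ((ha s hs).neg.exp)
    have h2 := (intervalIntegral.integral_hasDerivAt_right (hFc.intervalIntegrable 0 s)
      (hFc.stronglyMeasurableAtFilter _ _) hFc.continuousAt).const_mul (Real.exp A)
    exact h1.sub h2
  have hanti : AntitoneOn K (Icc 0 t) := by
    apply antitoneOn_of_deriv_nonpos (convex_Icc 0 t) hKc
    · intro s hs
      rw [interior_Icc] at hs
      exact (hKd s hs).differentiableAt.differentiableWithinAt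
    · intro s hs
      rw [interior_Icc] at hs
      rw [(hKd s hs).deriv]
      have hb := hA s (Ioo_subset_Icc_self hs)
      have h1 : Real.exp (-a s) ≤ Real.exp A :=
        Real.exp_le_exp.2 (by linarith [neg_abs_le (a s)])
      have h2 : (H' s - a' s * H s) * Real.exp (-a s) ≤ F s * Real.exp (-a s) :=
        mul_le_mul_of_nonneg_right (by linarith [hle s hs]) (Real.exp_pos _).le
      have h3 : F s * Real.exp (-a s) ≤ F s * Real.exp A :=
        mul_le_mul_of_nonneg_left h1 (hF s)
      nlinarith
  have h0t := hanti (left_mem_Icc.2 ht) (right_mem_Icc.2 ht) ht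
  simp only [hK, intervalIntegral.integral_same, mul_zero, sub_zero] at h0t
  have hI : 0 ≤ ∫ r in (0 : ℝ)..t, F r :=
    intervalIntegral.integral_nonneg ht fun s _ => hF s
  have e0 : Real.exp (-a 0) ≤ Real.exp A :=
    Real.exp_le_exp.2 (by linarith [neg_abs_le (a 0), hA 0 (left_mem_Icc.2 ht)])
  have et : Real.exp (a t) ≤ Real.exp A :=
    Real.exp_le_exp.2 (by linarith [le_abs_self (a t), hA t (right_mem_Icc.2 ht)])
  have h5 : H t * Real.exp (-a t) ≤ Real.exp A * (H 0 + ∫ r in (0 : ℝ)..t, F r) := by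
    nlinarith [mul_le_mul_of_nonneg_left e0 H0]
  calc H t = (H t * Real.exp (-a t)) * Real.exp (a t) := by
        rw [mul_assoc, ← Real.exp_add]; simp
    _ ≤ (Real.exp A * (H 0 + ∫ r in (0 : ℝ)..t, F r)) * Real.exp (a t) :=
        mul_le_mul_of_nonneg_right h5 (Real.exp_pos _).le
    _ ≤ (Real.exp A * (H 0 + ∫ r in (0 : ℝ)..t, F r)) * Real.exp A :=
        mul_le_mul_of_nonneg_left et (mul_nonneg (Real.exp_pos _).le (by linarith))
    _ = _ := by rw [two_mul, Real.exp_add]; ring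

/-- The squared length `k² + (ξ - ks)²` of the frequency which, at time `s`, the Couette flow has
carried the frequency `(k, ξ)` to. -/
noncomputable def shearSq (k ξ s : ℝ) : ℝ := k ^ 2 + (ξ - k * s) ^ 2

/-- The squared sound speed `c2 + κ / (p + d)` at a frequency of squared length `p`: the thermal
part and the part due to the electric field. -/
noncomputable def soundSq (c2 κ d p : ℝ) : ℝ := c2 + κ / (p + d)

/-- Coefficient of `N` in the equation for `Ψ`. The term `2 k² / p` comes from writing the vorticity
as `Γ - N`. -/
noncomputable def pressureCoeff (c2 κ d k ξ s : ℝ) : ℝ :=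
  shearSq k ξ s * soundSq c2 κ d (shearSq k ξ s) + 2 * k ^ 2 / shearSq k ξ s

/-- Half the logarithmic derivative in time of `shearSq`. -/
noncomputable def shearRate (k ξ s : ℝ) : ℝ := -(k * (ξ - k * s)) / shearSq k ξ s

/-- The modified energy density `P N² + Ψ² + ν N Ψ`. With the cross term the growth rate is `3 ν`
up to a multiple of `k² / shearSq`, which is integrable in time. -/
noncomputable def modeEnergy (c2 κ d k ξ s N Ψ : ℝ) : ℝ :=
  pressureCoeff c2 κ d k ξ s * N ^ 2 + Ψ ^ 2 + shearRate k ξ s * N * Ψ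

section
variable {c2 κ d k ξ s : ℝ}

theorem shearSq_ge (k ξ s : ℝ) : k ^ 2 ≤ shearSq k ξ s := by
  unfold shearSq; nlinarith [sq_nonneg (ξ - k * s)]

theorem shearSq_pos (hk : 1 ≤ k ^ 2) : 0 < shearSq k ξ s := by
  linarith [shearSq_ge k ξ s]

theorem shearRate_sq_le (hk : 1 ≤ k ^ 2) : shearRate k ξ s ^ 2 ≤ k ^ 2 / shearSq k ξ s := by
  have hp := shearSq_pos (ξ := ξ) (s := s) hk
  unfold shearRate
  rw [div_pow, div_le_div_iff₀ (by positivity) hp]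
  have : (ξ - k * s) ^ 2 ≤ shearSq k ξ s := by unfold shearSq; nlinarith
  have h2 : (-(k * (ξ - k * s))) ^ 2 ≤ k ^ 2 * shearSq k ξ s := by
    nlinarith [sq_nonneg k]
  nlinarith

theorem pressureCoeff_ge (hκ : 0 ≤ κ) (hd : 0 ≤ d) (hk : 1 ≤ k ^ 2) :
    c2 * shearSq k ξ s + 2 * (k ^ 2 / shearSq k ξ s) ≤ pressureCoeff c2 κ d k ξ s := by
  have hp := shearSq_pos (ξ := ξ) (s := s) hk
  have : 0 ≤ shearSq k ξ s * (κ / (shearSq k ξ s + d)) := by positivity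
  unfold pressureCoeff soundSq
  rw [mul_div_assoc]
  nlinarith

theorem pressureCoeff_le (hκ : 0 ≤ κ) (hd : 0 ≤ d) (hk : 1 ≤ k ^ 2) :
    pressureCoeff c2 κ d k ξ s ≤ (c2 + κ + 2) * shearSq k ξ s := by
  have hge := shearSq_ge k ξ s
  have hp := shearSq_pos (ξ := ξ) (s := s) hk
  have h1 : κ / (shearSq k ξ s + d) ≤ κ := div_le_self hκ (by linarith)
  have h2 : 2 * k ^ 2 / shearSq k ξ s ≤ 2 * shearSq k ξ s := by
    rw [div_le_iff₀ hp]; nlinarith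
  unfold pressureCoeff soundSq
  nlinarith

theorem modeEnergy_ge (hκ : 0 ≤ κ) (hd : 0 ≤ d) (hk : 1 ≤ k ^ 2) (N Ψ : ℝ) :
    c2 * shearSq k ξ s * N ^ 2 + Ψ ^ 2 / 2 ≤ modeEnergy c2 κ d k ξ s N Ψ := by
  have h1 := pressureCoeff_ge (c2 := c2) (ξ := ξ) (s := s) hκ hd hk
  have h2 := shearRate_sq_le (ξ := ξ) (s := s) hk
  unfold modeEnergy
  have h3 := mul_le_mul_of_nonneg_right h1 (sq_nonneg N)
  have h4 := mul_le_mul_of_nonneg_right h2 (sq_nonneg N)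
  nlinarith [sq_nonneg (shearRate k ξ s * N + Ψ), sq_nonneg (shearRate k ξ s * N)]

theorem shearRate_sq_le_one (hk : 1 ≤ k ^ 2) : shearRate k ξ s ^ 2 ≤ 1 :=
  (shearRate_sq_le hk).trans (div_le_one_of_le₀ (shearSq_ge k ξ s) (shearSq_pos hk).le)

theorem modeEnergy_le (hκ : 0 ≤ κ) (hd : 0 ≤ d) (hk : 1 ≤ k ^ 2) (N Ψ : ℝ) :
    modeEnergy c2 κ d k ξ s N Ψ ≤ (c2 + κ + 3) * shearSq k ξ s * N ^ 2 + 2 * Ψ ^ 2 := by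
  have h1 := pressureCoeff_le (c2 := c2) (ξ := ξ) (s := s) hκ hd hk
  have h2 := shearRate_sq_le_one (ξ := ξ) (s := s) hk
  have hge := shearSq_ge k ξ s
  unfold modeEnergy
  have h3 := mul_le_mul_of_nonneg_right h1 (sq_nonneg N)
  have h4 := mul_le_mul_of_nonneg_right h2 (sq_nonneg N)
  have h5 : N ^ 2 ≤ shearSq k ξ s * N ^ 2 := by nlinarith [sq_nonneg N]
  nlinarith [sq_nonneg (shearRate k ξ s * N - Ψ), sq_nonneg (shearRate k ξ s * N)]

theorem hasDerivAt_shearSq (k ξ s : ℝ) :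
    HasDerivAt (shearSq k ξ) (-2 * k * (ξ - k * s)) s := by
  have h : HasDerivAt (fun s => ξ - k * s) (-k) s := by
    simpa using ((hasDerivAt_id s).const_mul k).const_sub ξ
  have := (h.pow 2).const_add (k ^ 2)
  refine this.congr_deriv ?_
  simp; ring

theorem hasDerivAt_shearRate (hk : 1 ≤ k ^ 2) :
    HasDerivAt (shearRate k ξ)
      (k ^ 2 / shearSq k ξ s - 2 * k ^ 2 * (ξ - k * s) ^ 2 / shearSq k ξ s ^ 2) s := by
  have h : HasDerivAt (fun s => -(k * (ξ - k * s))) (k ^ 2) s := by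
    have := ((((hasDerivAt_id s).const_mul k).const_sub ξ).const_mul k).neg
    refine this.congr_deriv ?_
    simp; ring
  have hp := shearSq_pos (ξ := ξ) (s := s) hk
  refine (h.div (hasDerivAt_shearSq k ξ s) hp.ne').congr_deriv ?_
  field_simp

theorem hasDerivAt_pressureCoeff (hd : 0 ≤ d) (hk : 1 ≤ k ^ 2) :
    HasDerivAt (pressureCoeff c2 κ d k ξ)
      (2 * shearRate k ξ s * pressureCoeff c2 κ d k ξ s
        + (2 * k * (ξ - k * s)) * (shearSq k ξ s * κ / (shearSq k ξ s + d) ^ 2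
          + 4 * k ^ 2 / shearSq k ξ s ^ 2)) s := by
  have hp := shearSq_pos (ξ := ξ) (s := s) hk
  have hpd : shearSq k ξ s + d ≠ 0 := by positivity
  have h := hasDerivAt_shearSq k ξ s
  have h1 := h.mul (((hasDerivAt_const s κ).div (h.add_const d) hpd).const_add c2)
  have h2 := (hasDerivAt_const s (2 * k ^ 2)).div h hp.ne'
  refine (h1.add h2).congr_deriv ?_
  simp only [shearRate, pressureCoeff, soundSq, Pi.div_apply]
  field_simp
  ring

/-- The part of the growth rate of the modified energy that does not come from the forcing. -/
theorem modeEnergy_rate_le (hc2 : 0 < c2) (hκ : 0 ≤ κ) (hd : 0 ≤ d) (hk : 1 ≤ k ^ 2)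
    (N Ψ Γ : ℝ) :
    (2 * k * (ξ - k * s)) * (shearSq k ξ s * κ / (shearSq k ξ s + d) ^ 2
          + 4 * k ^ 2 / shearSq k ξ s ^ 2) * N ^ 2
      + (k ^ 2 / shearSq k ξ s - 2 * k ^ 2 * (ξ - k * s) ^ 2 / shearSq k ξ s ^ 2
          - shearRate k ξ s ^ 2) * N * Ψ
      - 2 * (k ^ 2 / shearSq k ξ s) * Γ * (2 * Ψ + shearRate k ξ s * N)
    ≤ (k ^ 2 / shearSq k ξ s) *
      (((κ + 6) / c2 + 6) * modeEnergy c2 κ d k ξ s N Ψ + 3 * Γ ^ 2) := by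
  have hp := shearSq_pos (ξ := ξ) (s := s) hk
  have hge := shearSq_ge k ξ s
  have hE := modeEnergy_ge (c2 := c2) (ξ := ξ) (s := s) hκ hd hk N Ψ
  have hν1 := shearRate_sq_le_one (ξ := ξ) (s := s) hk
  have hν := shearRate_sq_le (ξ := ξ) (s := s) hk
  have hq : 2 * |k * (ξ - k * s)| ≤ shearSq k ξ s := by
    unfold shearSq
    rw [abs_mul]
    nlinarith [sq_nonneg (|k| - |ξ - k * s|), sq_abs k, sq_abs (ξ - k * s)]
  set p := shearSq k ξ s with hpdef
  set μ := k ^ 2 / p with hμ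
  set ν := shearRate k ξ s with hνdef
  have hμ0 : 0 ≤ μ := by positivity
  have hμp : μ * p = k ^ 2 := by rw [hμ]; field_simp
  -- the coefficient of `N ^ 2`
  have t1 : (2 * k * (ξ - k * s)) * (p * κ / (p + d) ^ 2 + 4 * k ^ 2 / p ^ 2)
      ≤ (κ + 4) * k ^ 2 := by
    have a1 : p * κ / (p + d) ^ 2 ≤ κ / p := by
      rw [div_le_div_iff₀ (by positivity) hp]
      nlinarith [mul_nonneg hκ hd, mul_nonneg (mul_nonneg hκ hd) hp.le,
        mul_nonneg hκ (sq_nonneg d)]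
    have a2 : 4 * k ^ 2 / p ^ 2 ≤ 4 / p := by
      rw [div_le_div_iff₀ (by positivity) hp]; nlinarith
    have a3 : 2 * k * (ξ - k * s) ≤ p := by
      nlinarith [le_abs_self (k * (ξ - k * s))]
    have a4 : 0 ≤ p * κ / (p + d) ^ 2 + 4 * k ^ 2 / p ^ 2 := by positivity
    calc _ ≤ p * (p * κ / (p + d) ^ 2 + 4 * k ^ 2 / p ^ 2) :=
          mul_le_mul_of_nonneg_right a3 a4
      _ ≤ p * (κ / p + 4 / p) := mul_le_mul_of_nonneg_left (by linarith) hp.le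
      _ = κ + 4 := by field_simp
      _ ≤ (κ + 4) * k ^ 2 := by nlinarith
  have t1' := mul_le_mul_of_nonneg_right t1 (sq_nonneg N)
  -- the coefficient of `N * Ψ`
  have hν2 : ν ^ 2 = k ^ 2 * (ξ - k * s) ^ 2 / p ^ 2 := by
    rw [hνdef]; unfold shearRate; rw [div_pow]; ring
  have t2 : |μ - 2 * k ^ 2 * (ξ - k * s) ^ 2 / p ^ 2 - ν ^ 2| ≤ 2 * μ := by
    have : 2 * k ^ 2 * (ξ - k * s) ^ 2 / p ^ 2 = 2 * ν ^ 2 := by rw [hν2]; ring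
    rw [this, abs_le]
    constructor <;> nlinarith [sq_nonneg ν]
  have t2' : (μ - 2 * k ^ 2 * (ξ - k * s) ^ 2 / p ^ 2 - ν ^ 2) * N * Ψ
      ≤ μ * (N ^ 2 + Ψ ^ 2) := by
    have h1 := le_abs_self ((μ - 2 * k ^ 2 * (ξ - k * s) ^ 2 / p ^ 2 - ν ^ 2) * N * Ψ)
    rw [abs_mul, abs_mul] at h1
    have h2 : |μ - 2 * k ^ 2 * (ξ - k * s) ^ 2 / p ^ 2 - ν ^ 2| * (|N| * |Ψ|)
        ≤ 2 * μ * (|N| * |Ψ|) := mul_le_mul_of_nonneg_right t2 (by positivity)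
    have h3 : 2 * (|N| * |Ψ|) ≤ N ^ 2 + Ψ ^ 2 := by
      nlinarith [sq_nonneg (|N| - |Ψ|), sq_abs N, sq_abs Ψ]
    linarith [mul_le_mul_of_nonneg_left h3 hμ0]
  have t3 : - 2 * μ * Γ * (2 * Ψ + ν * N) ≤ μ * (3 * Γ ^ 2 + 2 * Ψ ^ 2 + N ^ 2) := by
    have : -2 * Γ * (2 * Ψ + ν * N) ≤ 3 * Γ ^ 2 + 2 * Ψ ^ 2 + N ^ 2 := by
      have : (ν * N) ^ 2 ≤ N ^ 2 := by
        rw [mul_pow]; nlinarith [sq_nonneg N]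
      have e : 2 * (Γ + Ψ) ^ 2 + (Γ + ν * N) ^ 2
          = 3 * Γ ^ 2 + 2 * Ψ ^ 2 + (ν * N) ^ 2 + 2 * Γ * (2 * Ψ + ν * N) := by ring
      linarith [sq_nonneg (Γ + Ψ), sq_nonneg (Γ + ν * N)]
    linarith [mul_le_mul_of_nonneg_left this hμ0]
  have hNp : N ^ 2 ≤ p * N ^ 2 := le_mul_of_one_le_left (sq_nonneg N) (hk.trans hge)
  have t4 : (κ + 6) * p * N ^ 2 + 3 * Ψ ^ 2 ≤
      ((κ + 6) / c2 + 6) * modeEnergy c2 κ d k ξ s N Ψ := by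
    have hx : 0 ≤ (κ + 6) / c2 := by positivity
    have b1 := mul_le_mul_of_nonneg_left hE (show 0 ≤ (κ + 6) / c2 + 6 by positivity)
    have b2 : (κ + 6) / c2 * (c2 * p * N ^ 2) = (κ + 6) * p * N ^ 2 := by field_simp
    have b3 : 0 ≤ c2 * p * N ^ 2 := by positivity
    have b4 := mul_nonneg hx (sq_nonneg Ψ)
    have b5 : ((κ + 6) / c2 + 6) * (c2 * p * N ^ 2 + Ψ ^ 2 / 2)
        = (κ + 6) * p * N ^ 2 + 6 * (c2 * p * N ^ 2) + ((κ + 6) / c2 * Ψ ^ 2) / 2 + 3 * Ψ ^ 2 := by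
      rw [← b2]; ring
    linarith
  have t5 := mul_le_mul_of_nonneg_left t4 hμ0
  have t6 := mul_le_mul_of_nonneg_left hNp hμ0
  have t7 : μ * ((κ + 6) * p * N ^ 2) = (κ + 6) * k ^ 2 * N ^ 2 := by rw [← hμp]; ring
  have t8 : μ * p * N ^ 2 = k ^ 2 * N ^ 2 := by rw [hμp]
  have t9 : μ * ((κ + 6) * p * N ^ 2 + 3 * Ψ ^ 2)
      = (κ + 6) * k ^ 2 * N ^ 2 + 3 * (μ * Ψ ^ 2) := by rw [mul_add, t7]; ring
  have t10 : μ * (p * N ^ 2) = k ^ 2 * N ^ 2 := by rw [← t8]; ring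
  linarith
end

/-- The contribution of the forcing to the growth rate of the modified energy. -/
theorem modeEnergy_forcing_le {c2 κ d k ξ s : ℝ} (hc2 : 0 < c2) (hκ : 0 ≤ κ) (hd : 0 ≤ d)
    (hk : 1 ≤ k ^ 2) (N Ψ f g : ℝ) :
    2 * pressureCoeff c2 κ d k ξ s * N * f + 2 * Ψ * g + shearRate k ξ s * (f * Ψ + N * g)
    ≤ (k ^ 2 / shearSq k ξ s) * ((2 / c2 + 4) * modeEnergy c2 κ d k ξ s N Ψ)
      + ((pressureCoeff c2 κ d k ξ s ^ 2 + 2) / (k ^ 2 / shearSq k ξ s)) * (f ^ 2 + g ^ 2) := by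
  have hp := shearSq_pos (ξ := ξ) (s := s) hk
  have hE := modeEnergy_ge (c2 := c2) (ξ := ξ) (s := s) hκ hd hk N Ψ
  have hν1 := shearRate_sq_le_one (ξ := ξ) (s := s) hk
  have hp1 : 1 ≤ shearSq k ξ s := hk.trans (shearSq_ge k ξ s)
  have hμ : 0 < k ^ 2 / shearSq k ξ s := by positivity
  generalize hQ : modeEnergy c2 κ d k ξ s N Ψ = Q at *
  generalize pressureCoeff c2 κ d k ξ s = P at *
  generalize shearRate k ξ s = ν at *
  generalize k ^ 2 / shearSq k ξ s = μ at *
  generalize shearSq k ξ s = p at *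
  -- the quadratic inequality `2 x y ≤ μ x ^ 2 + y ^ 2 / μ`
  have amgm : ∀ x y : ℝ, 2 * x * y ≤ μ * x ^ 2 + y ^ 2 / μ := by
    intro x y
    have : μ * x ^ 2 + y ^ 2 / μ - 2 * x * y = (μ * x - y) ^ 2 / μ := by field_simp; ring
    have := div_nonneg (sq_nonneg (μ * x - y)) hμ.le
    linarith
  have h1 := amgm N (P * f)
  have h2 := amgm Ψ g
  have h3 := amgm Ψ (ν * f)
  have h4 := amgm N (ν * g)
  have n1 : (ν * f) ^ 2 / μ ≤ f ^ 2 / μ := by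
    apply div_le_div_of_nonneg_right _ hμ.le
    rw [mul_pow]; nlinarith [sq_nonneg f]
  have n2 : (ν * g) ^ 2 / μ ≤ g ^ 2 / μ := by
    apply div_le_div_of_nonneg_right _ hμ.le
    rw [mul_pow]; nlinarith [sq_nonneg g]
  have m0 : N ^ 2 + Ψ ^ 2 ≤ (1 / c2 + 2) * Q := by
    have a1 : N ^ 2 ≤ p * N ^ 2 := le_mul_of_one_le_left (sq_nonneg N) hp1
    have a2 := mul_le_mul_of_nonneg_left hE (show 0 ≤ 1 / c2 + 2 by positivity)
    have a3 : (1 / c2 + 2) * (c2 * p * N ^ 2 + Ψ ^ 2 / 2)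
        = p * N ^ 2 + 2 * (c2 * (p * N ^ 2)) + 1 / c2 * Ψ ^ 2 / 2 + Ψ ^ 2 := by
      field_simp; ring
    have a4 : 0 ≤ 1 / c2 * Ψ ^ 2 := by positivity
    have a5 : 0 ≤ c2 * (p * N ^ 2) := by positivity
    linarith
  have m1 := mul_le_mul_of_nonneg_left m0 (show 0 ≤ 2 * μ by positivity)
  have e1 : (P ^ 2 + 2) / μ * (f ^ 2 + g ^ 2)
      = (P * f) ^ 2 / μ + P ^ 2 * g ^ 2 / μ + 2 * (f ^ 2 / μ) + 2 * (g ^ 2 / μ) := by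
    field_simp; ring
  have e2 : 0 ≤ P ^ 2 * g ^ 2 / μ := by positivity
  have e3 : 0 ≤ f ^ 2 / μ := by positivity
  have e4 : 0 ≤ g ^ 2 / μ := by positivity
  have e5 : 0 ≤ μ * N ^ 2 := by positivity
  have e6 : 0 ≤ μ * Ψ ^ 2 := by positivity
  have e7 : μ * ((2 / c2 + 4) * Q) = 2 * μ * ((1 / c2 + 2) * Q) := by ring
  nlinarith

set_option maxHeartbeats 1000000 in
/-- Energy estimate for a single Fourier mode of the linearized system, with forcing. The constant
`C` is uniform in the frequency and in time; the constant `L` in front of the forcing is not. -/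
theorem mode_energy_bound {c2 κ d : ℝ} (hc2 : 0 < c2) (hκ : 0 ≤ κ) (hd : 0 ≤ d) :
    ∃ C : ℝ, 0 < C ∧ ∀ k ξ t : ℝ, 1 ≤ k ^ 2 → 0 ≤ t → ∃ L : ℝ, 0 ≤ L ∧
      ∀ N Ψ Γ f g h : ℝ → ℝ, Continuous N → Continuous Ψ → Continuous Γ →
        Continuous f → Continuous g → Continuous h →
        (∀ s ∈ Ioo 0 t, HasDerivAt N (-Ψ s + f s) s) →
        (∀ s ∈ Ioo 0 t, HasDerivAt Ψ (2 * shearRate k ξ s * Ψ s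
          + pressureCoeff c2 κ d k ξ s * N s - 2 * (k ^ 2 / shearSq k ξ s) * Γ s + g s) s) →
        (∀ s ∈ Ioo 0 t, HasDerivAt Γ (h s) s) →
        shearSq k ξ t ^ (-3 / 2 : ℝ) * (shearSq k ξ t * N t ^ 2 + Ψ t ^ 2)
            + (k ^ 2) ^ (-3 / 2 : ℝ) * Γ t ^ 2
          ≤ C * (shearSq k ξ 0 ^ (-3 / 2 : ℝ) * (shearSq k ξ 0 * N 0 ^ 2 + Ψ 0 ^ 2)
            + (k ^ 2) ^ (-3 / 2 : ℝ) * Γ 0 ^ 2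
            + L * ∫ s in (0 : ℝ)..t, (f s ^ 2 + g s ^ 2 + h s ^ 2)) := by
  set C1 : ℝ := ((κ + 6) / c2 + 6) + (2 / c2 + 4) with hC1
  have hC10 : 0 < C1 := by positivity
  set M : ℝ := c2 + κ + 3 with hM
  -- constant of the lower bound for the energy
  set m : ℝ := 1 / c2 + 2 with hm
  refine ⟨(m + 1) * Real.exp (2 * (C1 * (Real.pi / 2))) * (M + 3), by positivity, ?_⟩
  intro k ξ t hk ht
  have hk0 : k ≠ 0 := by rintro rfl; norm_num at hk
  have hpc : Continuous (shearSq k ξ) := by unfold shearSq; fun_prop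
  have hp : ∀ s, 0 < shearSq k ξ s := fun s => shearSq_pos hk
  have hPc : Continuous (pressureCoeff c2 κ d k ξ) := by
    unfold pressureCoeff soundSq
    have : ∀ s, shearSq k ξ s + d ≠ 0 := fun s => by have := hp s; positivity
    have h2 : ∀ s, shearSq k ξ s ≠ 0 := fun s => (hp s).ne'
    fun_prop (disch := assumption)
  set Λ : ℝ → ℝ := fun s => (pressureCoeff c2 κ d k ξ s ^ 2 + 2) / (k ^ 2 / shearSq k ξ s)
    with hΛ
  have hΛc : Continuous Λ := by
    have h2 : ∀ s, shearSq k ξ s ≠ 0 := fun s => (hp s).ne'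
    have h3 : ∀ s, k ^ 2 / shearSq k ξ s ≠ 0 := fun s => by have := hp s; positivity
    fun_prop (disch := assumption)
  obtain ⟨L, hL⟩ := (isCompact_Icc (a := (0 : ℝ)) (b := t)).exists_bound_of_continuousOn
    hΛc.continuousOn
  have hL0 : 0 ≤ L := (norm_nonneg _).trans (hL 0 (left_mem_Icc.2 ht))
  refine ⟨L, hL0, ?_⟩
  intro N Ψ Γ f g h hN hΨ hΓ hf hg hh dN dΨ dΓ
  have hνc : Continuous (shearRate k ξ) := by
    unfold shearRate
    have h2 : ∀ s, shearSq k ξ s ≠ 0 := fun s => (hp s).ne'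
    fun_prop (disch := assumption)
  set w : ℝ → ℝ := fun s => shearSq k ξ s ^ (-3 / 2 : ℝ) with hw
  have hwc : Continuous w := hpc.rpow_const fun s => Or.inl (hp s).ne'
  have hw0 : ∀ s, 0 < w s := fun s => Real.rpow_pos_of_pos (hp s) _
  set b : ℝ := (k ^ 2) ^ (-3 / 2 : ℝ) with hb
  have hwb : ∀ s, w s ≤ b := fun s =>
    Real.rpow_le_rpow_of_nonpos (by positivity) (shearSq_ge k ξ s) (by norm_num)
  have hb1 : b ≤ 1 := Real.rpow_le_one_of_one_le_of_nonpos hk (by norm_num)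
  have hb0 : 0 < b := Real.rpow_pos_of_pos (by positivity) _
  set Q : ℝ → ℝ := fun s => modeEnergy c2 κ d k ξ s (N s) (Ψ s) with hQ
  have hQc : Continuous Q := by
    simp only [hQ, modeEnergy]; fun_prop
  have hQ0 : ∀ s, 0 ≤ Q s := fun s => by
    have := modeEnergy_ge (c2 := c2) (ξ := ξ) (s := s) hκ hd hk (N s) (Ψ s)
    refine le_trans ?_ this
    have := hp s
    positivity
  have dw : ∀ s, HasDerivAt w (-3 * shearRate k ξ s * w s) s := by
    intro s
    refine ((hasDerivAt_shearSq k ξ s).rpow_const (Or.inl (hp s).ne')).congr_deriv ?_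
    rw [Real.rpow_sub_one (hp s).ne']
    simp only [hw, shearRate]
    have := (hp s).ne'
    field_simp
  have dQ : ∀ s ∈ Ioo 0 t, HasDerivAt Q
      (3 * shearRate k ξ s * Q s
        + ((2 * k * (ξ - k * s)) * (shearSq k ξ s * κ / (shearSq k ξ s + d) ^ 2
          + 4 * k ^ 2 / shearSq k ξ s ^ 2) * N s ^ 2
          + (k ^ 2 / shearSq k ξ s - 2 * k ^ 2 * (ξ - k * s) ^ 2 / shearSq k ξ s ^ 2
          - shearRate k ξ s ^ 2) * N s * Ψ s
          - 2 * (k ^ 2 / shearSq k ξ s) * Γ s * (2 * Ψ s + shearRate k ξ s * N s))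
        + (2 * pressureCoeff c2 κ d k ξ s * N s * f s + 2 * Ψ s * g s
          + shearRate k ξ s * (f s * Ψ s + N s * g s))) s := by
    intro s hs
    have d1 := (hasDerivAt_pressureCoeff (c2 := c2) (κ := κ) (ξ := ξ) (s := s) hd hk).mul
      ((dN s hs).pow 2)
    have d2 := (dΨ s hs).pow 2
    have d3 := ((hasDerivAt_shearRate (ξ := ξ) (s := s) hk).mul (dN s hs)).mul (dΨ s hs)
    refine ((d1.add d2).add d3).congr_deriv ?_
    simp only [hQ, modeEnergy, Pi.mul_apply, Pi.pow_apply]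
    generalize pressureCoeff c2 κ d k ξ s = P
    generalize shearRate k ξ s = ν
    generalize k ^ 2 / shearSq k ξ s = μ
    push_cast
    ring
  -- the remaining growth rate `k² / shearSq` is the derivative of a bounded function
  have key := gronwall_bounded_exponent ht (A := C1 * (Real.pi / 2))
    (H := fun s => w s * Q s + b * Γ s ^ 2) (a := fun s => C1 * Real.arctan ((k * s - ξ) / k))
    (a' := fun s => C1 * (k ^ 2 / shearSq k ξ s))
    (F := fun s => L * (f s ^ 2 + g s ^ 2 + h s ^ 2))
    (by fun_prop) (by fun_prop) (by fun_prop)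
    (fun s hs => ((dw s).mul (dQ s hs)).add (((dΓ s hs).pow 2).const_mul b))
    (by
      intro s _
      have : HasDerivAt (fun s => (k * s - ξ) / k) 1 s := by
        have := (((hasDerivAt_id s).const_mul k).sub_const ξ).div_const k
        refine this.congr_deriv ?_
        field_simp
      refine (this.arctan.const_mul C1).congr_deriv ?_
      have hne := (hp s).ne'
      have : (1 + ((k * s - ξ) / k) ^ 2) = shearSq k ξ s / k ^ 2 := by
        unfold shearSq; field_simp; ring
      rw [this]
      field_simp)
    (by
      intro s _
      rw [abs_mul, abs_of_pos hC10]
      refine mul_le_mul_of_nonneg_left ?_ hC10.le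
      exact abs_le.2 ⟨(Real.neg_pi_div_two_lt_arctan _).le, (Real.arctan_lt_pi_div_two _).le⟩)
    (fun s => by positivity)
    (by
      intro s hs
      have r1 := modeEnergy_rate_le (ξ := ξ) (s := s) hc2 hκ hd hk (N s) (Ψ s) (Γ s)
      have r2 := modeEnergy_forcing_le (ξ := ξ) (s := s) hc2 hκ hd hk (N s) (Ψ s) (f s) (g s)
      have hΛL : Λ s ≤ L := (le_abs_self _).trans (hL s (Ioo_subset_Icc_self hs))
      have hμ : 0 < k ^ 2 / shearSq k ξ s := by have := hp s; positivity
      have hΛμ : 1 / (k ^ 2 / shearSq k ξ s) ≤ Λ s := by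
        simp only [hΛ]
        apply div_le_div_of_nonneg_right _ hμ.le
        nlinarith [sq_nonneg (pressureCoeff c2 κ d k ξ s)]
      change _ ≤ k ^ 2 / shearSq k ξ s * ((2 / c2 + 4) * Q s) + Λ s * (f s ^ 2 + g s ^ 2) at r2
      change _ ≤ k ^ 2 / shearSq k ξ s * (((κ + 6) / c2 + 6) * Q s + 3 * Γ s ^ 2) at r1
      have hws := hw0 s
      have hwbs := hwb s
      have hw1 : w s ≤ 1 := hwbs.trans hb1
      have hQs := hQ0 s
      generalize k ^ 2 / shearSq k ξ s = μ at *
      set R1 := (2 * k * (ξ - k * s)) * (shearSq k ξ s * κ / (shearSq k ξ s + d) ^ 2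
          + 4 * k ^ 2 / shearSq k ξ s ^ 2) * N s ^ 2
          + (μ - 2 * k ^ 2 * (ξ - k * s) ^ 2 / shearSq k ξ s ^ 2
          - shearRate k ξ s ^ 2) * N s * Ψ s
          - 2 * μ * Γ s * (2 * Ψ s + shearRate k ξ s * N s)
      set R2 := 2 * pressureCoeff c2 κ d k ξ s * N s * f s + 2 * Ψ s * g s
          + shearRate k ξ s * (f s * Ψ s + N s * g s)
      have s1 := mul_le_mul_of_nonneg_left r1 hws.le
      have s2 := mul_le_mul_of_nonneg_left r2 hws.le
      have s3 : 2 * Γ s * h s ≤ μ * Γ s ^ 2 + L * h s ^ 2 := by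
        have e : μ * Γ s ^ 2 + 1 / μ * h s ^ 2 - 2 * Γ s * h s = (μ * Γ s - h s) ^ 2 / μ := by
          field_simp; ring
        have e2 := div_nonneg (sq_nonneg (μ * Γ s - h s)) hμ.le
        have e3 := mul_le_mul_of_nonneg_right (hΛμ.trans hΛL) (sq_nonneg (h s))
        linarith
      have s4 : b * (2 * Γ s * h s) ≤ b * (μ * Γ s ^ 2) + L * h s ^ 2 := by
        have e1 := mul_le_mul_of_nonneg_left s3 hb0.le
        have e2 : b * (L * h s ^ 2) ≤ L * h s ^ 2 :=
          mul_le_of_le_one_left (by positivity) hb1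
        linarith
      have s5 : w s * (Λ s * (f s ^ 2 + g s ^ 2)) ≤ L * (f s ^ 2 + g s ^ 2) := by
        have e1 : Λ s * (f s ^ 2 + g s ^ 2) ≤ L * (f s ^ 2 + g s ^ 2) :=
          mul_le_mul_of_nonneg_right hΛL (by positivity)
        have e2 : w s * (L * (f s ^ 2 + g s ^ 2)) ≤ L * (f s ^ 2 + g s ^ 2) :=
          mul_le_of_le_one_left (by positivity) hw1
        linarith [mul_le_mul_of_nonneg_left e1 hws.le]
      have s6 : w s * (μ * (3 * Γ s ^ 2)) ≤ b * (μ * (3 * Γ s ^ 2)) :=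
        mul_le_mul_of_nonneg_right hwbs (by positivity)
      have s7 : 4 * (b * (μ * Γ s ^ 2)) ≤ C1 * (b * (μ * Γ s ^ 2)) := by
        refine mul_le_mul_of_nonneg_right ?_ (by positivity)
        have : 0 ≤ (κ + 6) / c2 := by positivity
        have : 0 ≤ 2 / c2 := by positivity
        linarith
      have e1 : C1 * μ * (w s * Q s + b * Γ s ^ 2)
          = w s * (μ * (((κ + 6) / c2 + 6) * Q s)) + w s * (μ * ((2 / c2 + 4) * Q s))
            + C1 * (b * (μ * Γ s ^ 2)) := by rw [hC1]; ring
      rw [e1]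
      calc _ = w s * R1 + w s * R2 + b * (2 * Γ s * h s) := by push_cast; ring
        _ ≤ _ := by linarith)
    (by
      have := hw0 0
      have := hQ0 0
      positivity)
  -- compare the modified energy with its diagonal part at both ends
  have hlow : w t * (shearSq k ξ t * N t ^ 2 + Ψ t ^ 2) ≤ m * (w t * Q t) := by
    have hE := modeEnergy_ge (c2 := c2) (ξ := ξ) (s := t) hκ hd hk (N t) (Ψ t)
    have a2 := mul_le_mul_of_nonneg_left hE (show 0 ≤ m by positivity)
    have a3 : m * (c2 * shearSq k ξ t * N t ^ 2 + Ψ t ^ 2 / 2)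
        = shearSq k ξ t * N t ^ 2 + 2 * (c2 * (shearSq k ξ t * N t ^ 2))
          + 1 / c2 * Ψ t ^ 2 / 2 + Ψ t ^ 2 := by
      rw [hm]; field_simp; ring
    have a4 : 0 ≤ 1 / c2 * Ψ t ^ 2 := by positivity
    have a5 : 0 ≤ c2 * (shearSq k ξ t * N t ^ 2) := by have := hp t; positivity
    have a6 : shearSq k ξ t * N t ^ 2 + Ψ t ^ 2 ≤ m * Q t := by
      simp only [hQ]; linarith
    calc _ ≤ w t * (m * Q t) := mul_le_mul_of_nonneg_left a6 (hw0 t).le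
      _ = _ := by ring
  have hup : w 0 * Q 0 ≤ (M + 2) * (w 0 * (shearSq k ξ 0 * N 0 ^ 2 + Ψ 0 ^ 2)) := by
    have hE := modeEnergy_le (c2 := c2) (ξ := ξ) (s := 0) hκ hd hk (N 0) (Ψ 0)
    have a1 : Q 0 ≤ (M + 2) * (shearSq k ξ 0 * N 0 ^ 2 + Ψ 0 ^ 2) := by
      refine hE.trans ?_
      have : 0 ≤ M * Ψ 0 ^ 2 := by positivity
      have : 0 ≤ shearSq k ξ 0 * N 0 ^ 2 := by have := hp 0; positivity
      have e : (c2 + κ + 3) * shearSq k ξ 0 * N 0 ^ 2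
        = M * (shearSq k ξ 0 * N 0 ^ 2) := by rw [hM]; ring
      rw [e]; nlinarith
    calc _ ≤ w 0 * ((M + 2) * (shearSq k ξ 0 * N 0 ^ 2 + Ψ 0 ^ 2)) :=
        mul_le_mul_of_nonneg_left a1 (hw0 0).le
      _ = _ := by ring
  rw [intervalIntegral.integral_const_mul] at key
  set I : ℝ := ∫ s in (0 : ℝ)..t, (f s ^ 2 + g s ^ 2 + h s ^ 2) with hI
  have hI0 : 0 ≤ I := intervalIntegral.integral_nonneg ht fun s _ => by positivity
  set X : ℝ := Real.exp (2 * (C1 * (Real.pi / 2)))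
  have hX : 0 < X := Real.exp_pos _
  have hLI : 0 ≤ L * I := mul_nonneg hL0 hI0
  have hD0 : 0 ≤ w 0 * (shearSq k ξ 0 * N 0 ^ 2 + Ψ 0 ^ 2) := by
    have := hp 0; have := hw0 0; positivity
  have hbt : 0 ≤ b * Γ t ^ 2 := by positivity
  have hb00 : 0 ≤ b * Γ 0 ^ 2 := by positivity
  have hwt : 0 ≤ w t * Q t := mul_nonneg (hw0 t).le (hQ0 t)
  have hm0 : 0 < m := by positivity
  have hM0 : 0 < M := by positivity
  calc w t * (shearSq k ξ t * N t ^ 2 + Ψ t ^ 2) + b * Γ t ^ 2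
      ≤ (m + 1) * (w t * Q t + b * Γ t ^ 2) := by nlinarith
    _ ≤ (m + 1) * (X * (w 0 * Q 0 + b * Γ 0 ^ 2 + L * I)) :=
        mul_le_mul_of_nonneg_left key (by positivity)
    _ ≤ (m + 1) * (X * ((M + 3) * (w 0 * (shearSq k ξ 0 * N 0 ^ 2 + Ψ 0 ^ 2)
          + b * Γ 0 ^ 2 + L * I))) := by
        refine mul_le_mul_of_nonneg_left (mul_le_mul_of_nonneg_left ?_ hX.le) (by positivity)
        nlinarith
    _ = _ := by ring

end EulerPoisson

/-! ### Fourier modes of smooth functions on the cylinder -/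

namespace EulerPoisson

open Set

/-- `G(x, y)` is `C^∞` on `ℝ × ℝ` and `2π`-periodic in `x`. -/
structure IsCylSmooth (G : ℝ → ℝ → ℝ) : Prop where
  contDiff : ContDiff ℝ ∞ (fun p : ℝ × ℝ => G p.1 p.2)
  periodic : ∀ x y, G (x + 2 * Real.pi) y = G x y

/-- The partial derivative in `x`. -/
noncomputable def dX (G : ℝ → ℝ → ℝ) (x y : ℝ) : ℝ := deriv (fun x' => G x' y) x

/-- The partial derivative in `y`. -/
noncomputable def dY (G : ℝ → ℝ → ℝ) (x y : ℝ) : ℝ := deriv (fun y' => G x y') y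

namespace IsCylSmooth

variable {G : ℝ → ℝ → ℝ}

theorem continuous (hG : IsCylSmooth G) : Continuous fun p : ℝ × ℝ => G p.1 p.2 :=
  hG.contDiff.continuous

theorem hasDerivAt_fst (hG : IsCylSmooth G) (x y : ℝ) :
    HasDerivAt (fun x' => G x' y) (fderiv ℝ (fun p : ℝ × ℝ => G p.1 p.2) (x, y) (1, 0)) x := by
  have h := (hG.contDiff.differentiable (by simp)).differentiableAt (x := (x, y))
  exact HasFDerivAt.comp_hasDerivAt (f := fun x' : ℝ => (x', y)) x h.hasFDerivAt
    ((hasDerivAt_id x).prodMk (hasDerivAt_const x y))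

theorem hasDerivAt_snd (hG : IsCylSmooth G) (x y : ℝ) :
    HasDerivAt (fun y' => G x y') (fderiv ℝ (fun p : ℝ × ℝ => G p.1 p.2) (x, y) (0, 1)) y := by
  have h := (hG.contDiff.differentiable (by simp)).differentiableAt (x := (x, y))
  exact HasFDerivAt.comp_hasDerivAt (f := fun y' : ℝ => (x, y')) y h.hasFDerivAt
    ((hasDerivAt_const y x).prodMk (hasDerivAt_id y))

theorem hasDerivAt_dX (hG : IsCylSmooth G) (x y : ℝ) :
    HasDerivAt (fun x' => G x' y) (dX G x y) x :=
  (hG.hasDerivAt_fst x y).differentiableAt.hasDerivAt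

theorem hasDerivAt_dY (hG : IsCylSmooth G) (x y : ℝ) :
    HasDerivAt (fun y' => G x y') (dY G x y) y :=
  (hG.hasDerivAt_snd x y).differentiableAt.hasDerivAt

theorem dX (hG : IsCylSmooth G) : IsCylSmooth (dX G) where
  contDiff := by
    have h : (fun p : ℝ × ℝ => EulerPoisson.dX G p.1 p.2)
        = fun p => fderiv ℝ (fun p : ℝ × ℝ => G p.1 p.2) p (1, 0) := by
      funext p
      exact (hG.hasDerivAt_fst p.1 p.2).deriv
    rw [h]
    exact (hG.contDiff.fderiv_right (m := ∞) (by simp)).clm_apply contDiff_const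
  periodic x y := by
    unfold EulerPoisson.dX
    rw [← deriv_comp_add_const]
    simp_rw [hG.periodic]

theorem dY (hG : IsCylSmooth G) : IsCylSmooth (dY G) where
  contDiff := by
    have h : (fun p : ℝ × ℝ => EulerPoisson.dY G p.1 p.2)
        = fun p => fderiv ℝ (fun p : ℝ × ℝ => G p.1 p.2) p (0, 1) := by
      funext p
      exact (hG.hasDerivAt_snd p.1 p.2).deriv
    rw [h]
    exact (hG.contDiff.fderiv_right (m := ∞) (by simp)).clm_apply contDiff_const
  periodic x y := by
    unfold EulerPoisson.dY
    simp_rw [hG.periodic]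

end IsCylSmooth

/-- Differentiation under the integral sign over a compact interval, for an integrand whose
derivative in the parameter is jointly continuous. -/
theorem hasDerivAt_intervalIntegral_of_continuousOn {Φ Φ' : ℝ → ℝ → ℂ} {U : Set ℝ}
    (hU : IsOpen U) (hΦ : ContinuousOn (fun p : ℝ × ℝ => Φ p.1 p.2) (U ×ˢ univ))
    (hΦ' : ContinuousOn (fun p : ℝ × ℝ => Φ' p.1 p.2) (U ×ˢ univ))
    (hd : ∀ s ∈ U, ∀ y, HasDerivAt (fun s => Φ s y) (Φ' s y) s) (A B : ℝ) {t : ℝ} (ht : t ∈ U) :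
    HasDerivAt (fun s => ∫ y in A..B, Φ s y) (∫ y in A..B, Φ' t y) t := by
  obtain ⟨ε, hε, hball⟩ := Metric.isOpen_iff.1 hU t ht
  have hcb : Metric.closedBall t (ε / 2) ⊆ U :=
    (Metric.closedBall_subset_ball (by linarith)).trans hball
  have hK : IsCompact (Metric.closedBall t (ε / 2) ×ˢ uIcc A B) :=
    (isCompact_closedBall t (ε / 2)).prod isCompact_uIcc
  obtain ⟨M, hM⟩ := hK.exists_bound_of_continuousOn
    (hΦ'.mono (prod_mono hcb (subset_univ _)))
  have hslice : ∀ {Θ : ℝ → ℝ → ℂ}, ContinuousOn (fun p : ℝ × ℝ => Θ p.1 p.2) (U ×ˢ univ) →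
      ∀ s ∈ U, Continuous (Θ s) := fun {Θ} hΘ s hs =>
    continuousOn_univ.1 (hΘ.comp (f := fun y : ℝ => (s, y)) (by fun_prop)
      fun y _ => ⟨hs, mem_univ _⟩)
  refine (intervalIntegral.hasDerivAt_integral_of_dominated_loc_of_deriv_le
    (s := Metric.closedBall t (ε / 2)) (bound := fun _ => M)
    (Metric.closedBall_mem_nhds t (by linarith)) ?_ ?_ ?_ ?_ ?_ ?_).2
  · filter_upwards [hU.mem_nhds ht] with s hs
    exact (hslice hΦ s hs).aestronglyMeasurable
  · exact (hslice hΦ t ht).intervalIntegrable _ _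
  · exact (hslice hΦ' t ht).aestronglyMeasurable
  · exact Filter.Eventually.of_forall fun y hy s hs => hM (s, y) ⟨hs, uIoc_subset_uIcc hy⟩
  · exact intervalIntegrable_const
  · exact Filter.Eventually.of_forall fun y _ s hs => hd s (hcb hs) y

/-- Continuity on a set of an integral over a compact interval depending on a parameter. -/
theorem continuousOn_intervalIntegral {X : Type*} [TopologicalSpace X] {S : Set X}
    {Φ : X → ℝ → ℂ} (hΦ : ContinuousOn (fun p : X × ℝ => Φ p.1 p.2) (S ×ˢ univ)) (A B : ℝ) :
    ContinuousOn (fun p => ∫ y in A..B, Φ p y) S := by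
  rw [continuousOn_iff_continuous_domRestrict]
  have : Continuous (Function.uncurry fun (p : S) (y : ℝ) => Φ p y) := by
    refine hΦ.comp_continuous (f := fun q : S × ℝ => ((q.1 : X), q.2)) (by fun_prop) ?_
    exact fun q => ⟨q.1.2, mem_univ _⟩
  exact intervalIntegral.continuous_parametric_intervalIntegral_of_continuous' this A B

section xMode

variable {G H : ℝ → ℝ → ℝ} {k : ℤ}

theorem continuous_xMode (hG : Continuous fun p : ℝ × ℝ => G p.1 p.2) (k : ℤ) :
    Continuous (xMode G k) := by
  unfold xMode
  apply intervalIntegral.continuous_parametric_intervalIntegral_of_continuous'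
  have : Continuous fun q : ℝ × ℝ => G q.2 q.1 := hG.comp continuous_swap
  simp only [Function.uncurry_def]
  fun_prop

theorem xMode_add_apply {y : ℝ} (hG : Continuous fun x => G x y) (hH : Continuous fun x => H x y) :
    xMode (fun x y => G x y + H x y) k y = xMode G k y + xMode H k y := by
  unfold xMode
  rw [← intervalIntegral.integral_add]
  · congr 1; funext x; push_cast; ring
  · exact Continuous.intervalIntegrable (by fun_prop) _ _
  · exact Continuous.intervalIntegrable (by fun_prop) _ _

theorem xMode_mul_left (c : ℝ → ℝ) (y : ℝ) :
    xMode (fun x y => c y * G x y) k y = (c y : ℂ) * xMode G k y := by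
  unfold xMode
  rw [← intervalIntegral.integral_const_mul]
  congr 1; funext x; push_cast; ring

theorem hasDerivAt_exp_mode (k : ℤ) (x : ℝ) :
    HasDerivAt (fun x : ℝ => Complex.exp (-(Complex.I * k * x)))
      (-(Complex.I * k) * Complex.exp (-(Complex.I * k * x))) x := by
  have h : HasDerivAt (fun x : ℝ => -(Complex.I * k * (x : ℂ))) (-(Complex.I * k)) x := by
    refine ((hasDerivAt_id x).ofReal_comp.const_mul (Complex.I * (k : ℂ))).neg.congr_deriv ?_
    simp
  refine h.cexp.congr_deriv (by ring)

theorem xMode_dX (hG : IsCylSmooth G) (k : ℤ) (y : ℝ) :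
    xMode (dX G) k y = Complex.I * k * xMode G k y := by
  unfold xMode
  have h1 : ∀ x ∈ uIcc (0 : ℝ) (2 * Real.pi), HasDerivAt (fun x : ℝ => ((G x y : ℝ) : ℂ))
      ((dX G x y : ℝ) : ℂ) x := fun x _ => (hG.hasDerivAt_dX x y).ofReal_comp
  have h2 : ∀ x ∈ uIcc (0 : ℝ) (2 * Real.pi), HasDerivAt
      (fun x : ℝ => Complex.exp (-(Complex.I * k * x)))
      (-(Complex.I * k) * Complex.exp (-(Complex.I * k * x))) x :=
    fun x _ => hasDerivAt_exp_mode k x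
  have hc : Continuous fun x => dX G x y := hG.dX.continuous.comp (by fun_prop : Continuous fun x : ℝ => (x, y))
  rw [intervalIntegral.integral_mul_deriv_eq_deriv_mul h2 h1
    (Continuous.intervalIntegrable (by fun_prop) _ _)
    (Continuous.intervalIntegrable (by fun_prop) _ _)]
  have e1 : Complex.exp (-(Complex.I * k * ((2 * Real.pi : ℝ) : ℂ))) = 1 := by
    rw [Complex.exp_eq_one_iff]
    exact ⟨-k, by push_cast; ring⟩
  have e2 : G (2 * Real.pi) y = G 0 y := by simpa using hG.periodic 0 y
  rw [e1, e2, ← intervalIntegral.integral_const_mul]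
  simp only [Complex.ofReal_zero, mul_zero, neg_zero, Complex.exp_zero, sub_self, zero_sub]
  rw [← intervalIntegral.integral_neg]
  congr 1; funext x; ring

theorem hasDerivAt_xMode (hG : IsCylSmooth G) (k : ℤ) (y : ℝ) :
    HasDerivAt (xMode G k) (xMode (dY G) k y) y := by
  have hc1 : Continuous fun q : ℝ × ℝ => G q.2 q.1 := hG.continuous.comp continuous_swap
  have hc2 : Continuous fun q : ℝ × ℝ => dY G q.2 q.1 := hG.dY.continuous.comp continuous_swap
  exact hasDerivAt_intervalIntegral_of_continuousOn
    (Φ := fun y x => Complex.exp (-(Complex.I * k * x)) * (G x y : ℂ))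
    (Φ' := fun y x => Complex.exp (-(Complex.I * k * x)) * (dY G x y : ℂ)) isOpen_univ
    (Continuous.continuousOn (Continuous.mul (by fun_prop) (Complex.continuous_ofReal.comp hc1)))
    (Continuous.continuousOn (Continuous.mul (by fun_prop) (Complex.continuous_ofReal.comp hc2)))
    (fun s _ x => ((hG.hasDerivAt_dY x s).ofReal_comp).const_mul _) _ _ (mem_univ y)

end xMode

/-- `w` is a smooth compactly supported weight in `y`. -/
structure IsWeight (w : ℝ → ℝ) : Prop where
  contDiff : ContDiff ℝ ∞ w
  compact : HasCompactSupport w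

theorem IsWeight.deriv {w : ℝ → ℝ} (hw : IsWeight w) : IsWeight (deriv w) where
  contDiff := by
    have : ContDiff ℝ ((∞ : ℕ∞ω) + 1) w := by simpa using hw.contDiff
    exact (contDiff_succ_iff_deriv.1 this).2.2
  compact := hw.compact.deriv

theorem IsWeight.continuous {w : ℝ → ℝ} (hw : IsWeight w) : Continuous w := hw.contDiff.continuous

theorem IsWeight.hasDerivAt {w : ℝ → ℝ} (hw : IsWeight w) (y : ℝ) :
    HasDerivAt w (_root_.deriv w y) y :=
  (hw.contDiff.differentiable (by simp) y).hasDerivAt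

/-- The Fourier transform `(2π)⁻¹ ∬ e^{-i(kx + ξy)} w(y) G(x, y) dx dy` of `G` localized by the
weight `w`. -/
noncomputable def weightedHat (w : ℝ → ℝ) (G : ℝ → ℝ → ℝ) (k : ℤ) (ξ : ℝ) : ℂ :=
  (1 / (2 * Real.pi) : ℂ) *
    ∫ y : ℝ, (w y : ℂ) * Complex.exp (-(Complex.I * ξ * y)) * xMode G k y

section weightedHat

variable {w : ℝ → ℝ} {G H : ℝ → ℝ → ℝ} {k : ℤ} {ξ : ℝ}

theorem IsWeight.integrable_mul {w : ℝ → ℝ} (hw : IsWeight w) {g : ℝ → ℂ} (hg : Continuous g) :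
    Integrable fun y => (w y : ℂ) * g y := by
  have hc := hw.continuous
  refine Continuous.integrable_of_hasCompactSupport (by fun_prop) ?_
  refine HasCompactSupport.mul_right ?_
  exact hw.compact.comp_left (g := fun r : ℝ => (r : ℂ)) Complex.ofReal_zero

theorem integrable_weightedHat (hw : IsWeight w) (hG : Continuous fun p : ℝ × ℝ => G p.1 p.2)
    (k : ℤ) (ξ : ℝ) :
    Integrable fun y : ℝ => (w y : ℂ) * Complex.exp (-(Complex.I * ξ * y)) * xMode G k y := by
  have := continuous_xMode hG k
  simp_rw [mul_assoc]
  exact hw.integrable_mul (by fun_prop)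

theorem weightedHat_add (hw : IsWeight w) (hG : Continuous fun p : ℝ × ℝ => G p.1 p.2)
    (hH : Continuous fun p : ℝ × ℝ => H p.1 p.2) :
    weightedHat w (fun x y => G x y + H x y) k ξ = weightedHat w G k ξ + weightedHat w H k ξ := by
  unfold weightedHat
  rw [← mul_add, ← integral_add (integrable_weightedHat hw hG k ξ)
    (integrable_weightedHat hw hH k ξ)]
  congr 2; funext y
  rw [xMode_add_apply (G := G) (H := H) (hG.comp (by fun_prop : Continuous fun x : ℝ => (x, y)))
    (hH.comp (by fun_prop : Continuous fun x : ℝ => (x, y)))]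
  ring

theorem weightedHat_const_mul (c : ℝ) :
    weightedHat w (fun x y => c * G x y) k ξ = (c : ℂ) * weightedHat w G k ξ := by
  unfold weightedHat
  rw [mul_left_comm]
  congr 1
  rw [← integral_const_mul]
  congr 1; funext y
  rw [xMode_mul_left (fun _ => c)]; ring

theorem weightedHat_dX (hG : IsCylSmooth G) :
    weightedHat w (dX G) k ξ = Complex.I * k * weightedHat w G k ξ := by
  unfold weightedHat
  rw [mul_left_comm]
  congr 1
  rw [← integral_const_mul]
  congr 1; funext y
  rw [xMode_dX hG]; ring

theorem weightedHat_dY (hw : IsWeight w) (hG : IsCylSmooth G) :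
    weightedHat w (dY G) k ξ
      = Complex.I * ξ * weightedHat w G k ξ - weightedHat (deriv w) G k ξ := by
  have hu : ∀ y : ℝ, HasDerivAt (fun y : ℝ => (w y : ℂ) * Complex.exp (-(Complex.I * ξ * y)))
      (((deriv w y : ℝ) : ℂ) * Complex.exp (-(Complex.I * ξ * y))
        + (w y : ℂ) * (Complex.exp (-(Complex.I * ξ * y)) * -(Complex.I * ξ))) y := by
    intro y
    have h : HasDerivAt (fun x : ℝ => -(Complex.I * ξ * (x : ℂ))) (-(Complex.I * ξ)) y := by
      refine ((hasDerivAt_id y).ofReal_comp.const_mul (Complex.I * (ξ : ℂ))).neg.congr_deriv ?_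
      simp
    exact (hw.hasDerivAt y).ofReal_comp.mul h.cexp
  have i1 := integrable_weightedHat hw hG.continuous k ξ
  have i2 := integrable_weightedHat hw hG.dY.continuous k ξ
  have i3 := integrable_weightedHat hw.deriv hG.continuous k ξ
  have i4 : Integrable fun y : ℝ => (((deriv w y : ℝ) : ℂ) * Complex.exp (-(Complex.I * ξ * y))
        + (w y : ℂ) * (Complex.exp (-(Complex.I * ξ * y)) * -(Complex.I * ξ))) * xMode G k y := by
    refine (i3.add (i1.const_mul (-(Complex.I * ξ)))).congr (Filter.Eventually.of_forall ?_)
    intro y; simp only [Pi.add_apply]; ring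
  have key := integral_mul_deriv_eq_deriv_mul_of_integrable
    (u := fun y : ℝ => (w y : ℂ) * Complex.exp (-(Complex.I * ξ * y))) (v := xMode G k)
    (fun y _ => hu y) (fun y _ => hasDerivAt_xMode hG k y) i2 i4 i1
  unfold weightedHat
  rw [key, mul_left_comm, ← mul_sub, ← integral_const_mul, ← integral_sub (i1.const_mul _) i3,
    ← integral_neg]
  congr 2; funext y; ring

end weightedHat

end EulerPoisson

/-! ### Evolution of the localized Fourier transforms -/

namespace EulerPoisson

open Set

/-- The partial derivative in time. -/
noncomputable def dT (F : ℝ → ℝ → ℝ → ℝ) (t x y : ℝ) : ℝ := deriv (fun s => F s x y) t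

namespace SmoothOnCylinder

variable {F : ℝ → ℝ → ℝ → ℝ}

theorem isCylSmooth (hF : SmoothOnCylinder F) {t : ℝ} (ht : 0 ≤ t) : IsCylSmooth (F t) where
  contDiff := by
    rw [← contDiffOn_univ]
    have h : ContDiff ℝ ∞ fun p : ℝ × ℝ => (t, p.1, p.2) := by fun_prop
    exact hF.1.comp h.contDiffOn fun p _ => ⟨ht, mem_univ _⟩
  periodic x y := hF.2 t x y ht

theorem continuous_max (hF : SmoothOnCylinder F) :
    Continuous fun p : ℝ × ℝ × ℝ => F (max p.1 0) p.2.1 p.2.2 :=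
  hF.1.continuousOn.comp_continuous (f := fun p : ℝ × ℝ × ℝ => (max p.1 0, p.2.1, p.2.2))
    (by fun_prop) fun _ => ⟨mem_Ici.2 (le_max_right _ _), mem_univ _⟩

theorem contDiffOn_Ioi (hF : SmoothOnCylinder F) :
    ContDiffOn ℝ ∞ (fun p : ℝ × ℝ × ℝ => F p.1 p.2.1 p.2.2) (Ioi 0 ×ˢ univ) :=
  hF.1.mono (prod_mono Ioi_subset_Ici_self subset_rfl)

theorem hasDerivAt_fderiv (hF : SmoothOnCylinder F) {t : ℝ} (ht : 0 < t) (x y : ℝ) :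
    HasDerivAt (fun s => F s x y)
      (fderiv ℝ (fun p : ℝ × ℝ × ℝ => F p.1 p.2.1 p.2.2) (t, x, y) (1, 0)) t := by
  have ho : IsOpen (Ioi (0 : ℝ) ×ˢ (univ : Set (ℝ × ℝ))) := isOpen_Ioi.prod isOpen_univ
  have h := (hF.contDiffOn_Ioi.differentiableOn (by simp)).differentiableAt (x := (t, x, y))
    (ho.mem_nhds ⟨ht, mem_univ _⟩)
  exact HasFDerivAt.comp_hasDerivAt (f := fun s : ℝ => (s, x, y)) t h.hasFDerivAt
    ((hasDerivAt_id t).prodMk (hasDerivAt_const t (x, y)))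

theorem hasDerivAt_dT (hF : SmoothOnCylinder F) {t : ℝ} (ht : 0 < t) (x y : ℝ) :
    HasDerivAt (fun s => F s x y) (dT F t x y) t :=
  (hF.hasDerivAt_fderiv ht x y).differentiableAt.hasDerivAt

theorem continuousOn_dT (hF : SmoothOnCylinder F) :
    ContinuousOn (fun p : ℝ × ℝ × ℝ => dT F p.1 p.2.1 p.2.2) (Ioi 0 ×ˢ univ) := by
  have ho : IsOpen (Ioi (0 : ℝ) ×ˢ (univ : Set (ℝ × ℝ))) := isOpen_Ioi.prod isOpen_univ
  refine ContinuousOn.congr (f := fun p : ℝ × ℝ × ℝ =>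
    fderiv ℝ (fun p : ℝ × ℝ × ℝ => F p.1 p.2.1 p.2.2) p (1, 0)) ?_ ?_
  · exact (hF.contDiffOn_Ioi.continuousOn_fderiv_of_isOpen ho (by simp)).clm_apply
      continuousOn_const
  · rintro ⟨t, x, y⟩ ⟨ht, _⟩
    exact (hF.hasDerivAt_fderiv ht x y).deriv

theorem continuous_dT (hF : SmoothOnCylinder F) {t : ℝ} (ht : 0 < t) :
    Continuous fun p : ℝ × ℝ => dT F t p.1 p.2 :=
  hF.continuousOn_dT.comp_continuous (f := fun p : ℝ × ℝ => (t, p.1, p.2)) (by fun_prop)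
    fun _ => ⟨ht, mem_univ _⟩

/-- Joint continuity in time and `y` of an `x`-mode, for a jointly continuous function. -/
theorem continuousOn_xMode {F : ℝ → ℝ → ℝ → ℝ} {S : Set ℝ}
    (hF : ContinuousOn (fun p : ℝ × ℝ × ℝ => F p.1 p.2.1 p.2.2) (S ×ˢ univ)) (k : ℤ) :
    ContinuousOn (fun p : ℝ × ℝ => xMode (F p.1) k p.2) (S ×ˢ univ) := by
  refine continuousOn_intervalIntegral
    (Φ := fun (p : ℝ × ℝ) x => Complex.exp (-(Complex.I * k * x)) * (F p.1 x p.2 : ℂ)) ?_ _ _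
  refine ContinuousOn.mul (Continuous.continuousOn (by fun_prop)) ?_
  refine Complex.continuous_ofReal.comp_continuousOn ?_
  exact hF.comp (f := fun q : (ℝ × ℝ) × ℝ => (q.1.1, q.2, q.1.2)) (by fun_prop)
    fun q hq => ⟨hq.1.1, mem_univ _⟩

theorem hasDerivAt_xMode (hF : SmoothOnCylinder F) {t : ℝ} (ht : 0 < t) (k : ℤ) (y : ℝ) :
    HasDerivAt (fun s => xMode (F s) k y) (xMode (dT F t) k y) t := by
  have h1 : ContinuousOn (fun p : ℝ × ℝ => F p.1 p.2 y) (Ioi 0 ×ˢ univ) :=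
    hF.contDiffOn_Ioi.continuousOn.comp (f := fun q : ℝ × ℝ => (q.1, q.2, y)) (by fun_prop)
      fun q hq => ⟨hq.1, mem_univ _⟩
  have h2 : ContinuousOn (fun p : ℝ × ℝ => dT F p.1 p.2 y) (Ioi 0 ×ˢ univ) :=
    hF.continuousOn_dT.comp (f := fun q : ℝ × ℝ => (q.1, q.2, y)) (by fun_prop)
      fun q hq => ⟨hq.1, mem_univ _⟩
  refine hasDerivAt_intervalIntegral_of_continuousOn
    (Φ := fun s x => Complex.exp (-(Complex.I * k * x)) * (F s x y : ℂ))
    (Φ' := fun s x => Complex.exp (-(Complex.I * k * x)) * (dT F s x y : ℂ)) isOpen_Ioi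
    (ContinuousOn.mul (Continuous.continuousOn (by fun_prop))
      (Complex.continuous_ofReal.comp_continuousOn h1))
    (ContinuousOn.mul (Continuous.continuousOn (by fun_prop))
      (Complex.continuous_ofReal.comp_continuousOn h2))
    (fun s hs x => ((hF.hasDerivAt_dT hs x y).ofReal_comp).const_mul _) _ _ ht

end SmoothOnCylinder

theorem IsWeight.exists_integral_eq {w : ℝ → ℝ} (hw : IsWeight w) :
    ∃ M : ℝ, ∀ g : ℝ → ℂ, ∫ y, (w y : ℂ) * g y = ∫ y in (-M)..M, (w y : ℂ) * g y := by
  obtain ⟨M, hM⟩ := hw.compact.isBounded.subset_closedBall 0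
  refine ⟨M + 1, fun g => (intervalIntegral.integral_eq_integral_of_support_subset ?_).symm⟩
  intro y hy
  have hwy : w y ≠ 0 := by
    intro h
    apply hy
    simp [h]
  have := hM (subset_tsupport w hwy)
  rw [mem_closedBall_zero_iff, Real.norm_eq_abs, abs_le] at this
  constructor <;> linarith

/-- Along the characteristics of the Couette flow the localized Fourier transform is differentiated
in time by the material derivative `∂_t + y ∂_x`. -/
theorem hasDerivAt_weightedHat {w : ℝ → ℝ} (hw : IsWeight w) {F : ℝ → ℝ → ℝ → ℝ}
    (hF : SmoothOnCylinder F) {t : ℝ} (ht : 0 < t) (k : ℤ) (ξ : ℝ) :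
    HasDerivAt (fun s => weightedHat w (F s) k (ξ - k * s))
      (weightedHat w (fun x y => dT F t x y + y * dX (F t) x y) k (ξ - k * t)) t := by
  obtain ⟨M, hM⟩ := hw.exists_integral_eq
  have hwc := hw.continuous
  set e : ℝ → ℝ → ℂ := fun s y => Complex.exp (-(Complex.I * ((ξ - k * s : ℝ) : ℂ) * y)) with he
  have hec : Continuous fun p : ℝ × ℝ => e p.1 p.2 := by simp only [he]; fun_prop
  have hW : ∀ (G : ℝ → ℝ → ℝ) (s : ℝ), weightedHat w G k (ξ - k * s)
      = (1 / (2 * Real.pi) : ℂ) * ∫ y in (-M)..M, (w y : ℂ) * (e s y * xMode G k y) := by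
    intro G s
    unfold weightedHat
    simp_rw [mul_assoc]
    rw [← hM fun y => e s y * xMode G k y]
    simp only [he, mul_assoc]
  have hmode : ∀ s ∈ Ioi (0 : ℝ), ∀ y, xMode (fun x y => dT F s x y + y * dX (F s) x y) k y
      = xMode (dT F s) k y + y * (Complex.I * k * xMode (F s) k y) := by
    intro s hs y
    have hs' : 0 < s := hs
    have hG := hF.isCylSmooth hs'.le
    have c1 : Continuous fun x => dT F s x y :=
      (hF.continuous_dT hs').comp (by fun_prop : Continuous fun x : ℝ => (x, y))
    have c2 : Continuous fun x => dX (F s) x y :=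
      hG.dX.continuous.comp (by fun_prop : Continuous fun x : ℝ => (x, y))
    rw [xMode_add_apply (G := dT F s) (H := fun x y => y * dX (F s) x y) c1
      (by fun_prop), xMode_mul_left (fun y => y), xMode_dX hG]
  rw [hW]
  simp_rw [hW]
  refine HasDerivAt.const_mul _ ?_
  have hx0 := SmoothOnCylinder.continuousOn_xMode hF.contDiffOn_Ioi.continuousOn k
  have hx1 := SmoothOnCylinder.continuousOn_xMode hF.continuousOn_dT k
  have hD := hasDerivAt_intervalIntegral_of_continuousOn (U := Ioi (0 : ℝ))
    (Φ := fun s y => (w y : ℂ) * (e s y * xMode (F s) k y))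
    (Φ' := fun s y => (w y : ℂ) * (e s y * (xMode (dT F s) k y
      + y * (Complex.I * k * xMode (F s) k y)))) isOpen_Ioi
    (ContinuousOn.mul (Continuous.continuousOn (by fun_prop))
      (hec.continuousOn.mul hx0))
    (ContinuousOn.mul (Continuous.continuousOn (by fun_prop))
      (hec.continuousOn.mul (hx1.add (ContinuousOn.mul (Continuous.continuousOn (by fun_prop))
        (continuousOn_const.mul hx0)))))
    (fun s hs y => by
      have h0 : HasDerivAt (fun s : ℝ => -(Complex.I * ((ξ - k * s : ℝ) : ℂ) * y))
          (Complex.I * k * y) s := by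
        have h1 : HasDerivAt (fun s : ℝ => ξ - k * s) (-(k : ℝ)) s := by
          simpa using ((hasDerivAt_id s).const_mul (k : ℝ)).const_sub ξ
        refine ((h1.ofReal_comp.const_mul Complex.I).mul_const (y : ℂ)).neg.congr_deriv ?_
        push_cast; ring
      refine ((h0.cexp.mul (hF.hasDerivAt_xMode hs k y)).const_mul (w y : ℂ)).congr_deriv ?_
      simp only [he]; ring) (-M) M ht
  refine hD.congr_deriv ?_
  simp_rw [hmode t ht]

/-- The localized Fourier transforms are jointly continuous in time and frequency; times `t < 0` are
replaced by `0`. -/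
theorem continuous_weightedHat {w : ℝ → ℝ} (hw : IsWeight w) {F : ℝ → ℝ → ℝ → ℝ}
    (hF : SmoothOnCylinder F) (k : ℤ) :
    Continuous fun p : ℝ × ℝ => weightedHat w (F (max p.1 0)) k (p.2 - k * p.1) := by
  obtain ⟨M, hM⟩ := hw.exists_integral_eq
  have hwc := hw.continuous
  have hW : ∀ p : ℝ × ℝ, weightedHat w (F (max p.1 0)) k (p.2 - k * p.1)
      = (1 / (2 * Real.pi) : ℂ) * ∫ y in (-M)..M, (w y : ℂ) *
        (Complex.exp (-(Complex.I * ((p.2 - k * p.1 : ℝ) : ℂ) * y))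
          * xMode (F (max p.1 0)) k y) := by
    intro p
    unfold weightedHat
    simp_rw [mul_assoc]
    rw [← hM]
  simp_rw [hW]
  refine continuous_const.mul ?_
  have hx : Continuous fun p : ℝ × ℝ => xMode (F (max p.1 0)) k p.2 := by
    have := SmoothOnCylinder.continuousOn_xMode (F := fun s => F (max s 0)) (S := univ)
      hF.continuous_max.continuousOn k
    rwa [univ_prod_univ, continuousOn_univ] at this
  apply intervalIntegral.continuous_parametric_intervalIntegral_of_continuous'
  have : Continuous fun q : (ℝ × ℝ) × ℝ => xMode (F (max q.1.1 0)) k q.2 :=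
    hx.comp (by fun_prop : Continuous fun q : (ℝ × ℝ) × ℝ => (q.1.1, q.2))
  simp only [Function.uncurry_def]
  fun_prop

end EulerPoisson

/-! ### The `L²` theory: Parseval and Plancherel -/

namespace EulerPoisson

open Set

/-- On `L¹ ∩ L²` the Fourier transform of `L²` is given by the Fourier integral. -/
theorem fourier_toLp_ae_eq {g : ℝ → ℂ} (h1 : Integrable g) (h2 : MemLp g 2 (volume : Measure ℝ)) :
    ((𝓕 (h2.toLp g) : Lp ℂ 2 (volume : Measure ℝ)) : ℝ → ℂ) =ᵐ[volume] 𝓕 g := by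
  have hcont : Continuous (𝓕 g) :=
    VectorFourier.fourierIntegral_continuous Real.continuous_fourierChar
      (by exact continuous_inner) h1
  refine ae_eq_of_integral_contDiff_smul_eq ?_ hcont.locallyIntegrable ?_
  · exact (Lp.memLp _).locallyIntegrable (by norm_num)
  intro φ hφ hφc
  have hφ' : ContDiff ℝ ∞ fun x => (φ x : ℂ) := Complex.ofRealCLM.contDiff.comp hφ
  have hφc' : HasCompactSupport fun x => (φ x : ℂ) :=
    hφc.comp_left (g := fun r : ℝ => (r : ℂ)) Complex.ofReal_zero
  set s : SchwartzMap ℝ ℂ := hφc'.toSchwartzMap hφ' with hs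
  have hsφ : ∀ x, s x = (φ x : ℂ) := fun x => rfl
  have e1 : ∫ x, φ x • (𝓕 (h2.toLp g) : Lp ℂ 2 (volume : Measure ℝ)) x
      = Lp.toTemperedDistribution (𝓕 (h2.toLp g) : Lp ℂ 2 (volume : Measure ℝ)) s := by
    rw [Lp.toTemperedDistribution_apply]
    simp only [hsφ, Complex.real_smul, smul_eq_mul]
  rw [e1, ← Lp.fourier_toTemperedDistribution_eq, TemperedDistribution.fourier_apply,
    Lp.toTemperedDistribution_apply]
  have e2 : ∫ x, (𝓕 s) x • (h2.toLp g) x = ∫ x, (𝓕 s) x • g x := by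
    apply integral_congr_ae
    filter_upwards [h2.coeFn_toLp] with x hx
    rw [hx]
  rw [e2]
  have e3 := VectorFourier.integral_fourierIntegral_smul_eq_flip (L := innerₗ ℝ) (μ := volume)
    (ν := volume) Real.continuous_fourierChar continuous_inner s.integrable h1
  simp only [flip_innerₗ] at e3
  have e4 : ∫ x, (𝓕 s) x • g x = ∫ x, s x • (𝓕 g) x := e3
  rw [e4]
  simp only [hsφ, Complex.real_smul, smul_eq_mul]

/-- The Fourier transform on `L²(ℝ)` in the normalization `(2π)⁻¹ ∫ e^{-iξy} g(y) dy`. -/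
noncomputable def l2Hat (g : Lp ℂ 2 (volume : Measure ℝ)) (ξ : ℝ) : ℂ :=
  (1 / (2 * Real.pi) : ℂ) * (𝓕 g : Lp ℂ 2 (volume : Measure ℝ)) (ξ / (2 * Real.pi))

theorem measurable_l2Hat (g : Lp ℂ 2 (volume : Measure ℝ)) : Measurable (l2Hat g) := by
  have h : Measurable ((𝓕 g : Lp ℂ 2 (volume : Measure ℝ)) : ℝ → ℂ) :=
    (Lp.stronglyMeasurable _).measurable
  exact (h.comp (measurable_id.div_const _)).const_mul _

theorem lintegral_comp_div {f : ℝ → ℝ≥0∞} (hf : Measurable f) {a : ℝ} (ha : 0 < a) :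
    ∫⁻ x, f (x / a) = ENNReal.ofReal a * ∫⁻ x, f x := by
  have h := Real.map_volume_mul_right (inv_ne_zero ha.ne')
  have h2 : ∫⁻ x, f x ∂(Measure.map (fun x => x * a⁻¹) volume) = ∫⁻ x, f (x * a⁻¹) :=
    lintegral_map hf (measurable_id.mul_const _)
  simp_rw [div_eq_mul_inv]
  rw [← h2]
  have h3 : Measure.map (fun x : ℝ => x * a⁻¹) volume = ENNReal.ofReal a • volume := by
    rw [h, inv_inv, abs_of_pos ha]
  rw [h3, lintegral_smul_measure, smul_eq_mul]

theorem ae_comp_div {P : ℝ → Prop} (h : ∀ᵐ x : ℝ, P x) {a : ℝ} (ha : 0 < a) :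
    ∀ᵐ x : ℝ, P (x / a) := by
  have h1 := (Measure.quasiMeasurePreserving_smul (E := ℝ) (μ := volume) (inv_ne_zero ha.ne')).ae h
  filter_upwards [h1] with x hx
  rwa [smul_eq_mul, mul_comm, ← div_eq_mul_inv] at hx

theorem lintegral_l2Hat (g : Lp ℂ 2 (volume : Measure ℝ)) :
    ∫⁻ ξ, ‖l2Hat g ξ‖ₑ ^ 2 = ENNReal.ofReal (2 * Real.pi)⁻¹ * ∫⁻ y, ‖g y‖ₑ ^ 2 := by
  have hpi : (0 : ℝ) < 2 * Real.pi := by positivity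
  have hm : Measurable ((𝓕 g : Lp ℂ 2 (volume : Measure ℝ)) : ℝ → ℂ) :=
    (Lp.stronglyMeasurable _).measurable
  have hsq : ∀ f : Lp ℂ 2 (volume : Measure ℝ), ∫⁻ y, ‖f y‖ₑ ^ 2 = ‖f‖ₑ ^ 2 := by
    intro f
    rw [Lp.enorm_def, eLpNorm_eq_lintegral_rpow_enorm_toReal (by norm_num) (by norm_num)]
    rw [← ENNReal.rpow_natCast, ← ENNReal.rpow_mul]
    simp
  have hc : ‖(1 / (2 * Real.pi) : ℂ)‖ₑ = ENNReal.ofReal (2 * Real.pi)⁻¹ := by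
    rw [← ofReal_norm]
    congr 1
    simp [abs_of_pos Real.pi_pos]
  unfold l2Hat
  simp_rw [enorm_mul, mul_pow, hc]
  have hm2 : Measurable fun ξ : ℝ =>
      ‖(𝓕 g : Lp ℂ 2 (volume : Measure ℝ)) (ξ / (2 * Real.pi))‖ₑ ^ 2 :=
    (hm.comp (measurable_id.div_const _)).enorm.pow_const 2
  rw [lintegral_const_mul _ hm2,
    lintegral_comp_div (f := fun x => ‖(𝓕 g : Lp ℂ 2 (volume : Measure ℝ)) x‖ₑ ^ 2)
      (hm.enorm.pow_const 2) hpi, hsq, hsq]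
  have hn : ‖(𝓕 g : Lp ℂ 2 (volume : Measure ℝ))‖ₑ = ‖g‖ₑ := by
    rw [← ofReal_norm, ← ofReal_norm, Lp.norm_fourier_eq]
  rw [hn, ← mul_assoc, sq, mul_assoc (ENNReal.ofReal _), ← ENNReal.ofReal_mul (by positivity),
    inv_mul_cancel₀ hpi.ne', ENNReal.ofReal_one, mul_one]

theorem l2Hat_sub_ae (f g : Lp ℂ 2 (volume : Measure ℝ)) :
    ∀ᵐ ξ, l2Hat (f - g) ξ = l2Hat f ξ - l2Hat g ξ := by
  have h : (𝓕 (f - g) : Lp ℂ 2 (volume : Measure ℝ))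
      = (𝓕 f : Lp ℂ 2 (volume : Measure ℝ)) - (𝓕 g : Lp ℂ 2 (volume : Measure ℝ)) :=
    (Lp.fourierTransformₗᵢ ℝ ℂ).map_sub f g
  have h2 := Lp.coeFn_sub (𝓕 f : Lp ℂ 2 (volume : Measure ℝ)) (𝓕 g : Lp ℂ 2 (volume : Measure ℝ))
  filter_upwards [ae_comp_div h2 (show (0 : ℝ) < 2 * Real.pi by positivity)] with ξ hξ
  unfold l2Hat
  rw [h, hξ, Pi.sub_apply, mul_sub]

theorem l2Hat_toLp_ae {g : ℝ → ℂ} (h1 : Integrable g) (h2 : MemLp g 2 (volume : Measure ℝ)) :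
    ∀ᵐ ξ : ℝ, l2Hat (h2.toLp g) ξ
      = (1 / (2 * Real.pi) : ℂ) * ∫ y : ℝ, Complex.exp (-(Complex.I * ξ * y)) * g y := by
  have hpi : (0 : ℝ) < 2 * Real.pi := by positivity
  filter_upwards [ae_comp_div (fourier_toLp_ae_eq h1 h2) hpi] with ξ hξ
  unfold l2Hat
  rw [hξ, Real.fourier_eq']
  congr 2; funext y
  rw [smul_eq_mul]
  congr 2
  simp only [RCLike.inner_apply, conj_trivial]
  push_cast
  have : (Real.pi : ℂ) ≠ 0 := by exact_mod_cast Real.pi_ne_zero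
  field_simp

theorem fourierHat_eq {G : ℝ → ℝ → ℝ} {k : ℤ} (h : MemLp (xMode G k) 2 (volume : Measure ℝ)) :
    fourierHat G k = l2Hat (h.toLp (xMode G k)) := by
  funext ξ
  unfold fourierHat l2Hat
  rw [dif_pos h]

theorem measurable_fourierHat (G : ℝ → ℝ → ℝ) (k : ℤ) : Measurable (fourierHat G k) := by
  by_cases h : MemLp (xMode G k) 2 (volume : Measure ℝ)
  · rw [fourierHat_eq h]; exact measurable_l2Hat _
  · have : fourierHat G k = fun _ => 0 := by
      funext ξ; unfold fourierHat; rw [dif_neg h]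
    rw [this]; exact measurable_const

theorem lintegral_fourierHat {G : ℝ → ℝ → ℝ} {k : ℤ}
    (h : MemLp (xMode G k) 2 (volume : Measure ℝ)) :
    ∫⁻ ξ, ‖fourierHat G k ξ‖ₑ ^ 2
      = ENNReal.ofReal (2 * Real.pi)⁻¹ * ∫⁻ y, ‖xMode G k y‖ₑ ^ 2 := by
  rw [fourierHat_eq h, lintegral_l2Hat]
  congr 1
  apply lintegral_congr_ae
  filter_upwards [h.coeFn_toLp] with y hy
  rw [hy]

section weighted

variable {w : ℝ → ℝ} {G : ℝ → ℝ → ℝ} {k : ℤ}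

theorem IsWeight.memLp_mul (hw : IsWeight w) (hG : Continuous fun p : ℝ × ℝ => G p.1 p.2) (k : ℤ) :
    MemLp (fun y => (w y : ℂ) * xMode G k y) 2 (volume : Measure ℝ) := by
  have hc := hw.continuous
  have hx := continuous_xMode hG k
  refine Continuous.memLp_of_hasCompactSupport (by fun_prop) ?_
  refine HasCompactSupport.mul_right ?_
  exact hw.compact.comp_left (g := fun r : ℝ => (r : ℂ)) Complex.ofReal_zero

theorem weightedHat_ae_eq (hw : IsWeight w) (hG : Continuous fun p : ℝ × ℝ => G p.1 p.2) (k : ℤ) :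
    ∀ᵐ ξ : ℝ, l2Hat ((hw.memLp_mul hG k).toLp _) ξ = weightedHat w G k ξ := by
  filter_upwards [l2Hat_toLp_ae (hw.integrable_mul (continuous_xMode hG k)) (hw.memLp_mul hG k)]
    with ξ hξ
  rw [hξ]
  unfold weightedHat
  congr 2; funext y; ring

/-- Plancherel's theorem for the localized Fourier transform. -/
theorem lintegral_weightedHat (hw : IsWeight w) (hG : Continuous fun p : ℝ × ℝ => G p.1 p.2)
    (k : ℤ) :
    ∫⁻ ξ, ‖weightedHat w G k ξ‖ₑ ^ 2
      = ENNReal.ofReal (2 * Real.pi)⁻¹ * ∫⁻ y, ‖(w y : ℂ) * xMode G k y‖ₑ ^ 2 := by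
  have h1 : ∫⁻ ξ, ‖weightedHat w G k ξ‖ₑ ^ 2
      = ∫⁻ ξ, ‖l2Hat ((hw.memLp_mul hG k).toLp _) ξ‖ₑ ^ 2 := by
    apply lintegral_congr_ae
    filter_upwards [weightedHat_ae_eq hw hG k] with ξ hξ
    rw [hξ]
  rw [h1, lintegral_l2Hat]
  congr 1
  apply lintegral_congr_ae
  filter_upwards [(hw.memLp_mul hG k).coeFn_toLp] with y hy
  rw [hy]

theorem lintegral_fourierHat_sub_weightedHat (hw : IsWeight w)
    (hG : Continuous fun p : ℝ × ℝ => G p.1 p.2)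
    (h : MemLp (xMode G k) 2 (volume : Measure ℝ)) :
    ∫⁻ ξ, ‖fourierHat G k ξ - weightedHat w G k ξ‖ₑ ^ 2
      = ENNReal.ofReal (2 * Real.pi)⁻¹ * ∫⁻ y, ‖(1 - w y : ℂ) * xMode G k y‖ₑ ^ 2 := by
  have h1 : ∫⁻ ξ, ‖fourierHat G k ξ - weightedHat w G k ξ‖ₑ ^ 2
      = ∫⁻ ξ, ‖l2Hat (h.toLp (xMode G k) - (hw.memLp_mul hG k).toLp _) ξ‖ₑ ^ 2 := by
    apply lintegral_congr_ae
    filter_upwards [weightedHat_ae_eq hw hG k,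
      l2Hat_sub_ae (h.toLp (xMode G k)) ((hw.memLp_mul hG k).toLp _)] with ξ hξ hξ2
    rw [hξ2, hξ, fourierHat_eq h]
  rw [h1, lintegral_l2Hat]
  congr 1
  apply lintegral_congr_ae
  filter_upwards [(hw.memLp_mul hG k).coeFn_toLp, h.coeFn_toLp,
    Lp.coeFn_sub (h.toLp (xMode G k)) ((hw.memLp_mul hG k).toLp _)] with y hy hy2 hy3
  rw [hy3, Pi.sub_apply, hy, hy2]
  congr 2; ring

end weighted

/-- Parseval's identity in `x`. -/
theorem tsum_xMode_sq {G : ℝ → ℝ → ℝ} {y : ℝ} (hG : Continuous fun x => G x y) :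
    ∑' k : ℤ, ‖xMode G k y‖ₑ ^ 2
      = ENNReal.ofReal (2 * Real.pi) * ∫⁻ x in Ioc 0 (2 * Real.pi), ‖G x y‖ₑ ^ 2 := by
  have hpi : (0 : ℝ) < 2 * Real.pi := by positivity
  set f : ℝ → ℂ := fun x => (G x y : ℂ) with hf
  have hfc : Continuous f := by fun_prop
  have hL2 : MemLp f 2 (volume.restrict (Ioc 0 (2 * Real.pi))) := by
    have h := (hfc.memLp_of_hasCompactSupport (p := 2) (μ := volume.restrict (Icc 0 (2 * Real.pi))))
    have hb : ∃ M, ∀ x ∈ Icc 0 (2 * Real.pi), ‖f x‖ ≤ M :=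
      isCompact_Icc.exists_bound_of_continuousOn hfc.continuousOn
    obtain ⟨M, hM⟩ := hb
    refine MemLp.of_bound hfc.aestronglyMeasurable M ?_
    filter_upwards [ae_restrict_mem measurableSet_Ioc] with x hx
    exact hM x (Ioc_subset_Icc_self hx)
  have hcoef : ∀ k : ℤ, fourierCoeffOn hpi f k = (1 / (2 * Real.pi) : ℝ) • xMode G k y := by
    intro k
    rw [fourierCoeffOn_eq_integral, sub_zero]
    congr 1
    unfold xMode
    congr 1; funext x
    rw [fourier_coe_apply, smul_eq_mul]
    congr 2
    have : (Real.pi : ℂ) ≠ 0 := by exact_mod_cast Real.pi_ne_zero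
    push_cast
    field_simp
  have hs := hasSum_sq_fourierCoeffOn hpi hL2
  simp_rw [hcoef, norm_smul, mul_pow] at hs
  have hs2 := hs.mul_left ((2 * Real.pi) ^ 2)
  have hterm : ∀ k : ℤ, ‖xMode G k y‖ₑ ^ 2 = ENNReal.ofReal
      ((2 * Real.pi) ^ 2 * (‖(1 / (2 * Real.pi) : ℝ)‖ ^ 2 * ‖xMode G k y‖ ^ 2)) := by
    intro k
    rw [← ofReal_norm, ← ENNReal.ofReal_pow (norm_nonneg _)]
    congr 1
    rw [Real.norm_eq_abs, abs_of_pos (by positivity)]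
    field_simp
  simp_rw [hterm]
  rw [← ENNReal.ofReal_tsum_of_nonneg (fun k => by positivity) hs2.summable, hs2.tsum_eq]
  have hint : Integrable (fun x => ‖f x‖ ^ 2) (volume.restrict (Ioc 0 (2 * Real.pi))) :=
    hL2.integrable_norm_pow (by norm_num)
  have hI : ∫⁻ x in Ioc 0 (2 * Real.pi), ‖G x y‖ₑ ^ 2
      = ENNReal.ofReal (∫ x in (0 : ℝ)..(2 * Real.pi), ‖f x‖ ^ 2) := by
    rw [intervalIntegral.integral_of_le hpi.le, ofReal_integral_eq_lintegral_ofReal hint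
      (Filter.Eventually.of_forall fun x => by positivity)]
    congr 1; funext x
    rw [← ofReal_norm, ENNReal.ofReal_pow (norm_nonneg _)]
    simp [hf]
  rw [hI, ← ENNReal.ofReal_mul hpi.le]
  congr 1
  rw [sub_zero, smul_eq_mul]
  field_simp

theorem l2Norm_sq {G : ℝ → ℝ → ℝ} (hG : Continuous fun p : ℝ × ℝ => G p.1 p.2) :
    l2Norm G ^ 2 = ENNReal.ofReal (2 * Real.pi)⁻¹ * ∑' k : ℤ, ∫⁻ y, ‖xMode G k y‖ₑ ^ 2 := by
  have hpi : (0 : ℝ) < 2 * Real.pi := by positivity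
  rw [← lintegral_tsum fun k => ((continuous_xMode hG k).enorm.measurable.pow_const 2).aemeasurable]
  have h1 : ∀ y, ∑' k : ℤ, ‖xMode G k y‖ₑ ^ 2
      = ENNReal.ofReal (2 * Real.pi) * ∫⁻ x in Ioc 0 (2 * Real.pi), ‖G x y‖ₑ ^ 2 := fun y =>
    tsum_xMode_sq (hG.comp (by fun_prop : Continuous fun x : ℝ => (x, y)))
  simp_rw [h1]
  have hm : Measurable fun p : ℝ × ℝ => ‖G p.1 p.2‖ₑ ^ 2 := hG.enorm.measurable.pow_const 2
  rw [lintegral_const_mul _ (Measurable.lintegral_prod_left' hm), ← mul_assoc,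
    ← ENNReal.ofReal_mul (by positivity), inv_mul_cancel₀ hpi.ne', ENNReal.ofReal_one, one_mul]
  unfold l2Norm cylMeasure
  rw [eLpNorm_eq_lintegral_rpow_enorm_toReal (by norm_num) (by norm_num), ← ENNReal.rpow_natCast,
    ← ENNReal.rpow_mul]
  simp only [ENNReal.toReal_ofNat, Nat.cast_ofNat, ENNReal.rpow_ofNat, one_div]
  rw [inv_mul_cancel₀ (by norm_num : (2 : ℝ) ≠ 0), ENNReal.rpow_one]
  rw [lintegral_prod_symm' _ hm]

theorem lintegral_xMode_le {G : ℝ → ℝ → ℝ} (hG : Continuous fun p : ℝ × ℝ => G p.1 p.2) (k : ℤ) :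
    ENNReal.ofReal (2 * Real.pi)⁻¹ * ∫⁻ y, ‖xMode G k y‖ₑ ^ 2 ≤ l2Norm G ^ 2 := by
  rw [l2Norm_sq hG]
  gcongr
  exact ENNReal.le_tsum k

theorem hasL2Modes_of_l2Norm {G : ℝ → ℝ → ℝ} (hG : Continuous fun p : ℝ × ℝ => G p.1 p.2)
    (h : l2Norm G < ⊤) : HasL2Modes G := by
  intro k
  refine ⟨(continuous_xMode hG k).aestronglyMeasurable, ?_⟩
  rw [eLpNorm_lt_top_iff_lintegral_rpow_enorm_lt_top (by norm_num) (by norm_num)]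
  have h1 := (lintegral_xMode_le hG k).trans_lt (ENNReal.pow_lt_top h)
  simp only [ENNReal.toReal_ofNat, ENNReal.rpow_ofNat]
  refine lt_top_iff_ne_top.2 fun htop => ?_
  rw [htop, ENNReal.mul_top] at h1
  · exact lt_irrefl _ h1
  · simp [Real.pi_pos]

/-- Plancherel's theorem on the cylinder. -/
theorem l2Norm_sq_eq_tsum {G : ℝ → ℝ → ℝ} (hG : Continuous fun p : ℝ × ℝ => G p.1 p.2)
    (h : l2Norm G < ⊤) : l2Norm G ^ 2 = ∑' k : ℤ, ∫⁻ ξ, ‖fourierHat G k ξ‖ₑ ^ 2 := by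
  have hm := hasL2Modes_of_l2Norm hG h
  rw [l2Norm_sq hG, ← ENNReal.tsum_mul_left]
  congr 1; funext k
  rw [lintegral_fourierHat (hm k)]

end EulerPoisson

/-! ### The localized Fourier modes of a solution -/

namespace EulerPoisson

open Set

/-- The localized Fourier transform along the characteristics of the Couette flow. Negative times
are replaced by `0`, so that this is continuous on the whole line. -/
noncomputable def movingHat (w : ℝ → ℝ) (F : ℝ → ℝ → ℝ → ℝ) (k : ℤ) (ξ s : ℝ) : ℂ :=
  weightedHat w (F (max s 0)) k (ξ - k * s)

theorem movingHat_of_nonneg (w : ℝ → ℝ) (F : ℝ → ℝ → ℝ → ℝ) (k : ℤ) (ξ : ℝ) {s : ℝ} (hs : 0 ≤ s) :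
    movingHat w F k ξ s = weightedHat w (F s) k (ξ - k * s) := by
  rw [movingHat, max_eq_left hs]

theorem continuous_movingHat_uncurry {w : ℝ → ℝ} (hw : IsWeight w) {F : ℝ → ℝ → ℝ → ℝ}
    (hF : SmoothOnCylinder F) (k : ℤ) :
    Continuous fun p : ℝ × ℝ => movingHat w F k p.2 p.1 :=
  continuous_weightedHat hw hF k

theorem continuous_movingHat {w : ℝ → ℝ} (hw : IsWeight w) {F : ℝ → ℝ → ℝ → ℝ}
    (hF : SmoothOnCylinder F) (k : ℤ) (ξ : ℝ) : Continuous (movingHat w F k ξ) :=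
  Continuous.comp (g := fun p : ℝ × ℝ => movingHat w F k p.2 p.1) (f := fun s : ℝ => (s, ξ))
    (continuous_movingHat_uncurry hw hF k) (by fun_prop)

theorem hasDerivAt_movingHat {w : ℝ → ℝ} (hw : IsWeight w) {F : ℝ → ℝ → ℝ → ℝ}
    (hF : SmoothOnCylinder F) {t : ℝ} (ht : 0 < t) (k : ℤ) (ξ : ℝ) :
    HasDerivAt (movingHat w F k ξ)
      (weightedHat w (fun x y => dT F t x y + y * dX (F t) x y) k (ξ - k * t)) t := by
  refine (hasDerivAt_weightedHat hw hF ht k ξ).congr_of_eventuallyEq ?_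
  filter_upwards [lt_mem_nhds ht] with s hs
  exact movingHat_of_nonneg w F k ξ hs.le

namespace IsSmoothSolution

variable {e m Tp Tm : ℝ} {η ux uy φ : ℝ → ℝ → ℝ → ℝ} {w : ℝ → ℝ}

theorem hasDerivAt_density (h : IsSmoothSolution e m Tp Tm η ux uy φ) (hw : IsWeight w)
    {t : ℝ} (ht : 0 < t) (k : ℤ) (ξ : ℝ) :
    HasDerivAt (movingHat w η k ξ)
      (-(Complex.I * k * movingHat w ux k ξ t
          + Complex.I * ((ξ - k * t : ℝ) : ℂ) * movingHat w uy k ξ t)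
        + movingHat (deriv w) uy k ξ t) t := by
  have sx := h.smooth_ux.isCylSmooth ht.le
  have sy := h.smooth_uy.isCylSmooth ht.le
  refine (hasDerivAt_movingHat hw h.smooth_η ht k ξ).congr_deriv ?_
  have e1 : (fun x y => dT η t x y + y * dX (η t) x y)
      = fun x y => (-1) * (dX (ux t) x y + dY (uy t) x y) := by
    funext x y
    have := h.continuity_eq t x y ht
    simp only [divergence] at this
    simp only [dT, dX, dY]
    linarith
  simp only [movingHat_of_nonneg _ _ _ _ ht.le]
  rw [e1, weightedHat_const_mul, weightedHat_add hw sx.dX.continuous sy.dY.continuous,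
    weightedHat_dX sx, weightedHat_dY hw sy]
  push_cast; ring

theorem hasDerivAt_velocityX (h : IsSmoothSolution e m Tp Tm η ux uy φ) (hw : IsWeight w)
    {t : ℝ} (ht : 0 < t) (k : ℤ) (ξ : ℝ) :
    HasDerivAt (movingHat w ux k ξ)
      (-movingHat w uy k ξ t - Complex.I * k * ((Tp / m : ℝ) * movingHat w η k ξ t
        + (e / m : ℝ) * movingHat w φ k ξ t)) t := by
  have sη := h.smooth_η.isCylSmooth ht.le
  have sφ := h.smooth_φ.isCylSmooth ht.le
  have sy := h.smooth_uy.isCylSmooth ht.le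
  refine (hasDerivAt_movingHat hw h.smooth_ux ht k ξ).congr_deriv ?_
  have e1 : (fun x y => dT ux t x y + y * dX (ux t) x y)
      = fun x y => (-1) * uy t x y
        + ((-(Tp / m)) * dX (η t) x y + (-(e / m)) * dX (φ t) x y) := by
    funext x y
    have := h.momentum_x t x y ht
    simp only [dT, dX]
    linarith
  have c1 := sη.dX.continuous
  have c2 := sφ.dX.continuous
  have c3 := sy.continuous
  simp only [movingHat_of_nonneg _ _ _ _ ht.le]
  rw [e1, weightedHat_add (G := fun x y => (-1) * uy t x y)
    (H := fun x y => (-(Tp / m)) * dX (η t) x y + (-(e / m)) * dX (φ t) x y) hw (by fun_prop)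
    (by fun_prop), weightedHat_add (G := fun x y => (-(Tp / m)) * dX (η t) x y)
    (H := fun x y => (-(e / m)) * dX (φ t) x y) hw (by fun_prop) (by fun_prop),
    weightedHat_const_mul, weightedHat_const_mul, weightedHat_const_mul, weightedHat_dX sη,
    weightedHat_dX sφ]
  push_cast; ring

theorem hasDerivAt_velocityY (h : IsSmoothSolution e m Tp Tm η ux uy φ) (hw : IsWeight w)
    {t : ℝ} (ht : 0 < t) (k : ℤ) (ξ : ℝ) :
    HasDerivAt (movingHat w uy k ξ)
      (-(Complex.I * ((ξ - k * t : ℝ) : ℂ)) * ((Tp / m : ℝ) * movingHat w η k ξ t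
        + (e / m : ℝ) * movingHat w φ k ξ t)
        + ((Tp / m : ℝ) * movingHat (deriv w) η k ξ t
        + (e / m : ℝ) * movingHat (deriv w) φ k ξ t)) t := by
  have sη := h.smooth_η.isCylSmooth ht.le
  have sφ := h.smooth_φ.isCylSmooth ht.le
  refine (hasDerivAt_movingHat hw h.smooth_uy ht k ξ).congr_deriv ?_
  have e1 : (fun x y => dT uy t x y + y * dX (uy t) x y)
      = fun x y => (-(Tp / m)) * dY (η t) x y + (-(e / m)) * dY (φ t) x y := by
    funext x y
    have := h.momentum_y t x y ht
    simp only [dT, dX, dY]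
    linarith
  have c1 := sη.dY.continuous
  have c2 := sφ.dY.continuous
  simp only [movingHat_of_nonneg _ _ _ _ ht.le]
  rw [e1, weightedHat_add (G := fun x y => (-(Tp / m)) * dY (η t) x y)
    (H := fun x y => (-(e / m)) * dY (φ t) x y) hw (by fun_prop) (by fun_prop),
    weightedHat_const_mul, weightedHat_const_mul, weightedHat_dY hw sη, weightedHat_dY hw sφ]
  push_cast; ring

/-- Poisson's equation for the localized modes. Localization produces an error. -/
theorem poisson_weightedHat (h : IsSmoothSolution e m Tp Tm η ux uy φ) (hw : IsWeight w)
    {t : ℝ} (ht : 0 ≤ t) (k : ℤ) (q : ℝ) :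
    ((k ^ 2 + q ^ 2 + 4 * Real.pi * e ^ 2 / Tm : ℝ) : ℂ) * weightedHat w (φ t) k q
      = (4 * Real.pi * e : ℝ) * weightedHat w (η t) k q
        + (weightedHat (deriv (deriv w)) (φ t) k q
          - 2 * Complex.I * q * weightedHat (deriv w) (φ t) k q) := by
  have sη := h.smooth_η.isCylSmooth ht
  have sφ := h.smooth_φ.isCylSmooth ht
  have e1 : (fun x y => dX (dX (φ t)) x y + dY (dY (φ t)) x y)
      = fun x y => (4 * Real.pi * e ^ 2 / Tm) * φ t x y + (-(4 * Real.pi * e)) * η t x y := by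
    funext x y
    have := h.poisson_eq t x y ht
    simp only [laplacian, iteratedDeriv_succ, iteratedDeriv_zero] at this
    simp only [dX, dY]
    rw [this]; ring
  have c1 := sη.continuous
  have c2 := sφ.continuous
  have e2 : weightedHat w (fun x y => dX (dX (φ t)) x y + dY (dY (φ t)) x y) k q
      = weightedHat w (fun x y =>
        (4 * Real.pi * e ^ 2 / Tm) * φ t x y + (-(4 * Real.pi * e)) * η t x y) k q := by rw [e1]
  rw [weightedHat_add hw sφ.dX.dX.continuous sφ.dY.dY.continuous, weightedHat_dX sφ.dX,
    weightedHat_dX sφ, weightedHat_dY hw sφ.dY, weightedHat_dY hw sφ, weightedHat_dY hw.deriv sφ,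
    weightedHat_add (G := fun x y => (4 * Real.pi * e ^ 2 / Tm) * φ t x y)
    (H := fun x y => (-(4 * Real.pi * e)) * η t x y) hw (by fun_prop) (by fun_prop),
    weightedHat_const_mul, weightedHat_const_mul] at e2
  push_cast at e2 ⊢
  have hI : Complex.I ^ 2 = -1 := Complex.I_sq
  linear_combination -e2 + (k ^ 2 + q ^ 2) * weightedHat w (φ t) k q * hI

end IsSmoothSolution

/-- The localized divergence of the velocity, along the characteristics. -/
noncomputable def movingDiv (w : ℝ → ℝ) (ux uy : ℝ → ℝ → ℝ → ℝ) (k : ℤ) (ξ s : ℝ) : ℂ :=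
  Complex.I * k * movingHat w ux k ξ s + Complex.I * ((ξ - k * s : ℝ) : ℂ) * movingHat w uy k ξ s

/-- The localized sum of density and vorticity, along the characteristics. It is conserved up to
the error of the localization. -/
noncomputable def movingSum (w : ℝ → ℝ) (η ux uy : ℝ → ℝ → ℝ → ℝ) (k : ℤ) (ξ s : ℝ) : ℂ :=
  movingHat w η k ξ s + (-(Complex.I * ((ξ - k * s : ℝ) : ℂ)) * movingHat w ux k ξ s
    + Complex.I * k * movingHat w uy k ξ s)

/-- The squared size of the terms produced by the localization. -/
noncomputable def cutoffError (w : ℝ → ℝ) (η uy φ : ℝ → ℝ → ℝ → ℝ) (k : ℤ) (ξ s : ℝ) : ℝ :=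
  ‖movingHat (deriv w) uy k ξ s‖ ^ 2 + ‖movingHat (deriv w) η k ξ s‖ ^ 2
    + ‖movingHat (deriv w) φ k ξ s‖ ^ 2 + ‖movingHat (deriv (deriv w)) φ k ξ s‖ ^ 2

theorem norm_add_sq_le {E : Type*} [SeminormedAddCommGroup E] (a b : E) :
    ‖a + b‖ ^ 2 ≤ 2 * ‖a‖ ^ 2 + 2 * ‖b‖ ^ 2 := by
  have h := norm_add_le a b
  nlinarith [norm_nonneg (a + b), norm_nonneg a, norm_nonneg b, sq_nonneg (‖a‖ - ‖b‖)]

theorem norm_sub_sq_le {E : Type*} [SeminormedAddCommGroup E] (a b : E) :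
    ‖a - b‖ ^ 2 ≤ 2 * ‖a‖ ^ 2 + 2 * ‖b‖ ^ 2 := by
  simpa [sub_eq_add_neg] using norm_add_sq_le a (-b)

theorem _root_.HasDerivAt.complex_re {f : ℝ → ℂ} {f' : ℂ} {x : ℝ} (h : HasDerivAt f f' x) :
    HasDerivAt (fun x => (f x).re) f'.re x :=
  Complex.reCLM.hasFDerivAt.comp_hasDerivAt x h

theorem _root_.HasDerivAt.complex_im {f : ℝ → ℂ} {f' : ℂ} {x : ℝ} (h : HasDerivAt f f' x) :
    HasDerivAt (fun x => (f x).im) f'.im x :=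
  Complex.imCLM.hasFDerivAt.comp_hasDerivAt x h

theorem sq_norm_eq_re_im (z : ℂ) : ‖z‖ ^ 2 = z.re ^ 2 + z.im ^ 2 := by
  rw [Complex.sq_norm, Complex.normSq_apply]; ring

/-- A quantity whose time derivative is `h` is controlled by its initial value and by `h`. -/
theorem norm_sq_le_of_hasDerivAt {t : ℝ} (ht : 0 ≤ t) {Γ h : ℝ → ℂ} (hΓ : Continuous Γ)
    (hh : Continuous h) (hd : ∀ s ∈ Ioo 0 t, HasDerivAt Γ (h s) s) :
    ‖Γ t‖ ^ 2 ≤ 2 * ‖Γ 0‖ ^ 2 + 2 * t * ∫ s in (0 : ℝ)..t, ‖h s‖ ^ 2 := by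
  have hftc : ∫ s in (0 : ℝ)..t, h s = Γ t - Γ 0 :=
    intervalIntegral.integral_eq_sub_of_hasDerivAt_of_le ht hΓ.continuousOn hd
      (hh.intervalIntegrable _ _)
  have hn : ‖Γ t - Γ 0‖ ≤ ∫ s in (0 : ℝ)..t, ‖h s‖ := by
    rw [← hftc]; exact intervalIntegral.norm_integral_le_integral_norm ht
  set I := ∫ s in (0 : ℝ)..t, ‖h s‖ with hI
  set J := ∫ s in (0 : ℝ)..t, ‖h s‖ ^ 2 with hJ
  have hI0 : 0 ≤ I := intervalIntegral.integral_nonneg ht fun _ _ => norm_nonneg _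
  -- Cauchy-Schwarz, from the nonnegativity of `∫ (t ‖h‖ - I) ^ 2`
  have hcs : I ^ 2 ≤ t * J := by
    rcases ht.eq_or_lt with rfl | htp
    · simp [hI]
    have h0 : 0 ≤ ∫ s in (0 : ℝ)..t, (t * ‖h s‖ - I) ^ 2 :=
      intervalIntegral.integral_nonneg ht fun _ _ => sq_nonneg _
    have h1 : ∫ s in (0 : ℝ)..t, (t * ‖h s‖ - I) ^ 2 = t ^ 2 * J - t * I ^ 2 := by
      have : ∀ s, (t * ‖h s‖ - I) ^ 2 = (t ^ 2 * ‖h s‖ ^ 2 - 2 * t * I * ‖h s‖) + I ^ 2 :=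
        fun s => by ring
      simp_rw [this]
      rw [intervalIntegral.integral_add, intervalIntegral.integral_sub,
        intervalIntegral.integral_const_mul, intervalIntegral.integral_const_mul,
        intervalIntegral.integral_const, smul_eq_mul, ← hI, ← hJ]
      · ring
      all_goals exact Continuous.intervalIntegrable (by fun_prop) _ _
    rw [h1] at h0
    have : 0 ≤ t * (t * J - I ^ 2) := by linarith
    linarith [nonneg_of_mul_nonneg_right this htp]
  have h3 := norm_add_sq_le (Γ 0) (Γ t - Γ 0)
  rw [add_sub_cancel] at h3
  have h4 : ‖Γ t - Γ 0‖ ^ 2 ≤ I ^ 2 := pow_le_pow_left₀ (norm_nonneg _) hn 2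
  linarith

/-- `mode_energy_bound` for complex-valued modes: real and imaginary parts solve the same
equations. -/
theorem mode_energy_bound_complex {c2 κ d : ℝ} (hc2 : 0 < c2) (hκ : 0 ≤ κ) (hd : 0 ≤ d) :
    ∃ C : ℝ, 0 < C ∧ ∀ k ξ t : ℝ, 1 ≤ k ^ 2 → 0 ≤ t → ∃ L : ℝ, 0 ≤ L ∧
      ∀ N Ψ Γ f g h : ℝ → ℂ, Continuous N → Continuous Ψ → Continuous Γ →
        Continuous f → Continuous g → Continuous h →
        (∀ s ∈ Ioo 0 t, HasDerivAt N (-Ψ s + f s) s) →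
        (∀ s ∈ Ioo 0 t, HasDerivAt Ψ (((2 * shearRate k ξ s : ℝ) : ℂ) * Ψ s
          + (pressureCoeff c2 κ d k ξ s : ℂ) * N s
          - ((2 * (k ^ 2 / shearSq k ξ s) : ℝ) : ℂ) * Γ s + g s) s) →
        (∀ s ∈ Ioo 0 t, HasDerivAt Γ (h s) s) →
        shearSq k ξ t ^ (-3 / 2 : ℝ) * (shearSq k ξ t * ‖N t‖ ^ 2 + ‖Ψ t‖ ^ 2)
            + (k ^ 2) ^ (-3 / 2 : ℝ) * ‖Γ t‖ ^ 2
          ≤ C * (shearSq k ξ 0 ^ (-3 / 2 : ℝ) * (shearSq k ξ 0 * ‖N 0‖ ^ 2 + ‖Ψ 0‖ ^ 2)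
            + (k ^ 2) ^ (-3 / 2 : ℝ) * ‖Γ 0‖ ^ 2
            + L * ∫ s in (0 : ℝ)..t, (‖f s‖ ^ 2 + ‖g s‖ ^ 2 + ‖h s‖ ^ 2)) := by
  obtain ⟨C, hC, H⟩ := mode_energy_bound hc2 hκ hd
  refine ⟨C, hC, fun k ξ t hk ht => ?_⟩
  obtain ⟨L, hL, H⟩ := H k ξ t hk ht
  refine ⟨L, hL, fun N Ψ Γ f g h cN cΨ cΓ cf cg ch dN dΨ dΓ => ?_⟩
  have hr := H (fun s => (N s).re) (fun s => (Ψ s).re) (fun s => (Γ s).re) (fun s => (f s).re)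
    (fun s => (g s).re) (fun s => (h s).re) (by fun_prop) (by fun_prop) (by fun_prop)
    (by fun_prop) (by fun_prop) (by fun_prop)
    (fun s hs => by simpa using (dN s hs).complex_re)
    (fun s hs => by
      refine (dΨ s hs).complex_re.congr_deriv ?_
      simp only [Complex.add_re, Complex.sub_re, Complex.re_ofReal_mul])
    (fun s hs => (dΓ s hs).complex_re)
  have hi := H (fun s => (N s).im) (fun s => (Ψ s).im) (fun s => (Γ s).im) (fun s => (f s).im)
    (fun s => (g s).im) (fun s => (h s).im) (by fun_prop) (by fun_prop) (by fun_prop)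
    (by fun_prop) (by fun_prop) (by fun_prop)
    (fun s hs => by simpa using (dN s hs).complex_im)
    (fun s hs => by
      refine (dΨ s hs).complex_im.congr_deriv ?_
      simp only [Complex.add_im, Complex.sub_im, Complex.im_ofReal_mul])
    (fun s hs => (dΓ s hs).complex_im)
  have hint : ∫ s in (0 : ℝ)..t, (‖f s‖ ^ 2 + ‖g s‖ ^ 2 + ‖h s‖ ^ 2)
      = (∫ s in (0 : ℝ)..t, ((f s).re ^ 2 + (g s).re ^ 2 + (h s).re ^ 2))
        + ∫ s in (0 : ℝ)..t, ((f s).im ^ 2 + (g s).im ^ 2 + (h s).im ^ 2) := by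
    rw [← intervalIntegral.integral_add]
    · congr 1; funext s
      rw [sq_norm_eq_re_im, sq_norm_eq_re_im, sq_norm_eq_re_im]; ring
    all_goals exact Continuous.intervalIntegrable (by fun_prop) _ _
  rw [hint]
  simp only [sq_norm_eq_re_im]
  linarith

theorem sq_norm_le_cutoffError (w : ℝ → ℝ) (η uy φ : ℝ → ℝ → ℝ → ℝ) (k : ℤ) (ξ s : ℝ) :
    ‖movingHat (deriv w) uy k ξ s‖ ^ 2 ≤ cutoffError w η uy φ k ξ s ∧
    ‖movingHat (deriv w) η k ξ s‖ ^ 2 + ‖movingHat (deriv w) φ k ξ s‖ ^ 2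
      + ‖movingHat (deriv (deriv w)) φ k ξ s‖ ^ 2 ≤ cutoffError w η uy φ k ξ s := by
  unfold cutoffError
  constructor
  · have a2 := sq_nonneg ‖movingHat (deriv w) η k ξ s‖
    have a3 := sq_nonneg ‖movingHat (deriv w) φ k ξ s‖
    have a4 := sq_nonneg ‖movingHat (deriv (deriv w)) φ k ξ s‖
    linarith
  · have a1 := sq_nonneg ‖movingHat (deriv w) uy k ξ s‖
    linarith

theorem cutoffError_nonneg (w : ℝ → ℝ) (η uy φ : ℝ → ℝ → ℝ → ℝ) (k : ℤ) (ξ s : ℝ) :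
    0 ≤ cutoffError w η uy φ k ξ s := by
  unfold cutoffError; positivity

theorem velocityForcing_sq_le (c2 β : ℝ) (w : ℝ → ℝ) (η uy φ : ℝ → ℝ → ℝ → ℝ) (k : ℤ) (ξ s : ℝ) :
    ‖(c2 : ℂ) * movingHat (deriv w) η k ξ s + (β : ℂ) * movingHat (deriv w) φ k ξ s‖ ^ 2
      ≤ (2 * c2 ^ 2 + 2 * β ^ 2) * cutoffError w η uy φ k ξ s := by
  refine (norm_add_sq_le _ _).trans ?_
  simp only [norm_mul, mul_pow, Complex.norm_real, Real.norm_eq_abs, sq_abs]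
  have h := (sq_norm_le_cutoffError w η uy φ k ξ s).2
  have a2 := sq_nonneg ‖movingHat (deriv w) η k ξ s‖
  have a3 := sq_nonneg ‖movingHat (deriv w) φ k ξ s‖
  have a4 := sq_nonneg ‖movingHat (deriv (deriv w)) φ k ξ s‖
  have b1 := mul_le_mul_of_nonneg_left (show ‖movingHat (deriv w) η k ξ s‖ ^ 2
    ≤ cutoffError w η uy φ k ξ s by linarith) (sq_nonneg c2)
  have b2 := mul_le_mul_of_nonneg_left (show ‖movingHat (deriv w) φ k ξ s‖ ^ 2
    ≤ cutoffError w η uy φ k ξ s by linarith) (sq_nonneg β)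
  linarith

theorem poissonForcing_sq_le {Q : ℝ} (w : ℝ → ℝ) (η uy φ : ℝ → ℝ → ℝ → ℝ) (k : ℤ) {ξ s : ℝ}
    (hQ : (ξ - k * s) ^ 2 ≤ Q) :
    ‖movingHat (deriv (deriv w)) φ k ξ s
        - 2 * Complex.I * ((ξ - k * s : ℝ) : ℂ) * movingHat (deriv w) φ k ξ s‖ ^ 2
      ≤ (2 + 8 * Q) * cutoffError w η uy φ k ξ s := by
  refine (norm_sub_sq_le _ _).trans ?_
  simp only [norm_mul, mul_pow, Complex.norm_real, Real.norm_eq_abs, sq_abs, Complex.norm_I,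
    one_pow, Complex.norm_ofNat]
  have h := (sq_norm_le_cutoffError w η uy φ k ξ s).2
  have a2 := sq_nonneg ‖movingHat (deriv w) η k ξ s‖
  have a3 := sq_nonneg ‖movingHat (deriv w) φ k ξ s‖
  have a4 := sq_nonneg ‖movingHat (deriv (deriv w)) φ k ξ s‖
  have b1 := mul_le_mul hQ (show ‖movingHat (deriv w) φ k ξ s‖ ^ 2
    ≤ cutoffError w η uy φ k ξ s by linarith) a3 ((sq_nonneg _).trans hQ)
  linarith

set_option maxHeartbeats 1000000 in
/-- Localized modes with `k ≠ 0` obey the energy estimate up to the localization error, and the sum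
of density and vorticity is conserved up to that error. -/
theorem localized_mode_bound {e m Tp Tm : ℝ} (he : 0 < e) (hm : 0 < m) (hTp : 0 < Tp)
    (hTm : 0 < Tm) :
    ∃ C : ℝ, 0 < C ∧ ∀ (k : ℤ) (ξ t : ℝ), k ≠ 0 → 0 ≤ t → ∃ L : ℝ, 0 ≤ L ∧
      ∀ η ux uy φ : ℝ → ℝ → ℝ → ℝ, IsSmoothSolution e m Tp Tm η ux uy φ →
      ∀ w : ℝ → ℝ, IsWeight w →
        shearSq k ξ t ^ (-3 / 2 : ℝ) * (shearSq k ξ t * ‖movingHat w η k ξ t‖ ^ 2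
              + ‖movingDiv w ux uy k ξ t‖ ^ 2)
            + ((k : ℝ) ^ 2) ^ (-3 / 2 : ℝ) * ‖movingSum w η ux uy k ξ t‖ ^ 2
          ≤ C * (shearSq k ξ 0 ^ (-3 / 2 : ℝ) * (shearSq k ξ 0 * ‖movingHat w η k ξ 0‖ ^ 2
              + ‖movingDiv w ux uy k ξ 0‖ ^ 2)
            + ((k : ℝ) ^ 2) ^ (-3 / 2 : ℝ) * ‖movingSum w η ux uy k ξ 0‖ ^ 2)
            + L * ∫ s in (0 : ℝ)..t, cutoffError w η uy φ k ξ s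
        ∧ ‖movingSum w η ux uy k ξ t‖ ^ 2 ≤ 2 * ‖movingSum w η ux uy k ξ 0‖ ^ 2
            + L * ∫ s in (0 : ℝ)..t, cutoffError w η uy φ k ξ s := by
  have hpi := Real.pi_pos
  set c2 := Tp / m with hc2
  set β := e / m with hβ
  set d := 4 * Real.pi * e ^ 2 / Tm with hd
  set κ := 4 * Real.pi * e * β with hκ
  have hc20 : 0 < c2 := by positivity
  have hβ0 : 0 < β := by positivity
  have hd0 : 0 < d := by positivity
  have hκ0 : 0 < κ := by positivity
  obtain ⟨C, hC, H⟩ := mode_energy_bound_complex hc20 hκ0.le hd0.le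
  refine ⟨C, hC, fun k ξ t hk ht => ?_⟩
  have hk1 : (1 : ℝ) ≤ (k : ℝ) ^ 2 := by
    have : (1 : ℤ) ≤ k ^ 2 := by
      have := sq_pos_of_ne_zero hk
      omega
    exact_mod_cast this
  obtain ⟨L, hL, H⟩ := H k ξ t hk1 ht
  -- a bound for the squared vertical frequency up to time `t`
  set Q := 2 * ξ ^ 2 + 2 * (k : ℝ) ^ 2 * t ^ 2 with hQ
  set B := 2 * c2 ^ 2 + 2 * β ^ 2 with hB
  set A := 1 + (2 * Q * B + 2 * β ^ 2 * (2 + 8 * Q)) + (2 + 2 * (k : ℝ) ^ 2 * B) with hA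
  have hQ0 : 0 ≤ Q := by positivity
  have hB0 : 0 ≤ B := by positivity
  have hA0 : 0 ≤ A := by positivity
  refine ⟨C * (L * A) + 2 * t * A, by positivity, fun η ux uy φ h w hw => ?_⟩
  have cN := continuous_movingHat hw h.smooth_η k ξ
  have cU := continuous_movingHat hw h.smooth_ux k ξ
  have cV := continuous_movingHat hw h.smooth_uy k ξ
  have cn := continuous_movingHat hw.deriv h.smooth_η k ξ
  have cv := continuous_movingHat hw.deriv h.smooth_uy k ξ
  have cp := continuous_movingHat hw.deriv h.smooth_φ k ξ
  have cpp := continuous_movingHat hw.deriv.deriv h.smooth_φ k ξ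
  have hp : ∀ s, 0 < shearSq k ξ s := fun s => shearSq_pos hk1
  have cpos : Continuous (shearSq k ξ) := by unfold shearSq; fun_prop
  set F3 : ℝ → ℂ := fun s => (c2 : ℂ) * movingHat (deriv w) η k ξ s
    + (β : ℂ) * movingHat (deriv w) φ k ξ s with hF3
  set ε4 : ℝ → ℂ := fun s => movingHat (deriv (deriv w)) φ k ξ s
    - 2 * Complex.I * ((ξ - k * s : ℝ) : ℂ) * movingHat (deriv w) φ k ξ s with hε4
  set g : ℝ → ℂ := fun s => Complex.I * ((ξ - k * s : ℝ) : ℂ) * F3 s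
    + ((β * (shearSq k ξ s / (shearSq k ξ s + d)) : ℝ) : ℂ) * ε4 s with hg
  set f : ℝ → ℂ := movingHat (deriv w) uy k ξ with hf
  set hh : ℝ → ℂ := fun s => f s + Complex.I * k * F3 s with hhh
  have cF3 : Continuous F3 := by fun_prop
  have cε4 : Continuous ε4 := by fun_prop
  have cg : Continuous g := by
    have : ∀ s, shearSq k ξ s + d ≠ 0 := fun s => by have := hp s; positivity
    have : Continuous fun s => β * (shearSq k ξ s / (shearSq k ξ s + d)) := by
      fun_prop (disch := assumption)
    fun_prop
  have ch : Continuous hh := by fun_prop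
  have cΨ : Continuous (movingDiv w ux uy k ξ) := by unfold movingDiv; fun_prop
  have cΓ : Continuous (movingSum w η ux uy k ξ) := by unfold movingSum; fun_prop
  have hq : ∀ s : ℝ, HasDerivAt (fun s : ℝ => ((ξ - k * s : ℝ) : ℂ)) (-(k : ℂ)) s := by
    intro s
    have h1 : HasDerivAt (fun s : ℝ => ξ - k * s) (-(k : ℝ)) s := by
      simpa using ((hasDerivAt_id s).const_mul (k : ℝ)).const_sub ξ
    simpa using h1.ofReal_comp
  have dΓ : ∀ s ∈ Ioo 0 t, HasDerivAt (movingSum w η ux uy k ξ) (hh s) s := by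
    intro s hs
    have d1 := h.hasDerivAt_density hw hs.1 k ξ
    have d2 := h.hasDerivAt_velocityX hw hs.1 k ξ
    have d3 := h.hasDerivAt_velocityY hw hs.1 k ξ
    refine (d1.add ((((hq s).const_mul Complex.I).neg.mul d2).add
      (d3.const_mul (Complex.I * k)))).congr_deriv ?_
    simp only [hhh, hf, hF3, Pi.neg_apply]
    ring
  have dΨ : ∀ s ∈ Ioo 0 t, HasDerivAt (movingDiv w ux uy k ξ)
      (((2 * shearRate k ξ s : ℝ) : ℂ) * movingDiv w ux uy k ξ s
          + (pressureCoeff c2 κ d k ξ s : ℂ) * movingHat w η k ξ s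
          - ((2 * (k ^ 2 / shearSq k ξ s) : ℝ) : ℂ) * movingSum w η ux uy k ξ s + g s) s := by
    intro s hs
    have d2 := h.hasDerivAt_velocityX hw hs.1 k ξ
    have d3 := h.hasDerivAt_velocityY hw hs.1 k ξ
    have hpo := h.poisson_weightedHat hw hs.1.le k (ξ - k * s)
    simp only [← movingHat_of_nonneg _ _ _ _ hs.1.le] at hpo
    rw [← hc2, ← hβ] at d2 d3
    refine ((d2.const_mul (Complex.I * k)).add
      (((hq s).const_mul Complex.I).mul d3)).congr_deriv ?_
    have hpd : ((shearSq k ξ s + d : ℝ) : ℂ) ≠ 0 := by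
      have := hp s
      exact_mod_cast (by positivity : shearSq k ξ s + d ≠ 0)
    have hpc : ((shearSq k ξ s : ℝ) : ℂ) ≠ 0 := by exact_mod_cast (hp s).ne'
    have hΦ : movingHat w φ k ξ s
        = ((4 * Real.pi * e : ℝ) * movingHat w η k ξ s + ε4 s) / ((shearSq k ξ s + d : ℝ) : ℂ) := by
      rw [eq_div_iff hpd, mul_comm]
      exact hpo
    rw [hΦ]
    simp only [hg, hF3, shearRate, pressureCoeff, soundSq, movingDiv, movingSum, hκ]
    have hpq : ((shearSq k ξ s : ℝ) : ℂ) = (k : ℂ) ^ 2 + ((ξ - k * s : ℝ) : ℂ) ^ 2 := by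
      unfold shearSq; push_cast; ring
    have hI : Complex.I ^ 2 = -1 := Complex.I_sq
    push_cast at hpd hpc hpq ⊢
    generalize ε4 s = E4 at *
    generalize ((shearSq k ξ s : ℝ) : ℂ) = p at *
    generalize movingHat w η k ξ s = N
    generalize movingHat w ux k ξ s = U
    generalize movingHat w uy k ξ s = V
    generalize movingHat (deriv w) η k ξ s = n
    generalize movingHat (deriv w) φ k ξ s = ph
    generalize (ξ : ℂ) - k * s = q at *
    generalize (d : ℂ) = D at *
    field_simp
    have hS : ∃ S : ℂ, S = D * c2 * N + 4 * Real.pi * e * β * N + β * E4 + p * c2 * N := ⟨_, rfl⟩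
    obtain ⟨S, hS⟩ := hS
    linear_combination (-p * (k ^ 2 + q ^ 2) * S) * hI
      + (-p * S - 2 * Complex.I * k * V * (p + D)) * hpq
      + (p * (k ^ 2 + q ^ 2) * (Complex.I ^ 2 + 1) + p * (p - (k ^ 2 + q ^ 2))) * hS
  have key := H _ _ _ _ _ _ cN cΨ cΓ cv cg ch
    (fun s hs => h.hasDerivAt_density hw hs.1 k ξ) dΨ dΓ
  -- the forcing is controlled by the localization error
  have hErr0 : ∀ s, 0 ≤ cutoffError w η uy φ k ξ s := fun s => cutoffError_nonneg _ _ _ _ _ _ _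
  have cv' : Continuous (movingHat (deriv w) uy k ξ) := cv
  have cErr : Continuous (cutoffError w η uy φ k ξ) := by unfold cutoffError; fun_prop
  have bF3 : ∀ s, ‖F3 s‖ ^ 2 ≤ B * cutoffError w η uy φ k ξ s := fun s =>
    velocityForcing_sq_le c2 β w η uy φ k ξ s
  have bq : ∀ s ∈ Icc 0 t, (ξ - k * s) ^ 2 ≤ Q := by
    intro s hs
    have h1 : s ^ 2 ≤ t ^ 2 := pow_le_pow_left₀ hs.1 hs.2 2
    have h2 := mul_le_mul_of_nonneg_left h1 (sq_nonneg (k : ℝ))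
    rw [hQ]
    nlinarith [sq_nonneg (ξ + k * s)]
  have bε4 : ∀ s ∈ Icc 0 t, ‖ε4 s‖ ^ 2 ≤ (2 + 8 * Q) * cutoffError w η uy φ k ξ s :=
    fun s hs => poissonForcing_sq_le w η uy φ k (bq s hs)
  have bf : ∀ s, ‖f s‖ ^ 2 ≤ cutoffError w η uy φ k ξ s := fun s =>
    (sq_norm_le_cutoffError w η uy φ k ξ s).1
  have bh : ∀ s, ‖hh s‖ ^ 2 ≤ (2 + 2 * (k : ℝ) ^ 2 * B) * cutoffError w η uy φ k ξ s := by
    intro s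
    refine (norm_add_sq_le _ _).trans ?_
    simp only [norm_mul, mul_pow, Complex.norm_I, one_mul, Complex.norm_intCast, sq_abs]
    have a0 := bf s
    have := mul_le_mul_of_nonneg_left (bF3 s) (sq_nonneg (k : ℝ))
    linarith
  have bg : ∀ s ∈ Icc 0 t, ‖g s‖ ^ 2
      ≤ (2 * Q * B + 2 * β ^ 2 * (2 + 8 * Q)) * cutoffError w η uy φ k ξ s := by
    intro s hs
    refine (norm_add_sq_le _ _).trans ?_
    simp only [norm_mul, mul_pow, Complex.norm_real, Real.norm_eq_abs, sq_abs, Complex.norm_I,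
      one_mul]
    have b1 : (shearSq k ξ s / (shearSq k ξ s + d)) ^ 2 ≤ 1 := by
      have := hp s
      refine pow_le_one₀ (by positivity) (div_le_one_of_le₀ (by linarith) (by positivity))
    have b2 : (ξ - k * s) ^ 2 * ‖F3 s‖ ^ 2 ≤ Q * (B * cutoffError w η uy φ k ξ s) :=
      mul_le_mul (bq s hs) (bF3 s) (sq_nonneg _) hQ0
    have b3 : (shearSq k ξ s / (shearSq k ξ s + d)) ^ 2 * ‖ε4 s‖ ^ 2
        ≤ 1 * ((2 + 8 * Q) * cutoffError w η uy φ k ξ s) :=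
      mul_le_mul b1 (bε4 s hs) (sq_nonneg _) zero_le_one
    have b4 := mul_le_mul_of_nonneg_left b3 (sq_nonneg β)
    linarith
  set E := ∫ s in (0 : ℝ)..t, cutoffError w η uy φ k ξ s with hE
  have hE0 : 0 ≤ E := intervalIntegral.integral_nonneg ht fun s _ => hErr0 s
  have hI1 : ∫ s in (0 : ℝ)..t, (‖f s‖ ^ 2 + ‖g s‖ ^ 2 + ‖hh s‖ ^ 2) ≤ A * E := by
    rw [hE, ← intervalIntegral.integral_const_mul]
    refine intervalIntegral.integral_mono_on ht (Continuous.intervalIntegrable (by fun_prop) _ _)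
      (Continuous.intervalIntegrable (by fun_prop) _ _) fun s hs => ?_
    have b1 := bg s hs
    have b2 := bh s
    have a0 := bf s
    rw [hA]
    linarith
  have hI2 : ∫ s in (0 : ℝ)..t, ‖hh s‖ ^ 2 ≤ A * E := by
    refine le_trans ?_ hI1
    refine intervalIntegral.integral_mono_on ht (Continuous.intervalIntegrable (by fun_prop) _ _)
      (Continuous.intervalIntegrable (by fun_prop) _ _) fun s hs => ?_
    linarith [sq_nonneg ‖f s‖, sq_nonneg ‖g s‖]
  constructor
  · refine key.trans ?_
    have b1 := mul_le_mul_of_nonneg_left (mul_le_mul_of_nonneg_left hI1 hL) hC.le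
    have b2 : 0 ≤ 2 * t * A * E := by positivity
    linarith
  · have b0 := norm_sq_le_of_hasDerivAt ht cΓ ch dΓ
    have b1 := mul_le_mul_of_nonneg_left hI2 (show 0 ≤ 2 * t by positivity)
    have b2 : 0 ≤ C * (L * A) * E := by positivity
    linarith

theorem zero_mode_rate_le {a c2 β d ξ B R Λ A : ℝ} {N U V Φ F1 F3 E4 : ℂ} (hd : 0 < d)
    (hB : B ≤ 2 * c2 ^ 2 + 2 * β ^ 2) (bf : ‖F1‖ ^ 2 ≤ R) (bF3 : ‖F3‖ ^ 2 ≤ B * R)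
    (bε : ‖E4‖ ^ 2 ≤ (2 + 8 * ξ ^ 2) * R)
    (hpo : ((ξ : ℂ) ^ 2 + d) * Φ = a * N + E4)
    (hΛ : 2 + 2 * ξ ^ 2 + 4 * ξ ^ 2 * c2 ^ 2 + 8 * ξ ^ 2 * β ^ 2 * a ^ 2 / d ^ 2 ≤ Λ)
    (hA : 2 + 2 * (2 * c2 ^ 2 + 2 * β ^ 2) + 8 * ξ ^ 2 * β ^ 2 * (2 + 8 * ξ ^ 2) / d ^ 2 ≤ A) :
    ‖N‖ ^ 2 + ‖-(Complex.I * ((0 : ℤ) : ℂ) * U + Complex.I * (ξ : ℂ) * V) + F1‖ ^ 2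
      + (‖U‖ ^ 2 + ‖-V - Complex.I * ((0 : ℤ) : ℂ) * (c2 * N + β * Φ)‖ ^ 2)
      + (‖V‖ ^ 2 + ‖-(Complex.I * (ξ : ℂ)) * (c2 * N + β * Φ) + F3‖ ^ 2)
    ≤ Λ * (‖N‖ ^ 2 + ‖U‖ ^ 2 + ‖V‖ ^ 2) + A * R := by
  have hR : 0 ≤ R := (sq_nonneg _).trans bf
  -- bound for the potential
  have bΦ : ‖Φ‖ ^ 2 ≤ (2 * a ^ 2 * ‖N‖ ^ 2 + 2 * ((2 + 8 * ξ ^ 2) * R)) / d ^ 2 := by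
    rw [le_div_iff₀ (by positivity)]
    have h1 := congrArg (fun z : ℂ => ‖z‖ ^ 2) hpo
    have h0 : ‖(ξ : ℂ) ^ 2 + d‖ = |ξ ^ 2 + d| := by
      rw [← Real.norm_eq_abs, ← Complex.norm_real]; push_cast; rfl
    simp only [norm_mul, mul_pow, h0, sq_abs] at h1
    have h2 := norm_add_sq_le ((a : ℂ) * N) E4
    rw [← h1] at h2
    simp only [norm_mul, mul_pow, Complex.norm_real, Real.norm_eq_abs, sq_abs] at h2
    have h3 : d ^ 2 ≤ (ξ ^ 2 + d) ^ 2 :=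
      pow_le_pow_left₀ hd.le (by linarith [sq_nonneg ξ]) 2
    have h4 := mul_le_mul_of_nonneg_right h3 (sq_nonneg ‖Φ‖)
    linarith
  have n1 : ‖-(Complex.I * ((0 : ℤ) : ℂ) * U + Complex.I * (ξ : ℂ) * V) + F1‖ ^ 2
      ≤ 2 * (ξ ^ 2 * ‖V‖ ^ 2) + 2 * R := by
    refine (norm_add_sq_le _ _).trans ?_
    simp only [Int.cast_zero, mul_zero, zero_mul, zero_add, norm_neg, norm_mul, Complex.norm_I,
      one_mul, Complex.norm_real, mul_pow, Real.norm_eq_abs, sq_abs]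
    linarith
  have n2 : ‖-V - Complex.I * ((0 : ℤ) : ℂ) * (c2 * N + β * Φ)‖ ^ 2 = ‖V‖ ^ 2 := by simp
  have n3 : ‖-(Complex.I * (ξ : ℂ)) * (c2 * N + β * Φ) + F3‖ ^ 2
      ≤ 2 * (ξ ^ 2 * (2 * (c2 ^ 2 * ‖N‖ ^ 2) + 2 * (β ^ 2 * ‖Φ‖ ^ 2))) + 2 * (B * R) := by
    refine (norm_add_sq_le _ _).trans ?_
    have h2 := norm_add_sq_le ((c2 : ℂ) * N) ((β : ℂ) * Φ)
    simp only [norm_mul, mul_pow, Complex.norm_real, Real.norm_eq_abs, sq_abs] at h2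
    simp only [norm_neg, norm_mul, Complex.norm_I,
      one_mul, Complex.norm_real, mul_pow, Real.norm_eq_abs, sq_abs]
    have h3 := mul_le_mul_of_nonneg_left h2 (sq_nonneg ξ)
    linarith
  rw [n2]
  have h5 := mul_le_mul_of_nonneg_left bΦ (show 0 ≤ 4 * ξ ^ 2 * β ^ 2 by positivity)
  have h6 : 4 * ξ ^ 2 * β ^ 2 * ((2 * a ^ 2 * ‖N‖ ^ 2 + 2 * ((2 + 8 * ξ ^ 2) * R)) / d ^ 2)
      = (8 * ξ ^ 2 * β ^ 2 * a ^ 2 / d ^ 2) * ‖N‖ ^ 2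
        + (8 * ξ ^ 2 * β ^ 2 * (2 + 8 * ξ ^ 2) / d ^ 2) * R := by ring
  rw [h6] at h5
  have m1 : 0 ≤ ‖N‖ ^ 2 := sq_nonneg _
  have m2 : 0 ≤ ‖U‖ ^ 2 := sq_nonneg _
  have m3 : 0 ≤ ‖V‖ ^ 2 := sq_nonneg _
  have x1 : 0 ≤ 2 * ξ ^ 2 := by positivity
  have x2 : 0 ≤ 4 * ξ ^ 2 * c2 ^ 2 := by positivity
  have x3 : 0 ≤ 8 * ξ ^ 2 * β ^ 2 * a ^ 2 / d ^ 2 := by positivity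
  have k1 := mul_le_mul_of_nonneg_right hA hR
  have k2 := mul_le_mul_of_nonneg_right hB hR
  have k3 : (1 + 4 * ξ ^ 2 * c2 ^ 2 + 8 * ξ ^ 2 * β ^ 2 * a ^ 2 / d ^ 2) * ‖N‖ ^ 2
      ≤ Λ * ‖N‖ ^ 2 := mul_le_mul_of_nonneg_right (by linarith) m1
  have k4 : 1 * ‖U‖ ^ 2 ≤ Λ * ‖U‖ ^ 2 := mul_le_mul_of_nonneg_right (by linarith) m2
  have k5 : (2 + 2 * ξ ^ 2) * ‖V‖ ^ 2 ≤ Λ * ‖V‖ ^ 2 :=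
    mul_le_mul_of_nonneg_right (by linarith) m3
  linarith

/-- Localized modes with `k = 0`: a crude estimate, not uniform in time. -/
theorem localized_zero_mode_bound {e m Tp Tm : ℝ} (he : 0 < e) (hTm : 0 < Tm) (ξ : ℝ) {t : ℝ}
    (ht : 0 ≤ t) :
    ∃ L : ℝ, 0 ≤ L ∧
      ∀ η ux uy φ : ℝ → ℝ → ℝ → ℝ, IsSmoothSolution e m Tp Tm η ux uy φ →
      ∀ w : ℝ → ℝ, IsWeight w →
        ‖movingHat w η 0 ξ t‖ ^ 2 + ‖movingHat w ux 0 ξ t‖ ^ 2 + ‖movingHat w uy 0 ξ t‖ ^ 2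
          ≤ L * (‖movingHat w η 0 ξ 0‖ ^ 2 + ‖movingHat w ux 0 ξ 0‖ ^ 2
              + ‖movingHat w uy 0 ξ 0‖ ^ 2
            + ∫ s in (0 : ℝ)..t, cutoffError w η uy φ 0 ξ s) := by
  have hpi := Real.pi_pos
  set c2 := Tp / m with hc2
  set β := e / m with hβ
  set d := 4 * Real.pi * e ^ 2 / Tm with hd
  set a := 4 * Real.pi * e with ha
  have hd0 : 0 < d := by positivity
  set B := 2 * c2 ^ 2 + 2 * β ^ 2 with hB
  -- growth rate, and size of the forcing
  set Λ := 2 + 2 * ξ ^ 2 + 4 * ξ ^ 2 * c2 ^ 2 + 8 * ξ ^ 2 * β ^ 2 * a ^ 2 / d ^ 2 with hΛ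
  set A := 2 + 2 * B + 8 * ξ ^ 2 * β ^ 2 * (2 + 8 * ξ ^ 2) / d ^ 2 with hA
  have hΛ0 : 0 ≤ Λ := by positivity
  have hA0 : 0 ≤ A := by positivity
  refine ⟨Real.exp (2 * (Λ * t)) * (1 + A), by positivity, fun η ux uy φ h w hw => ?_⟩
  have cN := continuous_movingHat hw h.smooth_η 0 ξ
  have cU := continuous_movingHat hw h.smooth_ux 0 ξ
  have cV := continuous_movingHat hw h.smooth_uy 0 ξ
  have cn := continuous_movingHat hw.deriv h.smooth_η 0 ξ
  have cv := continuous_movingHat hw.deriv h.smooth_uy 0 ξ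
  have cp := continuous_movingHat hw.deriv h.smooth_φ 0 ξ
  have cpp := continuous_movingHat hw.deriv.deriv h.smooth_φ 0 ξ
  have cErr : Continuous (cutoffError w η uy φ 0 ξ) := by unfold cutoffError; fun_prop
  have hErr0 : ∀ s, 0 ≤ cutoffError w η uy φ 0 ξ s := fun s => cutoffError_nonneg _ _ _ _ _ _ _
  have two_inner : ∀ z z' : ℂ, 2 * inner ℝ z z' ≤ ‖z‖ ^ 2 + ‖z'‖ ^ 2 := by
    intro z z'
    have h1 := real_inner_le_norm z z'
    nlinarith [sq_nonneg (‖z‖ - ‖z'‖)]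
  have key := gronwall_bounded_exponent ht (A := Λ * t)
    (H := fun s => ‖movingHat w η 0 ξ s‖ ^ 2 + ‖movingHat w ux 0 ξ s‖ ^ 2
      + ‖movingHat w uy 0 ξ s‖ ^ 2) (a := fun s => Λ * s) (a' := fun _ => Λ)
    (F := fun s => A * cutoffError w η uy φ 0 ξ s) (by fun_prop) (by fun_prop) (by fun_prop)
    (fun s hs => ((h.hasDerivAt_density hw hs.1 0 ξ).norm_sq.add
      (h.hasDerivAt_velocityX hw hs.1 0 ξ).norm_sq).add
      (h.hasDerivAt_velocityY hw hs.1 0 ξ).norm_sq)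
    (fun s _ => by simpa using (hasDerivAt_id s).const_mul Λ)
    (fun s hs => by
      rw [abs_of_nonneg (mul_nonneg hΛ0 hs.1)]
      exact mul_le_mul_of_nonneg_left hs.2 hΛ0)
    (fun s => mul_nonneg hA0 (hErr0 s))
    (by
      intro s hs
      have hpo := h.poisson_weightedHat hw hs.1.le 0 (ξ - (0 : ℤ) * s)
      simp only [← movingHat_of_nonneg _ _ _ _ hs.1.le] at hpo
      have bF3 := velocityForcing_sq_le c2 β w η uy φ 0 ξ s
      have hq : ξ - ((0 : ℤ) : ℝ) * s = ξ := by simp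
      have bε := poissonForcing_sq_le (Q := ξ ^ 2) w η uy φ 0 (ξ := ξ) (s := s)
        (by rw [hq])
      have bf := (sq_norm_le_cutoffError w η uy φ 0 ξ s).1
      rw [← hc2, ← hβ]
      have i1 := two_inner (movingHat w η 0 ξ s) (-(Complex.I * ((0 : ℤ) : ℂ) * movingHat w ux 0 ξ s
          + Complex.I * ((ξ - ((0 : ℤ) : ℝ) * s : ℝ) : ℂ) * movingHat w uy 0 ξ s)
        + movingHat (deriv w) uy 0 ξ s)
      have i2 := two_inner (movingHat w ux 0 ξ s) (-movingHat w uy 0 ξ s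
        - Complex.I * ((0 : ℤ) : ℂ) * (c2 * movingHat w η 0 ξ s + β * movingHat w φ 0 ξ s))
      have i3 := two_inner (movingHat w uy 0 ξ s)
        (-(Complex.I * ((ξ - ((0 : ℤ) : ℝ) * s : ℝ) : ℂ)) * (c2 * movingHat w η 0 ξ s
        + β * movingHat w φ 0 ξ s)
        + (c2 * movingHat (deriv w) η 0 ξ s + β * movingHat (deriv w) φ 0 ξ s))
      refine (add_le_add (add_le_add i1 i2) i3).trans ?_
      rw [hq] at bε hpo ⊢
      generalize movingHat (deriv (deriv w)) φ 0 ξ s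
        - 2 * Complex.I * (ξ : ℂ) * movingHat (deriv w) φ 0 ξ s = E4 at bε hpo
      generalize (c2 * movingHat (deriv w) η 0 ξ s + β * movingHat (deriv w) φ 0 ξ s : ℂ) = F3
        at bF3 ⊢
      generalize movingHat (deriv w) uy 0 ξ s = F1 at bf ⊢
      generalize cutoffError w η uy φ 0 ξ s = R at bf bF3 bε ⊢
      generalize movingHat w η 0 ξ s = N at hpo ⊢
      generalize movingHat w ux 0 ξ s = U
      generalize movingHat w uy 0 ξ s = V
      generalize movingHat w φ 0 ξ s = Φ at hpo ⊢
      rw [← hd, ← ha] at hpo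
      refine zero_mode_rate_le hd0 hB.le bf bF3 bε ?_ hΛ.ge hA.ge
      simpa using hpo)
    (by positivity)
  rw [intervalIntegral.integral_const_mul] at key
  refine key.trans ?_
  have hE0 : 0 ≤ ∫ s in (0 : ℝ)..t, cutoffError w η uy φ 0 ξ s :=
    intervalIntegral.integral_nonneg ht fun s _ => hErr0 s
  rw [mul_assoc]
  refine mul_le_mul_of_nonneg_left ?_ (Real.exp_pos _).le
  have m1 : 0 ≤ ‖movingHat w η 0 ξ 0‖ ^ 2 + ‖movingHat w ux 0 ξ 0‖ ^ 2
              + ‖movingHat w uy 0 ξ 0‖ ^ 2 := by positivity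
  nlinarith [mul_nonneg hA0 m1]

/-! ### Cutoffs in `y` and their removal -/

/-- The bump function that is `1` on `[-1, 1]` and `0` outside `[-2, 2]`. -/
noncomputable def baseBump : ContDiffBump (0 : ℝ) := ⟨1, 2, one_pos, one_lt_two⟩

/-- The cutoff in `y` at scale `n + 1`. -/
noncomputable def cutoff (n : ℕ) (y : ℝ) : ℝ := baseBump (y / (n + 1))

theorem isWeight_cutoff (n : ℕ) : IsWeight (cutoff n) where
  contDiff := by
    unfold cutoff
    exact baseBump.contDiff.comp (by fun_prop)
  compact := by
    have hn : ((n : ℝ) + 1)⁻¹ ≠ 0 := by positivity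
    have h := baseBump.hasCompactSupport.comp_homeomorph (Homeomorph.mulRight₀ _ hn)
    exact h

theorem cutoff_mem (n : ℕ) (y : ℝ) : cutoff n y ∈ Icc (0 : ℝ) 1 :=
  ⟨baseBump.nonneg, baseBump.le_one⟩

theorem eventually_cutoff_eq_one (y : ℝ) : ∀ᶠ n : ℕ in Filter.atTop, cutoff n y = 1 := by
  obtain ⟨N, hN⟩ := exists_nat_ge |y|
  filter_upwards [Filter.eventually_ge_atTop N] with n hn
  apply baseBump.one_of_mem_closedBall
  rw [mem_closedBall_zero_iff, Real.norm_eq_abs, abs_div]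
  have h1 : (0 : ℝ) < n + 1 := by positivity
  rw [abs_of_pos h1]
  have h2 : (N : ℝ) ≤ n := by exact_mod_cast hn
  exact div_le_one_of_le₀ (by linarith) h1.le

theorem deriv_cutoff (n : ℕ) : deriv (cutoff n) = fun y => deriv baseBump (y / (n + 1)) / (n + 1) := by
  funext y
  have hw : IsWeight baseBump := ⟨baseBump.contDiff, baseBump.hasCompactSupport⟩
  have hdiv : HasDerivAt (fun y : ℝ => y / ((n : ℝ) + 1)) (1 / ((n : ℝ) + 1)) y :=
    (hasDerivAt_id y).div_const _
  have h : HasDerivAt (cutoff n) _ y := (hw.hasDerivAt (y / (n + 1))).comp y hdiv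
  rw [h.deriv]; ring

theorem deriv_deriv_cutoff (n : ℕ) :
    deriv (deriv (cutoff n)) = fun y => deriv (deriv baseBump) (y / (n + 1)) / (n + 1) / (n + 1) := by
  funext y
  rw [deriv_cutoff, deriv_div_const]
  congr 1
  have hw : IsWeight baseBump := ⟨baseBump.contDiff, baseBump.hasCompactSupport⟩
  have hdiv : HasDerivAt (fun y : ℝ => y / ((n : ℝ) + 1)) (1 / ((n : ℝ) + 1)) y :=
    (hasDerivAt_id y).div_const _
  have h : HasDerivAt (deriv baseBump ∘ fun y : ℝ => y / ((n : ℝ) + 1)) _ y :=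
    HasDerivAt.comp y (hw.deriv.hasDerivAt (y / (n + 1))) hdiv
  exact h.deriv.trans (by ring)

theorem exists_cutoff_bound : ∃ B : ℝ, 0 ≤ B ∧ ∀ (n : ℕ) (y : ℝ),
    |deriv (cutoff n) y| ≤ B / (n + 1) ∧ |deriv (deriv (cutoff n)) y| ≤ B / (n + 1) := by
  have hw : IsWeight baseBump := ⟨baseBump.contDiff, baseBump.hasCompactSupport⟩
  obtain ⟨B1, h1⟩ := hw.deriv.compact.exists_bound_of_continuous hw.deriv.continuous
  obtain ⟨B2, h2⟩ := hw.deriv.deriv.compact.exists_bound_of_continuous hw.deriv.deriv.continuous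
  have p1 : 0 ≤ B1 := (norm_nonneg _).trans (h1 0)
  have p2 : 0 ≤ B2 := (norm_nonneg _).trans (h2 0)
  refine ⟨B1 + B2, by positivity, fun n y => ⟨?_, ?_⟩⟩
  · rw [deriv_cutoff, abs_div, abs_of_pos (show (0 : ℝ) < n + 1 by positivity)]
    have := h1 (y / (n + 1))
    rw [Real.norm_eq_abs] at this
    gcongr
    linarith
  · rw [deriv_deriv_cutoff, abs_div, abs_div, abs_of_pos (show (0 : ℝ) < n + 1 by positivity)]
    have := h2 (y / (n + 1))
    rw [Real.norm_eq_abs] at this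
    rw [div_div]
    have hn : (1 : ℝ) ≤ n + 1 := by
      have : (0 : ℝ) ≤ n := by positivity
      linarith
    have h3 : (n : ℝ) + 1 ≤ (n + 1) * (n + 1) := by nlinarith
    calc _ ≤ (B1 + B2) / ((n + 1) * (n + 1)) := by gcongr; linarith
      _ ≤ _ := by gcongr

open Filter Topology

theorem IsCylSmooth.smoothOnCylinder {G : ℝ → ℝ → ℝ} (hG : IsCylSmooth G) :
    SmoothOnCylinder fun _ => G := by
  refine ⟨ContDiff.contDiffOn ?_, fun _ x y _ => hG.periodic x y⟩
  exact hG.contDiff.comp (f := fun p : ℝ × ℝ × ℝ => p.2) contDiff_snd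

theorem continuous_weightedHat_freq {w : ℝ → ℝ} (hw : IsWeight w) {G : ℝ → ℝ → ℝ}
    (hG : IsCylSmooth G) (k : ℤ) : Continuous (weightedHat w G k) := by
  have h := Continuous.comp (f := fun ξ : ℝ => ((0 : ℝ), ξ))
    (continuous_weightedHat hw hG.smoothOnCylinder k) (by fun_prop)
  simpa [Function.comp_def] using h

section removal

variable {G : ℝ → ℝ → ℝ} {k : ℤ}

theorem lintegral_sq_lt_top {g : ℝ → ℂ} (h : MemLp g 2 (volume : Measure ℝ)) :
    ∫⁻ y, ‖g y‖ₑ ^ 2 < ⊤ := by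
  have := (eLpNorm_lt_top_iff_lintegral_rpow_enorm_lt_top (by norm_num) (by norm_num)).1 h.2
  simpa using this

/-- Removing the cutoff, in `L²` of the frequency. -/
theorem tendsto_lintegral_cutoff (hG : Continuous fun p : ℝ × ℝ => G p.1 p.2)
    (h : MemLp (xMode G k) 2 (volume : Measure ℝ)) :
    Tendsto (fun n => ∫⁻ ξ, ‖fourierHat G k ξ - weightedHat (cutoff n) G k ξ‖ₑ ^ 2) atTop
      (𝓝 0) := by
  simp_rw [fun n => lintegral_fourierHat_sub_weightedHat (isWeight_cutoff n) hG h]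
  have hx := continuous_xMode hG k
  have h0 : Tendsto (fun n : ℕ => ∫⁻ y, ‖(1 - cutoff n y : ℂ) * xMode G k y‖ₑ ^ 2) atTop
      (𝓝 (∫⁻ _ : ℝ, 0)) := by
    refine tendsto_lintegral_of_dominated_convergence (fun y => ‖xMode G k y‖ₑ ^ 2) ?_ ?_
      (lintegral_sq_lt_top h).ne ?_
    · intro n
      have hc := (isWeight_cutoff n).continuous
      have : Continuous fun y => (1 - cutoff n y : ℂ) * xMode G k y := by fun_prop
      exact this.enorm.measurable.pow_const 2
    · intro n
      refine Eventually.of_forall fun y => ?_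
      obtain ⟨h1, h2⟩ := cutoff_mem n y
      have h3 : ‖(1 - cutoff n y : ℂ)‖ₑ ≤ 1 := by
        rw [← ofReal_norm]
        refine ENNReal.ofReal_le_one.2 ?_
        rw [← Complex.ofReal_one, ← Complex.ofReal_sub, Complex.norm_real, Real.norm_eq_abs,
          abs_le]
        constructor <;> linarith
      change ‖(1 - cutoff n y : ℂ) * xMode G k y‖ₑ ^ 2 ≤ ‖xMode G k y‖ₑ ^ 2
      rw [enorm_mul]
      gcongr
      exact mul_le_of_le_one_left (zero_le) h3
    · refine Eventually.of_forall fun y => ?_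
      refine tendsto_const_nhds.congr' ?_
      filter_upwards [eventually_cutoff_eq_one y] with n hn
      simp [hn]
  rw [lintegral_zero] at h0
  have := ENNReal.Tendsto.const_mul (a := ENNReal.ofReal (2 * Real.pi)⁻¹) h0
    (Or.inr ENNReal.ofReal_ne_top)
  simpa using this

/-- A weight bounded by `b` costs a factor `b` in `L²` of the frequency. -/
theorem lintegral_weightedHat_le {w : ℝ → ℝ} (hw : IsWeight w) {b : ℝ} (hb : ∀ y, |w y| ≤ b)
    (hG : Continuous fun p : ℝ × ℝ => G p.1 p.2) (k : ℤ) :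
    ∫⁻ ξ, ‖weightedHat w G k ξ‖ₑ ^ 2 ≤ ENNReal.ofReal b ^ 2 *
      (ENNReal.ofReal (2 * Real.pi)⁻¹ * ∫⁻ y, ‖xMode G k y‖ₑ ^ 2) := by
  rw [lintegral_weightedHat hw hG k]
  rw [mul_left_comm]
  refine mul_le_mul_right ?_ _
  rw [← lintegral_const_mul _ ((continuous_xMode hG k).enorm.measurable.pow_const 2)]
  refine lintegral_mono fun y => ?_
  rw [enorm_mul, mul_pow]
  gcongr
  rw [← ofReal_norm, Complex.norm_real]
  exact ENNReal.ofReal_le_ofReal (hb y)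

theorem tendsto_cutoff_const (B : ℝ) (M : ℝ≥0∞) (hM : M ≠ ⊤) :
    Tendsto (fun n : ℕ => ENNReal.ofReal (B / (n + 1)) ^ 2 * M) atTop (𝓝 0) := by
  have h1 : Tendsto (fun n : ℕ => ENNReal.ofReal (B / (n + 1))) atTop (𝓝 0) := by
    rw [← ENNReal.ofReal_zero]
    refine (ENNReal.continuous_ofReal.tendsto 0).comp ?_
    have h := tendsto_one_div_add_atTop_nhds_zero_nat (𝕜 := ℝ)
    have := h.const_mul B
    simpa [div_eq_mul_inv] using this
  have h2 := (ENNReal.Tendsto.pow (n := 2) h1)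
  have h3 := ENNReal.Tendsto.mul_const (b := M) h2 (Or.inr hM)
  simpa using h3

end removal

/-- Functions converging to `0` in `L¹` converge pointwise almost everywhere along some sequence of
indices, which may depend on the point. -/
theorem ae_exists_seq_tendsto_zero {f : ℕ → ℝ → ℝ≥0∞} (hm : ∀ n, Measurable (f n))
    (hf : Tendsto (fun n => ∫⁻ ξ, f n ξ) atTop (𝓝 0)) :
    ∀ᵐ ξ, ∃ u : ℕ → ℕ, Tendsto (fun j => f (u j) ξ) atTop (𝓝 0) := by
  have h1 : ∫⁻ ξ, liminf (fun n => f n ξ) atTop = 0 := by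
    refine le_antisymm ((lintegral_liminf_le hm).trans ?_) (zero_le)
    rw [hf.liminf_eq]
  rw [lintegral_eq_zero_iff (Measurable.liminf hm)] at h1
  filter_upwards [h1] with ξ hξ
  have h2 : ∀ j : ℕ, ∃ n, f n ξ < ((j : ℝ≥0∞) + 1)⁻¹ := by
    intro j
    have h3 : liminf (fun n => f n ξ) atTop < ((j : ℝ≥0∞) + 1)⁻¹ := by
      rw [hξ]
      simp
    exact (frequently_lt_of_liminf_lt (by isBoundedDefault) h3).exists
  choose u hu using h2
  refine ⟨u, ?_⟩
  refine tendsto_of_tendsto_of_tendsto_of_le_of_le tendsto_const_nhds ?_ (fun j => zero_le)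
    (fun j => (hu j).le)
  have h4 := ENNReal.tendsto_inv_nat_nhds_zero.comp (tendsto_add_atTop_nat 1)
  simpa [Function.comp_def] using h4

theorem tendsto_zero_of_enorm_sq {z : ℕ → ℂ} {f : ℕ → ℝ≥0∞} (hf : Tendsto f atTop (𝓝 0))
    (h : ∀ j, ‖z j‖ₑ ^ 2 ≤ f j) : Tendsto z atTop (𝓝 0) := by
  rw [tendsto_zero_iff_norm_tendsto_zero]
  have h1 : Tendsto (fun j => ‖z j‖ₑ ^ 2) atTop (𝓝 0) :=
    tendsto_of_tendsto_of_tendsto_of_le_of_le tendsto_const_nhds hf (fun j => zero_le) h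
  have h2 : Tendsto (fun j => ‖z j‖ ^ 2) atTop (𝓝 0) := by
    have := (ENNReal.tendsto_toReal ENNReal.zero_ne_top).comp h1
    simpa [Function.comp_def] using this
  have h3 := h2.sqrt
  simpa [Real.sqrt_sq (norm_nonneg _)] using h3

/-- For almost every frequency there is a sequence of cutoffs along which the localized transforms
of finitely many functions, at prescribed shifts of the frequency, converge to the Fourier
transforms, the terms with a differentiated cutoff tend to `0`, and so does a given sequence of
remainders. -/
theorem ae_exists_cutoff_seq {ι : Type*} [Fintype ι] (k : ℤ) (G : ι → ℝ → ℝ → ℝ)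
    (hG : ∀ i, IsCylSmooth (G i)) (hL : ∀ i, MemLp (xMode (G i) k) 2 volume)
    (a : ι → ℝ) (R : ℕ → ℝ → ℝ≥0∞) (hRm : ∀ n, Measurable (R n))
    (hR : Tendsto (fun n => ∫⁻ ξ, R n ξ) atTop (𝓝 0)) :
    ∀ᵐ ξ : ℝ, ∃ u : ℕ → ℕ,
      (∀ i, Tendsto (fun j => weightedHat (cutoff (u j)) (G i) k (ξ - a i)) atTop
          (𝓝 (fourierHat (G i) k (ξ - a i)))) ∧
      (∀ i,
        Tendsto (fun j => weightedHat (deriv (cutoff (u j))) (G i) k (ξ - a i)) atTop (𝓝 0) ∧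
        Tendsto (fun j => weightedHat (deriv (deriv (cutoff (u j)))) (G i) k (ξ - a i)) atTop
          (𝓝 0)) ∧
      Tendsto (fun j => R (u j) ξ) atTop (𝓝 0) := by
  classical
  obtain ⟨B, hB0, hB⟩ := exists_cutoff_bound
  set T1 : ι → ℕ → ℝ → ℝ≥0∞ := fun i n ξ =>
    ‖fourierHat (G i) k ξ - weightedHat (cutoff n) (G i) k ξ‖ₑ ^ 2 with hT1
  set T2 : ι → ℕ → ℝ → ℝ≥0∞ := fun i n ξ =>
    ‖weightedHat (deriv (cutoff n)) (G i) k ξ‖ₑ ^ 2 with hT2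
  set T3 : ι → ℕ → ℝ → ℝ≥0∞ := fun i n ξ =>
    ‖weightedHat (deriv (deriv (cutoff n))) (G i) k ξ‖ₑ ^ 2 with hT3
  have mhat : ∀ i (w : ℝ → ℝ), IsWeight w → Measurable (weightedHat w (G i) k) := fun i w hw =>
    (continuous_weightedHat_freq hw (hG i) k).measurable
  have m1 : ∀ i n, Measurable (T1 i n) := fun i n =>
    ((measurable_fourierHat (G i) k).sub (mhat i _ (isWeight_cutoff n))).enorm.pow_const 2
  have m2 : ∀ i n, Measurable (T2 i n) := fun i n =>
    (mhat i _ (isWeight_cutoff n).deriv).enorm.pow_const 2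
  have m3 : ∀ i n, Measurable (T3 i n) := fun i n =>
    (mhat i _ (isWeight_cutoff n).deriv.deriv).enorm.pow_const 2
  have l1 : ∀ i, Tendsto (fun n => ∫⁻ ξ, T1 i n ξ) atTop (𝓝 0) := fun i =>
    tendsto_lintegral_cutoff (hG i).continuous (hL i)
  have hfin : ∀ i, ENNReal.ofReal (2 * Real.pi)⁻¹ * ∫⁻ y, ‖xMode (G i) k y‖ₑ ^ 2 ≠ ⊤ := fun i =>
    ENNReal.mul_ne_top ENNReal.ofReal_ne_top (lintegral_sq_lt_top (hL i)).ne
  have l2 : ∀ i, Tendsto (fun n => ∫⁻ ξ, T2 i n ξ) atTop (𝓝 0) := fun i =>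
    tendsto_of_tendsto_of_tendsto_of_le_of_le tendsto_const_nhds
      (tendsto_cutoff_const B _ (hfin i)) (fun n => zero_le) fun n =>
      lintegral_weightedHat_le (isWeight_cutoff n).deriv (fun y => (hB n y).1)
        (hG i).continuous k
  have l3 : ∀ i, Tendsto (fun n => ∫⁻ ξ, T3 i n ξ) atTop (𝓝 0) := fun i =>
    tendsto_of_tendsto_of_tendsto_of_le_of_le tendsto_const_nhds
      (tendsto_cutoff_const B _ (hfin i)) (fun n => zero_le) fun n =>
      lintegral_weightedHat_le (isWeight_cutoff n).deriv.deriv (fun y => (hB n y).2)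
        (hG i).continuous k
  set f : ℕ → ℝ → ℝ≥0∞ := fun n ξ =>
    (∑ i, (T1 i n (ξ - a i) + T2 i n (ξ - a i) + T3 i n (ξ - a i))) + R n ξ with hf
  have msub : ∀ i, Measurable fun ξ : ℝ => ξ - a i := fun i => measurable_id.sub_const _
  have mi : ∀ i n, Measurable fun ξ =>
      T1 i n (ξ - a i) + T2 i n (ξ - a i) + T3 i n (ξ - a i) := fun i n =>
    (((m1 i n).comp (msub i)).add ((m2 i n).comp (msub i))).add ((m3 i n).comp (msub i))
  have hfm : ∀ n, Measurable (f n) := fun n =>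
    (Finset.measurable_sum _ fun i _ => mi i n).add (hRm n)
  have hint : ∀ n, ∫⁻ ξ, f n ξ
      = (∑ i, ((∫⁻ ξ, T1 i n ξ) + (∫⁻ ξ, T2 i n ξ) + (∫⁻ ξ, T3 i n ξ))) + ∫⁻ ξ, R n ξ := by
    intro n
    simp only [hf]
    rw [lintegral_add_right _ (hRm n), lintegral_finsetSum _ fun i _ => mi i n]
    congr 1
    refine Finset.sum_congr rfl fun i _ => ?_
    have n2 : Measurable fun ξ => T2 i n (ξ - a i) := (m2 i n).comp (msub i)
    have n3 : Measurable fun ξ => T3 i n (ξ - a i) := (m3 i n).comp (msub i)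
    rw [lintegral_add_right _ n3, lintegral_add_right _ n2, lintegral_sub_right_eq_self (T1 i n),
      lintegral_sub_right_eq_self (T2 i n), lintegral_sub_right_eq_self (T3 i n)]
  have hlim : Tendsto (fun n => ∫⁻ ξ, f n ξ) atTop (𝓝 0) := by
    simp_rw [hint]
    have := (tendsto_finsetSum Finset.univ fun i _ => ((l1 i).add (l2 i)).add (l3 i)).add hR
    simpa using this
  filter_upwards [ae_exists_seq_tendsto_zero hfm hlim] with ξ ⟨u, hu⟩
  have hle : ∀ i j, T1 i (u j) (ξ - a i) + T2 i (u j) (ξ - a i) + T3 i (u j) (ξ - a i)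
      ≤ f (u j) ξ := fun i j =>
    (Finset.single_le_sum (f := fun i => T1 i (u j) (ξ - a i) + T2 i (u j) (ξ - a i)
      + T3 i (u j) (ξ - a i)) (fun _ _ => zero_le) (Finset.mem_univ i)).trans le_self_add
  refine ⟨u, fun i => ?_, fun i => ⟨?_, ?_⟩, ?_⟩
  · have h := tendsto_zero_of_enorm_sq hu fun j =>
      (le_self_add.trans le_self_add).trans (hle i j)
    have h2 := h.const_sub (fourierHat (G i) k (ξ - a i))
    simpa using h2
  · refine tendsto_zero_of_enorm_sq hu fun j => ?_
    exact (le_add_self.trans le_self_add).trans (hle i j)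
  · refine tendsto_zero_of_enorm_sq hu fun j => ?_
    exact le_add_self.trans (hle i j)
  · exact tendsto_of_tendsto_of_tendsto_of_le_of_le tendsto_const_nhds hu (fun j => zero_le)
      fun j => le_add_self

end EulerPoisson

/-! ### Almost everywhere identities and estimates for the Fourier transform -/

namespace EulerPoisson

open Set Filter Topology

section identities

variable {G H : ℝ → ℝ → ℝ} {k : ℤ}

theorem IsCylSmooth.add (hG : IsCylSmooth G) (hH : IsCylSmooth H) :
    IsCylSmooth fun x y => G x y + H x y :=
  ⟨hG.contDiff.add hH.contDiff, fun x y => by rw [hG.periodic, hH.periodic]⟩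

theorem IsCylSmooth.const_mul (hG : IsCylSmooth G) (c : ℝ) : IsCylSmooth fun x y => c * G x y :=
  ⟨contDiff_const.mul hG.contDiff, fun x y => by rw [hG.periodic]⟩

theorem xMode_add (hG : Continuous fun p : ℝ × ℝ => G p.1 p.2)
    (hH : Continuous fun p : ℝ × ℝ => H p.1 p.2) (k : ℤ) :
    xMode (fun x y => G x y + H x y) k = fun y => xMode G k y + xMode H k y := by
  funext y
  exact xMode_add_apply (G := G) (H := H) (hG.comp (by fun_prop : Continuous fun x : ℝ => (x, y)))
    (hH.comp (by fun_prop : Continuous fun x : ℝ => (x, y)))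

theorem memLp_xMode_add (hG : IsCylSmooth G) (hH : IsCylSmooth H)
    (h1 : MemLp (xMode G k) 2 (volume : Measure ℝ))
    (h2 : MemLp (xMode H k) 2 (volume : Measure ℝ)) :
    MemLp (xMode (fun x y => G x y + H x y) k) 2 (volume : Measure ℝ) := by
  rw [xMode_add hG.continuous hH.continuous]
  exact h1.add h2

theorem memLp_xMode_const_mul (c : ℝ) (h1 : MemLp (xMode G k) 2 (volume : Measure ℝ)) :
    MemLp (xMode (fun x y => c * G x y) k) 2 (volume : Measure ℝ) := by
  have : xMode (fun x y => c * G x y) k = fun y => (c : ℂ) * xMode G k y := by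
    funext y; exact xMode_mul_left (fun _ => c) y
  rw [this]
  exact h1.const_mul _

theorem fourierHat_add_ae (hG : IsCylSmooth G) (hH : IsCylSmooth H)
    (h1 : MemLp (xMode G k) 2 (volume : Measure ℝ))
    (h2 : MemLp (xMode H k) 2 (volume : Measure ℝ)) :
    ∀ᵐ ξ, fourierHat (fun x y => G x y + H x y) k ξ = fourierHat G k ξ + fourierHat H k ξ := by
  have h := ae_exists_cutoff_seq k ![fun x y => G x y + H x y, G, H]
    (by simp [Fin.forall_fin_succ, hG, hH, hG.add hH])
    (by simp [Fin.forall_fin_succ, h1, h2, memLp_xMode_add hG hH h1 h2]) (fun _ => 0)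
    (fun _ _ => 0) (fun _ => measurable_const) (by simp)
  filter_upwards [h] with ξ ⟨u, hu, _, _⟩
  simp only [Fin.forall_fin_succ, sub_zero, Matrix.cons_val_zero, Matrix.cons_val_succ] at hu
  refine tendsto_nhds_unique hu.1 ?_
  refine (hu.2.1.add hu.2.2.1).congr fun j => ?_
  exact (weightedHat_add (isWeight_cutoff _) hG.continuous hH.continuous).symm

theorem fourierHat_const_mul_ae (hG : IsCylSmooth G) (c : ℝ)
    (h1 : MemLp (xMode G k) 2 (volume : Measure ℝ)) :
    ∀ᵐ ξ, fourierHat (fun x y => c * G x y) k ξ = c * fourierHat G k ξ := by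
  have h := ae_exists_cutoff_seq k ![fun x y => c * G x y, G]
    (by simp [Fin.forall_fin_succ, hG, hG.const_mul c])
    (by simp [Fin.forall_fin_succ, h1, memLp_xMode_const_mul c h1]) (fun _ => 0)
    (fun _ _ => 0) (fun _ => measurable_const) (by simp)
  filter_upwards [h] with ξ ⟨u, hu, _, _⟩
  simp only [Fin.forall_fin_succ, sub_zero, Matrix.cons_val_zero, Matrix.cons_val_succ] at hu
  refine tendsto_nhds_unique hu.1 ?_
  refine (hu.2.1.const_mul (c : ℂ)).congr fun j => ?_
  exact (weightedHat_const_mul c).symm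

theorem IsCylSmooth.divergence (hG : IsCylSmooth G) (hH : IsCylSmooth H) :
    IsCylSmooth (divergence G H) :=
  hG.dX.add hH.dY

theorem IsCylSmooth.vorticity (hG : IsCylSmooth G) (hH : IsCylSmooth H) :
    IsCylSmooth (vorticity G H) := by
  have h : EulerPoisson.vorticity G H
      = fun x y => (-1) * EulerPoisson.dY G x y + EulerPoisson.dX H x y := by
    funext x y
    simp only [EulerPoisson.vorticity, EulerPoisson.dY, EulerPoisson.dX]; ring
  rw [h]
  exact (hG.dY.const_mul (-1)).add hH.dX

theorem fourierHat_divergence_ae (hG : IsCylSmooth G) (hH : IsCylSmooth H)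
    (h1 : MemLp (xMode G k) 2 (volume : Measure ℝ))
    (h2 : MemLp (xMode H k) 2 (volume : Measure ℝ))
    (h3 : MemLp (xMode (divergence G H) k) 2 (volume : Measure ℝ)) :
    ∀ᵐ ξ, fourierHat (divergence G H) k ξ = divHat G H k ξ := by
  have h := ae_exists_cutoff_seq k ![divergence G H, G, H]
    (by simp [Fin.forall_fin_succ, hG, hH, hG.divergence hH])
    (by simp [Fin.forall_fin_succ, h1, h2, h3]) (fun _ => 0)
    (fun _ _ => 0) (fun _ => measurable_const) (by simp)
  filter_upwards [h] with ξ ⟨u, hu, hu', _⟩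
  simp only [Fin.forall_fin_succ, sub_zero, Matrix.cons_val_zero, Matrix.cons_val_succ] at hu hu'
  refine tendsto_nhds_unique hu.1 ?_
  have hlim := ((hu.2.1.const_mul (Complex.I * k)).add
    (hu.2.2.1.const_mul (Complex.I * ξ))).sub hu'.2.2.1.1
  rw [sub_zero] at hlim
  refine hlim.congr fun j => ?_
  have hw := isWeight_cutoff (u j)
  have e : weightedHat (cutoff (u j)) (divergence G H) k ξ
      = weightedHat (cutoff (u j)) (fun x y => dX G x y + dY H x y) k ξ := rfl
  rw [e, weightedHat_add hw hG.dX.continuous hH.dY.continuous, weightedHat_dX hG,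
    weightedHat_dY hw hH]
  ring

theorem fourierHat_vorticity_ae (hG : IsCylSmooth G) (hH : IsCylSmooth H)
    (h1 : MemLp (xMode G k) 2 (volume : Measure ℝ))
    (h2 : MemLp (xMode H k) 2 (volume : Measure ℝ))
    (h3 : MemLp (xMode (vorticity G H) k) 2 (volume : Measure ℝ)) :
    ∀ᵐ ξ, fourierHat (vorticity G H) k ξ = vortHat G H k ξ := by
  have h := ae_exists_cutoff_seq k ![vorticity G H, G, H]
    (by simp [Fin.forall_fin_succ, hG, hH, hG.vorticity hH])
    (by simp [Fin.forall_fin_succ, h1, h2, h3]) (fun _ => 0)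
    (fun _ _ => 0) (fun _ => measurable_const) (by simp)
  filter_upwards [h] with ξ ⟨u, hu, hu', _⟩
  simp only [Fin.forall_fin_succ, sub_zero, Matrix.cons_val_zero, Matrix.cons_val_succ] at hu hu'
  refine tendsto_nhds_unique hu.1 ?_
  have hlim := ((hu.2.1.const_mul (-(Complex.I * ξ))).add
    (hu.2.2.1.const_mul (Complex.I * k))).add hu'.2.1.1
  rw [add_zero] at hlim
  refine hlim.congr fun j => ?_
  have hw := isWeight_cutoff (u j)
  have e : weightedHat (cutoff (u j)) (vorticity G H) k ξ
      = weightedHat (cutoff (u j)) (fun x y => (-1) * dY G x y + dX H x y) k ξ := by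
    congr 1
    funext x y
    simp only [vorticity, dY, dX]; ring
  have c1 := hG.dY.continuous
  rw [e, weightedHat_add (G := fun x y => (-1) * dY G x y) (H := dX H) hw (by fun_prop)
    hH.dX.continuous, weightedHat_const_mul, weightedHat_dX hH, weightedHat_dY hw hG]
  push_cast
  ring

end identities

theorem continuous_cutoffError {w : ℝ → ℝ} (hw : IsWeight w) {η uy φ : ℝ → ℝ → ℝ → ℝ}
    (h1 : SmoothOnCylinder η) (h2 : SmoothOnCylinder uy) (h3 : SmoothOnCylinder φ) (k : ℤ) :
    Continuous fun p : ℝ × ℝ => cutoffError w η uy φ k p.2 p.1 := by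
  have c1 := continuous_movingHat_uncurry hw.deriv h2 k
  have c2 := continuous_movingHat_uncurry hw.deriv h1 k
  have c3 := continuous_movingHat_uncurry hw.deriv h3 k
  have c4 := continuous_movingHat_uncurry hw.deriv.deriv h3 k
  unfold cutoffError
  exact (((c1.norm.pow 2).add (c2.norm.pow 2)).add (c3.norm.pow 2)).add (c4.norm.pow 2)

theorem lintegral_movingHat_le {w : ℝ → ℝ} (hw : IsWeight w) {b : ℝ} (hb : ∀ y, |w y| ≤ b)
    {F : ℝ → ℝ → ℝ → ℝ} (hF : SmoothOnCylinder F) {s M : ℝ} (hs : 0 ≤ s)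
    (hM : l2Norm (F s) ≤ ENNReal.ofReal M) (k : ℤ) :
    ∫⁻ ξ, ‖movingHat w F k ξ s‖ₑ ^ 2 ≤ ENNReal.ofReal b ^ 2 * ENNReal.ofReal M ^ 2 := by
  simp_rw [movingHat_of_nonneg _ _ _ _ hs]
  rw [lintegral_sub_right_eq_self fun ξ => ‖weightedHat w (F s) k ξ‖ₑ ^ 2]
  refine (lintegral_weightedHat_le hw hb (hF.isCylSmooth hs).continuous k).trans ?_
  gcongr
  exact (lintegral_xMode_le (hF.isCylSmooth hs).continuous k).trans (by gcongr)

theorem tendsto_lintegral_cutoffError {η uy φ : ℝ → ℝ → ℝ → ℝ}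
    (h1 : SmoothOnCylinder η) (h2 : SmoothOnCylinder uy) (h3 : SmoothOnCylinder φ)
    (b1 : LocallyBoundedInL2 η) (b2 : LocallyBoundedInL2 uy) (b3 : LocallyBoundedInL2 φ)
    (k : ℤ) {t : ℝ} (ht : 0 ≤ t) :
    Tendsto (fun n => ∫⁻ ξ, ENNReal.ofReal
      (∫ s in (0 : ℝ)..t, cutoffError (cutoff n) η uy φ k ξ s)) atTop (𝓝 0) := by
  obtain ⟨B, hB0, hB⟩ := exists_cutoff_bound
  obtain ⟨M1, hM1⟩ := b1 t
  obtain ⟨M2, hM2⟩ := b2 t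
  obtain ⟨M3, hM3⟩ := b3 t
  set K : ℝ≥0∞ := ENNReal.ofReal M2 ^ 2 + ENNReal.ofReal M1 ^ 2 + ENNReal.ofReal M3 ^ 2
    + ENNReal.ofReal M3 ^ 2 with hK
  have hKtop : K * ENNReal.ofReal t ≠ ⊤ := by
    refine ENNReal.mul_ne_top ?_ ENNReal.ofReal_ne_top
    simp [hK]
  refine tendsto_of_tendsto_of_tendsto_of_le_of_le tendsto_const_nhds
    (tendsto_cutoff_const B _ hKtop) (fun n => zero_le) fun n => ?_
  have hw := isWeight_cutoff n
  have hc := continuous_cutoffError hw h1 h2 h3 k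
  have hcs : ∀ ξ, Continuous fun s => cutoffError (cutoff n) η uy φ k ξ s := fun ξ =>
    Continuous.comp (f := fun s : ℝ => (s, ξ)) hc (by fun_prop)
  have e1 : ∀ ξ, ENNReal.ofReal (∫ s in (0 : ℝ)..t, cutoffError (cutoff n) η uy φ k ξ s)
      = ∫⁻ s in Ioc 0 t, ENNReal.ofReal (cutoffError (cutoff n) η uy φ k ξ s) := by
    intro ξ
    rw [intervalIntegral.integral_of_le ht]
    exact ofReal_integral_eq_lintegral_ofReal (((hcs ξ).intervalIntegrable 0 t).1)
      (Eventually.of_forall fun s => cutoffError_nonneg _ _ _ _ _ _ _)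
  simp_rw [e1]
  rw [lintegral_lintegral_swap]
  swap
  · have : Continuous fun p : ℝ × ℝ => cutoffError (cutoff n) η uy φ k p.1 p.2 :=
      Continuous.comp (f := fun p : ℝ × ℝ => (p.2, p.1)) hc (by fun_prop)
    exact this.measurable.ennreal_ofReal.aemeasurable
  have hslice : ∀ s ∈ Ioc 0 t, ∫⁻ ξ, ENNReal.ofReal (cutoffError (cutoff n) η uy φ k ξ s)
      ≤ ENNReal.ofReal (B / (n + 1)) ^ 2 * K := by
    intro s hs
    have hs0 := hs.1.le
    have e2 : ∀ ξ, ENNReal.ofReal (cutoffError (cutoff n) η uy φ k ξ s)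
        = ‖movingHat (deriv (cutoff n)) uy k ξ s‖ₑ ^ 2 + ‖movingHat (deriv (cutoff n)) η k ξ s‖ₑ ^ 2
          + ‖movingHat (deriv (cutoff n)) φ k ξ s‖ₑ ^ 2
          + ‖movingHat (deriv (deriv (cutoff n))) φ k ξ s‖ₑ ^ 2 := by
      intro ξ
      unfold cutoffError
      rw [ENNReal.ofReal_add (by positivity) (by positivity), ENNReal.ofReal_add (by positivity)
        (by positivity), ENNReal.ofReal_add (by positivity) (by positivity)]
      simp only [ENNReal.ofReal_pow (norm_nonneg _), ofReal_norm]
    have mm : ∀ {w : ℝ → ℝ} {F : ℝ → ℝ → ℝ → ℝ}, IsWeight w → SmoothOnCylinder F →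
        Measurable fun ξ => ‖movingHat w F k ξ s‖ₑ ^ 2 := fun hw hF =>
      (Continuous.comp (f := fun ξ : ℝ => (s, ξ)) (continuous_movingHat_uncurry hw hF k)
        (by fun_prop)).enorm.measurable.pow_const 2
    simp_rw [e2]
    rw [lintegral_add_right _ (mm hw.deriv.deriv h3), lintegral_add_right _ (mm hw.deriv h3),
      lintegral_add_right _ (mm hw.deriv h1), hK, mul_add, mul_add, mul_add]
    gcongr
    · exact lintegral_movingHat_le hw.deriv (fun y => (hB n y).1) h2 hs0 (hM2 s hs0 hs.2) k
    · exact lintegral_movingHat_le hw.deriv (fun y => (hB n y).1) h1 hs0 (hM1 s hs0 hs.2) k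
    · exact lintegral_movingHat_le hw.deriv (fun y => (hB n y).1) h3 hs0 (hM3 s hs0 hs.2) k
    · exact lintegral_movingHat_le hw.deriv.deriv (fun y => (hB n y).2) h3 hs0 (hM3 s hs0 hs.2) k
  calc _ ≤ ∫⁻ s in Ioc 0 t, ENNReal.ofReal (B / (n + 1)) ^ 2 * K :=
        setLIntegral_mono' measurableSet_Ioc hslice
    _ = _ := by
        rw [setLIntegral_const, Real.volume_Ioc, sub_zero, mul_assoc]

theorem measurable_integral_cutoffError {w : ℝ → ℝ} (hw : IsWeight w) {η uy φ : ℝ → ℝ → ℝ → ℝ}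
    (h1 : SmoothOnCylinder η) (h2 : SmoothOnCylinder uy) (h3 : SmoothOnCylinder φ) (k : ℤ) (t : ℝ) :
    Measurable fun ξ => ENNReal.ofReal (∫ s in (0 : ℝ)..t, cutoffError w η uy φ k ξ s) := by
  have hc := continuous_cutoffError hw h1 h2 h3 k
  have : Continuous fun ξ => ∫ s in (0 : ℝ)..t, cutoffError w η uy φ k ξ s :=
    intervalIntegral.continuous_parametric_intervalIntegral_of_continuous'
      (Continuous.comp (f := fun p : ℝ × ℝ => (p.2, p.1)) hc (by fun_prop)) _ _
  exact this.measurable.ennreal_ofReal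

theorem LocallyBoundedInL2.l2Norm_lt_top {F : ℝ → ℝ → ℝ → ℝ} (hb : LocallyBoundedInL2 F) {t : ℝ}
    (ht : 0 ≤ t) : l2Norm (F t) < ⊤ := by
  obtain ⟨M, hM⟩ := hb t
  exact (hM t ht le_rfl).trans_lt ENNReal.ofReal_lt_top

theorem SmoothOnCylinder.memLp_xMode {F : ℝ → ℝ → ℝ → ℝ} (hF : SmoothOnCylinder F)
    (hb : LocallyBoundedInL2 F) {t : ℝ} (ht : 0 ≤ t) (k : ℤ) :
    MemLp (xMode (F t) k) 2 (volume : Measure ℝ) :=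
  hasL2Modes_of_l2Norm (hF.isCylSmooth ht).continuous (hb.l2Norm_lt_top ht) k

theorem xMode_zero_eq {f : ℝ → ℝ → ℝ} (hf : ∀ y, xAverage f y = 0) (y : ℝ) : xMode f 0 y = 0 := by
  have h := hf y
  unfold xAverage at h
  have hpi : 1 / (2 * Real.pi) ≠ 0 := by positivity
  have h2 := (mul_eq_zero.1 h).resolve_left hpi
  unfold xMode
  simp only [Int.cast_zero, mul_zero, zero_mul, neg_zero, Complex.exp_zero, one_mul]
  rw [intervalIntegral.integral_ofReal, h2, Complex.ofReal_zero]

theorem eq_zero_of_hasDerivAt_zero_of_memLp {g : ℝ → ℂ} (hd : ∀ y, HasDerivAt g 0 y)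
    (hg : MemLp g 2 (volume : Measure ℝ)) (y : ℝ) : g y = 0 := by
  have hconst : ∀ x, g x = g 0 := fun x =>
    is_const_of_deriv_eq_zero (fun x => (hd x).differentiableAt) (fun x => (hd x).deriv) x 0
  have h : g = fun _ => g 0 := funext hconst
  rw [h] at hg
  rcases (memLp_const_iff (by norm_num) (by norm_num)).1 hg with h0 | h0
  · rw [hconst, h0]
  · simp at h0

namespace IsSmoothSolution

variable {e m Tp Tm : ℝ} {η ux uy φ : ℝ → ℝ → ℝ → ℝ}

theorem poisson_fourierHat_ae (h : IsSmoothSolution e m Tp Tm η ux uy φ) {t : ℝ} (ht : 0 ≤ t)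
    (k : ℤ) : ∀ᵐ q : ℝ, ((k ^ 2 + q ^ 2 + 4 * Real.pi * e ^ 2 / Tm : ℝ) : ℂ) * fourierHat (φ t) k q
      = (4 * Real.pi * e : ℝ) * fourierHat (η t) k q := by
  have hG := h.smooth_φ.isCylSmooth ht
  have hH := h.smooth_η.isCylSmooth ht
  have hs := ae_exists_cutoff_seq k ![φ t, η t]
    (by simp [Fin.forall_fin_succ, hG, hH])
    (by simp [Fin.forall_fin_succ, h.smooth_φ.memLp_xMode h.l2_φ ht k,
      h.smooth_η.memLp_xMode h.l2_η ht k]) (fun _ => 0)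
    (fun _ _ => 0) (fun _ => measurable_const) (by simp)
  filter_upwards [hs] with q ⟨u, hu, hu', _⟩
  simp only [Fin.forall_fin_succ, sub_zero, Matrix.cons_val_zero, Matrix.cons_val_succ] at hu hu'
  have l1 := hu.1.const_mul (((k ^ 2 + q ^ 2 + 4 * Real.pi * e ^ 2 / Tm : ℝ) : ℂ))
  have l2 := (hu.2.1.const_mul ((4 * Real.pi * e : ℝ) : ℂ)).add
    (hu'.1.2.sub (hu'.1.1.const_mul (2 * Complex.I * q)))
  simp only [mul_zero, sub_zero, add_zero] at l2
  refine tendsto_nhds_unique l1 (l2.congr fun j => ?_)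
  exact (h.poisson_weightedHat (isWeight_cutoff (u j)) ht k q).symm

/-- The energy estimate, and the conservation of the sum of density and vorticity, for the modes
`k ≠ 0` of a solution. -/
theorem mode_estimate_ae (he : 0 < e) (hm : 0 < m) (hTp : 0 < Tp) (hTm : 0 < Tm) :
    ∃ C : ℝ, 0 < C ∧ ∀ η ux uy φ : ℝ → ℝ → ℝ → ℝ, IsSmoothSolution e m Tp Tm η ux uy φ →
      ∀ (k : ℤ) (t : ℝ), k ≠ 0 → 0 ≤ t → ∀ᵐ ξ : ℝ,
        shearSq k ξ t ^ (-3 / 2 : ℝ) * (shearSq k ξ t * ‖fourierHat (η t) k (ξ - k * t)‖ ^ 2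
              + ‖divHat (ux t) (uy t) k (ξ - k * t)‖ ^ 2)
          ≤ C * (shearSq k ξ 0 ^ (-3 / 2 : ℝ) * (shearSq k ξ 0 * ‖fourierHat (η 0) k ξ‖ ^ 2
              + ‖divHat (ux 0) (uy 0) k ξ‖ ^ 2)
            + ((k : ℝ) ^ 2) ^ (-3 / 2 : ℝ)
              * ‖fourierHat (η 0) k ξ + vortHat (ux 0) (uy 0) k ξ‖ ^ 2)
        ∧ ‖fourierHat (η t) k (ξ - k * t) + vortHat (ux t) (uy t) k (ξ - k * t)‖ ^ 2
          ≤ 2 * ‖fourierHat (η 0) k ξ + vortHat (ux 0) (uy 0) k ξ‖ ^ 2 := by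
  obtain ⟨C, hC, H⟩ := localized_mode_bound he hm hTp hTm
  refine ⟨C, hC, fun η ux uy φ h k t hk ht => ?_⟩
  have s1 := fun {t} (ht : 0 ≤ t) => h.smooth_η.isCylSmooth ht
  have s2 := fun {t} (ht : 0 ≤ t) => h.smooth_ux.isCylSmooth ht
  have s3 := fun {t} (ht : 0 ≤ t) => h.smooth_uy.isCylSmooth ht
  have p1 := fun {t} (ht : 0 ≤ t) => h.smooth_η.memLp_xMode h.l2_η ht k
  have p2 := fun {t} (ht : 0 ≤ t) => h.smooth_ux.memLp_xMode h.l2_ux ht k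
  have p3 := fun {t} (ht : 0 ≤ t) => h.smooth_uy.memLp_xMode h.l2_uy ht k
  have hs := ae_exists_cutoff_seq k ![η t, ux t, uy t, η 0, ux 0, uy 0]
    (by simp [Fin.forall_fin_succ, s1 ht, s2 ht, s3 ht, s1 le_rfl, s2 le_rfl, s3 le_rfl])
    (by simp [Fin.forall_fin_succ, p1 ht, p2 ht, p3 ht, p1 le_rfl, p2 le_rfl, p3 le_rfl])
    ![k * t, k * t, k * t, 0, 0, 0]
    (fun n ξ => ENNReal.ofReal (∫ s in (0 : ℝ)..t, cutoffError (cutoff n) η uy φ k ξ s))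
    (fun n => measurable_integral_cutoffError (isWeight_cutoff n) h.smooth_η h.smooth_uy
      h.smooth_φ k t)
    (tendsto_lintegral_cutoffError h.smooth_η h.smooth_uy h.smooth_φ h.l2_η h.l2_uy h.l2_φ k ht)
  filter_upwards [hs] with ξ ⟨u, hu, _, hR⟩
  simp only [Fin.forall_fin_succ, sub_zero, Matrix.cons_val_zero, Matrix.cons_val_succ,
    IsEmpty.forall_iff, and_true] at hu
  obtain ⟨l1, l2, l3, l4, l5, l6⟩ := hu
  obtain ⟨L, hL, H⟩ := H k ξ t hk ht
  have hR' : Tendsto (fun j => ∫ s in (0 : ℝ)..t, cutoffError (cutoff (u j)) η uy φ k ξ s) atTop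
      (𝓝 0) := by
    have := (ENNReal.tendsto_toReal ENNReal.zero_ne_top).comp hR
    refine (this.congr fun j => ?_)
    exact ENNReal.toReal_ofReal
      (intervalIntegral.integral_nonneg ht fun s _ => cutoffError_nonneg _ _ _ _ _ _ _)
  have m0 : ∀ (w : ℝ → ℝ) (F : ℝ → ℝ → ℝ → ℝ),
      movingHat w F k ξ 0 = weightedHat w (F 0) k ξ := by
    intro w F
    rw [movingHat_of_nonneg _ _ _ _ le_rfl, mul_zero, sub_zero]
  have dt : Tendsto (fun j => movingDiv (cutoff (u j)) ux uy k ξ t) atTop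
      (𝓝 (divHat (ux t) (uy t) k (ξ - k * t))) := by
    simp only [movingDiv, divHat, movingHat_of_nonneg _ _ _ _ ht]
    exact (l2.const_mul _).add (l3.const_mul _)
  have d0 : Tendsto (fun j => movingDiv (cutoff (u j)) ux uy k ξ 0) atTop
      (𝓝 (divHat (ux 0) (uy 0) k ξ)) := by
    simp only [movingDiv, divHat, m0, mul_zero, sub_zero]
    exact (l5.const_mul _).add (l6.const_mul _)
  have gt : Tendsto (fun j => movingSum (cutoff (u j)) η ux uy k ξ t) atTop
      (𝓝 (fourierHat (η t) k (ξ - k * t) + vortHat (ux t) (uy t) k (ξ - k * t))) := by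
    simp only [movingSum, vortHat, movingHat_of_nonneg _ _ _ _ ht]
    exact l1.add ((l2.const_mul _).add (l3.const_mul _))
  have g0 : Tendsto (fun j => movingSum (cutoff (u j)) η ux uy k ξ 0) atTop
      (𝓝 (fourierHat (η 0) k ξ + vortHat (ux 0) (uy 0) k ξ)) := by
    simp only [movingSum, vortHat, m0, mul_zero, sub_zero]
    exact l4.add ((l5.const_mul _).add (l6.const_mul _))
  have nt : Tendsto (fun j => movingHat (cutoff (u j)) η k ξ t) atTop
      (𝓝 (fourierHat (η t) k (ξ - k * t))) := by
    simpa only [movingHat_of_nonneg _ _ _ _ ht] using l1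
  have n0 : Tendsto (fun j => movingHat (cutoff (u j)) η k ξ 0) atTop
      (𝓝 (fourierHat (η 0) k ξ)) := by
    simpa only [m0] using l4
  have hb := fun j => H η ux uy φ h (cutoff (u j)) (isWeight_cutoff (u j))
  constructor
  · have left := ((((nt.norm.pow 2).const_mul (shearSq k ξ t)).add (dt.norm.pow 2)).const_mul
      (shearSq k ξ t ^ (-3 / 2 : ℝ)))
    have right := ((((((n0.norm.pow 2).const_mul (shearSq k ξ 0)).add (d0.norm.pow 2)).const_mul
      (shearSq k ξ 0 ^ (-3 / 2 : ℝ))).add ((g0.norm.pow 2).const_mul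
      (((k : ℝ) ^ 2) ^ (-3 / 2 : ℝ)))).const_mul C).add (hR'.const_mul L)
    rw [mul_zero, add_zero] at right
    refine le_of_tendsto_of_tendsto' left right fun j => ?_
    refine le_trans ?_ (hb j).1
    exact le_add_of_nonneg_right (by positivity)
  · have right := ((g0.norm.pow 2).const_mul 2).add (hR'.const_mul L)
    rw [mul_zero, add_zero] at right
    exact le_of_tendsto_of_tendsto' (gt.norm.pow 2) right fun j => (hb j).2

/-- The modes `k = 0` stay zero. -/
theorem zero_mode_ae (h : IsSmoothSolution e m Tp Tm η ux uy φ) (he : 0 < e) (hTm : 0 < Tm)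
    (h1 : ∀ y, xAverage (η 0) y = 0) (h2 : ∀ y, xAverage (divergence (ux 0) (uy 0)) y = 0)
    (h3 : ∀ y, xAverage (vorticity (ux 0) (uy 0)) y = 0) {t : ℝ} (ht : 0 ≤ t) :
    ∀ᵐ ξ : ℝ, fourierHat (η t) 0 ξ = 0 ∧ fourierHat (ux t) 0 ξ = 0 ∧ fourierHat (uy t) 0 ξ = 0 := by
  have s1 := fun {t} (ht : 0 ≤ t) => h.smooth_η.isCylSmooth ht
  have s2 := fun {t} (ht : 0 ≤ t) => h.smooth_ux.isCylSmooth ht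
  have s3 := fun {t} (ht : 0 ≤ t) => h.smooth_uy.isCylSmooth ht
  have p1 := fun {t} (ht : 0 ≤ t) => h.smooth_η.memLp_xMode h.l2_η ht 0
  have p2 := fun {t} (ht : 0 ≤ t) => h.smooth_ux.memLp_xMode h.l2_ux ht 0
  have p3 := fun {t} (ht : 0 ≤ t) => h.smooth_uy.memLp_xMode h.l2_uy ht 0
  -- the averages of the velocity vanish initially: they are constant and square integrable
  have z1 : ∀ y, xMode (η 0) 0 y = 0 := xMode_zero_eq h1
  have z3 : ∀ y, xMode (uy 0) 0 y = 0 := by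
    refine eq_zero_of_hasDerivAt_zero_of_memLp (fun y => ?_) (p3 le_rfl)
    have hd := hasDerivAt_xMode (s3 le_rfl) 0 y
    have e1 := xMode_zero_eq h2 y
    have e2 : xMode (divergence (ux 0) (uy 0)) 0 y
        = xMode (dX (ux 0)) 0 y + xMode (dY (uy 0)) 0 y :=
      congrFun (xMode_add (s2 le_rfl).dX.continuous (s3 le_rfl).dY.continuous 0) y
    rw [e1, xMode_dX (s2 le_rfl)] at e2
    simp only [Int.cast_zero, mul_zero, zero_mul, zero_add] at e2
    rwa [← e2] at hd
  have z2 : ∀ y, xMode (ux 0) 0 y = 0 := by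
    refine eq_zero_of_hasDerivAt_zero_of_memLp (fun y => ?_) (p2 le_rfl)
    have hd := hasDerivAt_xMode (s2 le_rfl) 0 y
    have e1 := xMode_zero_eq h3 y
    have c1 := (s2 le_rfl).dY.continuous
    have e0 : vorticity (ux 0) (uy 0) = fun x y => (-1) * dY (ux 0) x y + dX (uy 0) x y := by
      funext x y
      simp only [vorticity, dY, dX]; ring
    have e2 := congrFun (xMode_add (G := fun x y => (-1) * dY (ux 0) x y) (H := dX (uy 0))
      (by fun_prop) (s3 le_rfl).dX.continuous 0) y
    rw [← e0, e1, xMode_dX (s3 le_rfl), xMode_mul_left (fun _ => -1)] at e2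
    simp only [Int.cast_zero, mul_zero, zero_mul, add_zero, Complex.ofReal_neg,
      Complex.ofReal_one, neg_mul, one_mul] at e2
    rwa [neg_eq_zero.1 e2.symm] at hd
  have hs := ae_exists_cutoff_seq 0 ![η t, ux t, uy t]
    (by simp [Fin.forall_fin_succ, s1 ht, s2 ht, s3 ht])
    (by simp [Fin.forall_fin_succ, p1 ht, p2 ht, p3 ht]) (fun _ => 0)
    (fun n ξ => ENNReal.ofReal (∫ s in (0 : ℝ)..t, cutoffError (cutoff n) η uy φ 0 ξ s))
    (fun n => measurable_integral_cutoffError (isWeight_cutoff n) h.smooth_η h.smooth_uy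
      h.smooth_φ 0 t)
    (tendsto_lintegral_cutoffError h.smooth_η h.smooth_uy h.smooth_φ h.l2_η h.l2_uy h.l2_φ 0 ht)
  filter_upwards [hs] with ξ ⟨u, hu, _, hR⟩
  simp only [Fin.forall_fin_succ, sub_zero, Matrix.cons_val_zero, Matrix.cons_val_succ,
    IsEmpty.forall_iff, and_true] at hu
  obtain ⟨l1, l2, l3⟩ := hu
  obtain ⟨L, hL, H⟩ := localized_zero_mode_bound (m := m) (Tp := Tp) he hTm ξ ht
  have hR' : Tendsto (fun j => ∫ s in (0 : ℝ)..t, cutoffError (cutoff (u j)) η uy φ 0 ξ s) atTop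
      (𝓝 0) := by
    have := (ENNReal.tendsto_toReal ENNReal.zero_ne_top).comp hR
    refine (this.congr fun j => ?_)
    exact ENNReal.toReal_ofReal
      (intervalIntegral.integral_nonneg ht fun s _ => cutoffError_nonneg _ _ _ _ _ _ _)
  have m0 : ∀ (w : ℝ → ℝ) (F : ℝ → ℝ → ℝ → ℝ), (∀ y, xMode (F 0) 0 y = 0) →
      movingHat w F 0 ξ 0 = 0 := by
    intro w F hF
    rw [movingHat_of_nonneg _ _ _ _ le_rfl]
    simp [weightedHat, hF]
  have hmt : ∀ (w : ℝ → ℝ) (F : ℝ → ℝ → ℝ → ℝ),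
      movingHat w F 0 ξ t = weightedHat w (F t) 0 ξ := by
    intro w F
    rw [movingHat_of_nonneg _ _ _ _ ht]
    simp
  have hb := fun j => H η ux uy φ h (cutoff (u j)) (isWeight_cutoff (u j))
  simp only [hmt, m0 _ _ z1, m0 _ _ z2, m0 _ _ z3, norm_zero, ne_eq, OfNat.ofNat_ne_zero,
    not_false_eq_true, zero_pow, add_zero, zero_add] at hb
  have left := ((l1.norm.pow 2).add (l2.norm.pow 2)).add (l3.norm.pow 2)
  have right := hR'.const_mul L
  rw [mul_zero] at right
  have hle := le_of_tendsto_of_tendsto' left right hb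
  have q1 := sq_nonneg ‖fourierHat (η t) 0 ξ‖
  have q2 := sq_nonneg ‖fourierHat (ux t) 0 ξ‖
  have q3 := sq_nonneg ‖fourierHat (uy t) 0 ξ‖
  refine ⟨?_, ?_, ?_⟩
  · exact norm_eq_zero.1 (pow_eq_zero_iff two_ne_zero |>.1 (by linarith))
  · exact norm_eq_zero.1 (pow_eq_zero_iff two_ne_zero |>.1 (by linarith))
  · exact norm_eq_zero.1 (pow_eq_zero_iff two_ne_zero |>.1 (by linarith))

end IsSmoothSolution

end EulerPoisson

/-! ### Decay of the frequency weights -/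

namespace EulerPoisson

/-- Comparison of the size `a` of the frequency at time `t` and the size `b` of the initial one,
for a wave number of modulus `κ`. Here `T`, `α`, `β` are the brackets of the time, the wave number
and the vertical frequency, and `J` is the square of the joint bracket of the frequencies. -/
structure WeightRelations (a b κ T α β J : ℝ) : Prop where
  a_pos : 0 < a
  one_le_b : 1 ≤ b
  one_le_κ : 1 ≤ κ
  T_pos : 0 < T
  α_pos : 0 < α
  β_pos : 0 < β
  time_le : κ ^ 2 * T ≤ 2 * a * b
  a_le : a ≤ 2 * T * b
  b_le : b ≤ κ * β
  β_le : β ≤ b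
  α_le : α ≤ 2 * κ
  J_le : J ≤ 2 * b ^ 2
  le_J : b ^ 2 ≤ J

theorem bracket_pos (x : ℝ) : 0 < bracket x := Real.sqrt_pos.2 (by positivity)

theorem weightRelations {k : ℤ} (hk : k ≠ 0) (ξ t : ℝ) :
    WeightRelations √(shearSq k ξ t) √(shearSq k ξ 0) |(k : ℝ)| (bracket t) (bracket k)
      (bracket ξ) (1 + (k : ℝ) ^ 2 + ξ ^ 2) := by
  have hk1 : (1 : ℝ) ≤ (k : ℝ) ^ 2 := by
    have : 1 ≤ k ^ 2 := Int.one_le_abs hk |> fun h => by nlinarith [sq_abs k]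
    exact_mod_cast this
  have hp := shearSq_pos (ξ := ξ) (s := t) hk1
  have hp0 := shearSq_pos (ξ := ξ) (s := 0) hk1
  have e0 : shearSq k ξ 0 = (k : ℝ) ^ 2 + ξ ^ 2 := by simp [shearSq]
  have et : shearSq k ξ t = (k : ℝ) ^ 2 + (ξ - k * t) ^ 2 := rfl
  have ht : (0 : ℝ) < 1 + t ^ 2 := by positivity
  have habs : (1 : ℝ) ≤ |(k : ℝ)| := by
    rw [← one_le_sq_iff₀ (abs_nonneg _), sq_abs]; exact hk1
  have sp := Real.sq_sqrt hp.le
  have sp0 := Real.sq_sqrt hp0.le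
  have sT : bracket t ^ 2 = 1 + t ^ 2 := Real.sq_sqrt ht.le
  have hT := bracket_pos t
  have sβ : bracket ξ ^ 2 = 1 + ξ ^ 2 := Real.sq_sqrt (by positivity)
  have sα : bracket k ^ 2 = 1 + (k : ℝ) ^ 2 := Real.sq_sqrt (by positivity)
  have hkk := sq_abs (k : ℝ)
  refine ⟨Real.sqrt_pos.2 hp, ?_, habs, hT, bracket_pos _, bracket_pos _, ?_, ?_, ?_, ?_, ?_, ?_, ?_⟩
  · rw [Real.one_le_sqrt, e0]; nlinarith
  · refine abs_le_of_sq_le_sq' ?_ (by positivity) |>.2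
    have : ((k : ℝ) ^ 2) ^ 2 * (1 + t ^ 2) ≤ 2 * (shearSq k ξ t * shearSq k ξ 0) := by
      rw [e0, et]
      have h1 : (k : ℝ) ^ 2 * t ^ 2 ≤ 2 * ξ ^ 2 + 2 * (ξ - k * t) ^ 2 := by
        nlinarith [sq_nonneg (2 * ξ - k * t)]
      have h2 : (k : ℝ) ^ 2 * ((k : ℝ) ^ 2 * t ^ 2)
          ≤ (k : ℝ) ^ 2 * (2 * ξ ^ 2 + 2 * (ξ - k * t) ^ 2) := by gcongr
      nlinarith [mul_nonneg (sq_nonneg ξ) (sq_nonneg (ξ - k * t)), sq_nonneg ((k : ℝ) ^ 2)]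
    have hn := mul_pos hp hp0
    calc (|(k : ℝ)| ^ 2 * bracket t) ^ 2 = ((k : ℝ) ^ 2) ^ 2 * (1 + t ^ 2) := by
          rw [mul_pow, sT, hkk]
      _ ≤ 2 * (shearSq k ξ t * shearSq k ξ 0) := this
      _ ≤ 4 * (shearSq k ξ t * shearSq k ξ 0) := by linarith
      _ = _ := by rw [mul_pow, mul_pow, sp, sp0]; ring
  · refine abs_le_of_sq_le_sq' ?_ (by positivity) |>.2
    rw [mul_pow, mul_pow, sp, sp0, sT, e0, et]
    nlinarith [sq_nonneg (ξ + k * t), mul_nonneg (sq_nonneg ξ) (sq_nonneg t), sq_nonneg (k * t),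
      sq_nonneg ξ]
  · refine abs_le_of_sq_le_sq' ?_ (mul_pos (by positivity) (bracket_pos ξ)).le |>.2
    rw [mul_pow, sp0, sβ, hkk, e0]
    nlinarith [sq_nonneg ξ]
  · refine Real.sqrt_le_sqrt ?_
    rw [e0]; linarith
  · refine abs_le_of_sq_le_sq' ?_ (by positivity) |>.2
    rw [mul_pow, sα, hkk]; linarith
  · rw [sp0, e0]; nlinarith [sq_nonneg ξ]
  · rw [sp0, e0]; linarith

namespace WeightRelations

variable {a b κ T α β J : ℝ}

theorem b_pos (h : WeightRelations a b κ T α β J) : 0 < b := zero_lt_one.trans_le h.one_le_b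

theorem κ_pos (h : WeightRelations a b κ T α β J) : 0 < κ := zero_lt_one.trans_le h.one_le_κ

theorem κ_mul_T_le (h : WeightRelations a b κ T α β J) : κ * T ≤ 2 * a * b := by
  have h1 : κ ≤ κ ^ 2 := le_self_pow₀ h.one_le_κ two_ne_zero
  exact (mul_le_mul_of_nonneg_right h1 h.T_pos.le).trans h.time_le

theorem κ_mul_T_le' (h : WeightRelations a b κ T α β J) : κ * T ≤ 2 * a * β := by
  have h1 : κ * (κ * T) ≤ κ * (2 * a * β) :=
    calc κ * (κ * T) = κ ^ 2 * T := by ring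
      _ ≤ 2 * a * b := h.time_le
      _ ≤ 2 * a * (κ * β) := by have := h.a_pos; have := h.b_le; gcongr
      _ = _ := by ring
  exact le_of_mul_le_mul_left h1 h.κ_pos

theorem α_mul_T_le (h : WeightRelations a b κ T α β J) : α * T ≤ 4 * a * b := by
  nlinarith [h.κ_mul_T_le, mul_le_mul_of_nonneg_right h.α_le h.T_pos.le]

theorem α_mul_T_le' (h : WeightRelations a b κ T α β J) : α * T ≤ 4 * a * β := by
  nlinarith [h.κ_mul_T_le', mul_le_mul_of_nonneg_right h.α_le h.T_pos.le]

theorem inv_a_mul_inv_b_le (h : WeightRelations a b κ T α β J) :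
    1 / (a * b) ≤ 4 / (α * T) := by
  have := h.a_pos; have := h.b_pos; have := h.α_pos; have := h.T_pos
  rw [div_le_div_iff₀ (by positivity) (by positivity)]
  linarith [h.α_mul_T_le]

theorem inv_a_mul_inv_b_cube_le (h : WeightRelations a b κ T α β J) :
    1 / (a * b ^ 3) ≤ 4 / (α * T * β ^ 2) := by
  have := h.a_pos; have := h.b_pos; have := h.α_pos; have := h.T_pos; have := h.β_pos
  rw [div_le_div_iff₀ (by positivity) (by positivity)]
  have h1 := h.α_mul_T_le
  have h2 := h.β_le
  calc 1 * (α * T * β ^ 2) ≤ (4 * a * b) * b ^ 2 := by rw [one_mul]; gcongr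
    _ = _ := by ring

theorem inv_a_mul_inv_κ_cube_le (h : WeightRelations a b κ T α β J) :
    1 / (a * κ ^ 3) ≤ 4 * β / (α * T) := by
  have := h.a_pos; have := h.b_pos; have := h.α_pos; have := h.T_pos; have := h.β_pos
  have := h.κ_pos
  rw [div_le_div_iff₀ (by positivity) (by positivity)]
  have h1 : 1 ≤ κ ^ 3 := one_le_pow₀ h.one_le_κ
  calc 1 * (α * T) ≤ (4 * a * β) * 1 := by linarith [h.α_mul_T_le']
    _ ≤ (4 * a * β) * κ ^ 3 := by gcongr
    _ = _ := by ring

theorem inv_a_sq_le (h : WeightRelations a b κ T α β J) :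
    1 / a ^ 2 ≤ 16 * β ^ 2 / (α ^ 2 * T ^ 2) := by
  have := h.a_pos; have := h.α_pos; have := h.T_pos; have := h.β_pos
  rw [div_le_div_iff₀ (by positivity) (by positivity)]
  have h1 := h.α_mul_T_le'
  calc 1 * (α ^ 2 * T ^ 2) = (α * T) ^ 2 := by ring
    _ ≤ (4 * a * β) ^ 2 := by gcongr
    _ = _ := by ring

theorem κ_sq_inv_a_cube_mul_inv_b_le (h : WeightRelations a b κ T α β J) :
    κ ^ 2 / (a ^ 3 * b) ≤ 16 * β ^ 2 / (α * T ^ 3) := by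
  have := h.a_pos; have := h.b_pos; have := h.α_pos; have := h.T_pos; have := h.β_pos
  have := h.κ_pos
  rw [div_le_div_iff₀ (by positivity) (by positivity)]
  have h1 := h.κ_mul_T_le'
  have h2 := h.α_mul_T_le
  calc κ ^ 2 * (α * T ^ 3) = (κ * T) ^ 2 * (α * T) := by ring
    _ ≤ (2 * a * β) ^ 2 * (4 * a * b) := by gcongr
    _ = _ := by ring

theorem κ_sq_inv_a_cube_mul_inv_b_cube_le (h : WeightRelations a b κ T α β J) :
    κ ^ 2 / (a ^ 3 * b ^ 3) ≤ 16 / (α * T ^ 3) := by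
  have := h.a_pos; have := h.b_pos; have := h.α_pos; have := h.T_pos; have := h.κ_pos
  rw [div_le_div_iff₀ (by positivity) (by positivity)]
  have h1 := h.κ_mul_T_le
  have h2 := h.α_mul_T_le
  calc κ ^ 2 * (α * T ^ 3) = (κ * T) ^ 2 * (α * T) := by ring
    _ ≤ (2 * a * b) ^ 2 * (4 * a * b) := by gcongr
    _ = _ := by ring

theorem κ_sq_inv_a_cube_mul_inv_κ_cube_le (h : WeightRelations a b κ T α β J) :
    κ ^ 2 / (a ^ 3 * κ ^ 3) ≤ 16 * β ^ 3 / (α * T ^ 3) := by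
  have := h.a_pos; have := h.α_pos; have := h.T_pos; have := h.β_pos; have := h.κ_pos
  rw [div_le_div_iff₀ (by positivity) (by positivity)]
  have h1 := h.κ_mul_T_le'
  have h2 := h.α_mul_T_le'
  have h3 : 1 ≤ κ ^ 3 := one_le_pow₀ h.one_le_κ
  calc κ ^ 2 * (α * T ^ 3) = (κ * T) ^ 2 * (α * T) * 1 := by ring
    _ ≤ (2 * a * β) ^ 2 * (4 * a * β) * κ ^ 3 := by gcongr
    _ = _ := by ring

theorem κ_sq_inv_a_four_le (h : WeightRelations a b κ T α β J) :
    κ ^ 2 / a ^ 4 ≤ 64 * β ^ 4 / (α ^ 2 * T ^ 4) := by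
  have := h.a_pos; have := h.α_pos; have := h.T_pos; have := h.β_pos; have := h.κ_pos
  rw [div_le_div_iff₀ (by positivity) (by positivity)]
  have h1 := h.κ_mul_T_le'
  have h2 := h.α_mul_T_le'
  calc κ ^ 2 * (α ^ 2 * T ^ 4) = (κ * T) ^ 2 * (α * T) ^ 2 := by ring
    _ ≤ (2 * a * β) ^ 2 * (4 * a * β) ^ 2 := by gcongr
    _ = _ := by ring

theorem a_div_b_le (h : WeightRelations a b κ T α β J) : a / b ≤ 2 * T := by
  rw [div_le_iff₀ h.b_pos]; exact h.a_le

theorem J_pos (h : WeightRelations a b κ T α β J) : 0 < J := by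
  have := h.le_J; have := h.b_pos; have : 0 < b ^ 2 := by positivity
  linarith

theorem a_div_b_cube_le (h : WeightRelations a b κ T α β J) : a / b ^ 3 ≤ 4 * T / J := by
  have := h.J_pos; have := h.b_pos; have := h.T_pos
  rw [div_le_div_iff₀ (by positivity) (by positivity)]
  have h1 := h.a_le
  have h2 := h.J_le
  calc a * J ≤ (2 * T * b) * (2 * b ^ 2) := by gcongr
    _ = _ := by ring

theorem a_div_κ_cube_le (h : WeightRelations a b κ T α β J) : a / κ ^ 3 ≤ 2 * T * J := by
  have := h.J_pos; have := h.b_pos; have := h.T_pos; have := h.κ_pos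
  rw [div_le_iff₀ (by positivity)]
  have h3 : 1 ≤ κ ^ 3 := one_le_pow₀ h.one_le_κ
  have h4 : b ≤ J := le_trans (by nlinarith [h.one_le_b]) h.le_J
  calc a ≤ 2 * T * b := h.a_le
    _ ≤ 2 * T * J * 1 := by rw [mul_one]; gcongr
    _ ≤ 2 * T * J * κ ^ 3 := by gcongr

variable {C N Ψ Γ Ω N₀ Ψ₀ Γ₀ : ℝ}

/-- The weighted energy bound turns into decay of `N / a²`. -/
theorem density_decay (h : WeightRelations a b κ T α β J) (hC : 0 ≤ C) (hN₀ : 0 ≤ N₀)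
    (hΨ₀ : 0 ≤ Ψ₀) (hΓ₀ : 0 ≤ Γ₀) (hΨ : 0 ≤ Ψ)
    (hE : N / a + Ψ / a ^ 3 ≤ C * (N₀ / b + Ψ₀ / b ^ 3 + Γ₀ / κ ^ 3)) :
    N / a ^ 2 ≤ 4 * C * (N₀ / (α * T) + β * Γ₀ / (α * T) + Ψ₀ / (α * T * β ^ 2)) := by
  have ha := h.a_pos; have hb := h.b_pos; have hκ := h.κ_pos
  calc N / a ^ 2 ≤ N / a ^ 2 + Ψ / a ^ 4 := le_add_of_nonneg_right (by positivity)
    _ = (N / a + Ψ / a ^ 3) / a := by field_simp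
    _ ≤ C * (N₀ / b + Ψ₀ / b ^ 3 + Γ₀ / κ ^ 3) / a := by gcongr
    _ = C * (N₀ * (1 / (a * b)) + Γ₀ * (1 / (a * κ ^ 3)) + Ψ₀ * (1 / (a * b ^ 3))) := by
        field_simp; ring
    _ ≤ C * (N₀ * (4 / (α * T)) + Γ₀ * (4 * β / (α * T)) + Ψ₀ * (4 / (α * T * β ^ 2))) := by
        have h1 := h.inv_a_mul_inv_b_le
        have h2 := h.inv_a_mul_inv_b_cube_le
        have h3 := h.inv_a_mul_inv_κ_cube_le
        gcongr
    _ = _ := by ring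

/-- The weighted energy bound turns into decay of `κ² N / a⁴`. -/
theorem density_decay' (h : WeightRelations a b κ T α β J) (hC : 0 ≤ C) (hN₀ : 0 ≤ N₀)
    (hΨ₀ : 0 ≤ Ψ₀) (hΓ₀ : 0 ≤ Γ₀) (hΨ : 0 ≤ Ψ)
    (hE : N / a + Ψ / a ^ 3 ≤ C * (N₀ / b + Ψ₀ / b ^ 3 + Γ₀ / κ ^ 3)) :
    κ ^ 2 * N / a ^ 4 ≤ 16 * C * (β ^ 2 * N₀ / (α * T ^ 3) + β ^ 3 * Γ₀ / (α * T ^ 3)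
      + Ψ₀ / (α * T ^ 3)) := by
  have ha := h.a_pos; have hb := h.b_pos; have hκ := h.κ_pos
  calc κ ^ 2 * N / a ^ 4 ≤ κ ^ 2 * N / a ^ 4 + κ ^ 2 * Ψ / a ^ 6 :=
        le_add_of_nonneg_right (by positivity)
    _ = (N / a + Ψ / a ^ 3) * (κ ^ 2 / a ^ 3) := by field_simp
    _ ≤ C * (N₀ / b + Ψ₀ / b ^ 3 + Γ₀ / κ ^ 3) * (κ ^ 2 / a ^ 3) := by gcongr
    _ = C * (N₀ * (κ ^ 2 / (a ^ 3 * b)) + Γ₀ * (κ ^ 2 / (a ^ 3 * κ ^ 3))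
        + Ψ₀ * (κ ^ 2 / (a ^ 3 * b ^ 3))) := by
        field_simp; ring
    _ ≤ C * (N₀ * (16 * β ^ 2 / (α * T ^ 3)) + Γ₀ * (16 * β ^ 3 / (α * T ^ 3))
        + Ψ₀ * (16 / (α * T ^ 3))) := by
        have h1 := h.κ_sq_inv_a_cube_mul_inv_b_le
        have h2 := h.κ_sq_inv_a_cube_mul_inv_b_cube_le
        have h3 := h.κ_sq_inv_a_cube_mul_inv_κ_cube_le
        gcongr
    _ = _ := by ring

/-- The vorticity is controlled by the conserved sum `Γ` and the density. -/
theorem solenoidalX_decay (h : WeightRelations a b κ T α β J) (hC : 0 ≤ C) (hN₀ : 0 ≤ N₀)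
    (hΨ₀ : 0 ≤ Ψ₀) (hΓ₀ : 0 ≤ Γ₀) (hΨ : 0 ≤ Ψ)
    (hE : N / a + Ψ / a ^ 3 ≤ C * (N₀ / b + Ψ₀ / b ^ 3 + Γ₀ / κ ^ 3)) (hΓ : Γ ≤ 2 * Γ₀)
    (hΩ : Ω ≤ 2 * (Γ + N)) :
    Ω / a ^ 2 ≤ (64 + 8 * C) * (N₀ / (α * T) + β * Γ₀ / (α * T)
      + β ^ 2 * Γ₀ / (α ^ 2 * T ^ 2) + Ψ₀ / (α * T * β ^ 2)) := by
  have ha := h.a_pos; have hα := h.α_pos; have hT := h.T_pos; have hβ := h.β_pos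
  have h1 := h.density_decay hC hN₀ hΨ₀ hΓ₀ hΨ hE
  have h2 := mul_le_mul_of_nonneg_left h.inv_a_sq_le hΓ₀
  have e : Ω / a ^ 2 ≤ 4 * (Γ₀ * (1 / a ^ 2)) + 2 * (N / a ^ 2) := by
    calc Ω / a ^ 2 ≤ (2 * (2 * Γ₀ + N)) / a ^ 2 := by gcongr; linarith
      _ = _ := by ring
  have q1 : 0 ≤ N₀ / (α * T) := by positivity
  have q2 : 0 ≤ β * Γ₀ / (α * T) := by positivity
  have q3 : 0 ≤ Ψ₀ / (α * T * β ^ 2) := by positivity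
  have q4 : 0 ≤ C * (β ^ 2 * Γ₀ / (α ^ 2 * T ^ 2)) := by positivity
  have e2 : Γ₀ * (16 * β ^ 2 / (α ^ 2 * T ^ 2)) = 16 * (β ^ 2 * Γ₀ / (α ^ 2 * T ^ 2)) := by ring
  rw [e2] at h2
  linarith

theorem solenoidalY_decay (h : WeightRelations a b κ T α β J) (hC : 0 ≤ C) (hN₀ : 0 ≤ N₀)
    (hΨ₀ : 0 ≤ Ψ₀) (hΓ₀ : 0 ≤ Γ₀) (hΨ : 0 ≤ Ψ)
    (hE : N / a + Ψ / a ^ 3 ≤ C * (N₀ / b + Ψ₀ / b ^ 3 + Γ₀ / κ ^ 3)) (hΓ : Γ ≤ 2 * Γ₀)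
    (hΩ : Ω ≤ 2 * (Γ + N)) :
    κ ^ 2 * Ω / a ^ 4 ≤ (256 + 32 * C) * (β ^ 2 * N₀ / (α * T ^ 3) + β ^ 3 * Γ₀ / (α * T ^ 3)
      + β ^ 4 * Γ₀ / (α ^ 2 * T ^ 4) + Ψ₀ / (α * T ^ 3)) := by
  have ha := h.a_pos; have hα := h.α_pos; have hT := h.T_pos; have hβ := h.β_pos
  have h1 := h.density_decay' hC hN₀ hΨ₀ hΓ₀ hΨ hE
  have h2 := mul_le_mul_of_nonneg_left h.κ_sq_inv_a_four_le hΓ₀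
  have e : κ ^ 2 * Ω / a ^ 4 ≤ 4 * (Γ₀ * (κ ^ 2 / a ^ 4)) + 2 * (κ ^ 2 * N / a ^ 4) := by
    calc κ ^ 2 * Ω / a ^ 4 ≤ κ ^ 2 * (2 * (2 * Γ₀ + N)) / a ^ 4 := by gcongr; linarith
      _ = _ := by ring
  have q1 : 0 ≤ β ^ 2 * N₀ / (α * T ^ 3) := by positivity
  have q2 : 0 ≤ β ^ 3 * Γ₀ / (α * T ^ 3) := by positivity
  have q3 : 0 ≤ Ψ₀ / (α * T ^ 3) := by positivity
  have q4 : 0 ≤ C * (β ^ 4 * Γ₀ / (α ^ 2 * T ^ 4)) := by positivity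
  have e2 : Γ₀ * (64 * β ^ 4 / (α ^ 2 * T ^ 4)) = 64 * (β ^ 4 * Γ₀ / (α ^ 2 * T ^ 4)) := by ring
  rw [e2] at h2
  linarith

/-- The weighted energy bound turns into a growth bound for `N` and `Ψ / a²`. -/
theorem compressible_growth (h : WeightRelations a b κ T α β J) (hC : 0 ≤ C) (hN₀ : 0 ≤ N₀)
    (hΨ₀ : 0 ≤ Ψ₀) (hΓ₀ : 0 ≤ Γ₀)
    (hE : N / a + Ψ / a ^ 3 ≤ C * (N₀ / b + Ψ₀ / b ^ 3 + Γ₀ / κ ^ 3)) :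
    N + Ψ / a ^ 2 ≤ 4 * C * (T * N₀ + T * (Ψ₀ / J) + T * (J * Γ₀)) := by
  have ha := h.a_pos; have hb := h.b_pos; have hκ := h.κ_pos
  have hT := h.T_pos; have hJ := h.J_pos
  calc N + Ψ / a ^ 2 = (N / a + Ψ / a ^ 3) * a := by field_simp
    _ ≤ C * (N₀ / b + Ψ₀ / b ^ 3 + Γ₀ / κ ^ 3) * a := by gcongr
    _ = C * (N₀ * (a / b) + Ψ₀ * (a / b ^ 3) + Γ₀ * (a / κ ^ 3)) := by ring
    _ ≤ C * (N₀ * (2 * T) + Ψ₀ * (4 * T / J) + Γ₀ * (2 * T * J)) := by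
        have h1 := h.a_div_b_le
        have h2 := h.a_div_b_cube_le
        have h3 := h.a_div_κ_cube_le
        gcongr
    _ ≤ C * (N₀ * (4 * T) + Ψ₀ * (4 * T / J) + Γ₀ * (4 * T * J)) := by
        gcongr <;> norm_num
    _ = _ := by ring

end WeightRelations

/-! ### Norms from almost everywhere bounds -/

theorem half_pow_sum_le {ι : Type*} (s : Finset ι) (c F : ι → ℝ≥0∞) :
    (∑ i ∈ s, c i ^ 2 * F i) ^ (1 / 2 : ℝ) ≤ ∑ i ∈ s, c i * F i ^ (1 / 2 : ℝ) := by
  classical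
  induction s using Finset.induction_on with
  | empty => simp
  | insert a s ha ih =>
    rw [Finset.sum_insert ha, Finset.sum_insert ha]
    refine (ENNReal.rpow_add_le_add_rpow _ _ (by norm_num) (by norm_num)).trans ?_
    refine add_le_add (le_of_eq ?_) ih
    rw [ENNReal.mul_rpow_of_nonneg _ _ (by norm_num), ← ENNReal.rpow_natCast, ← ENNReal.rpow_mul]
    norm_num

/-- A pointwise bound for squares, in the frame moving with the flow, gives a bound of norms. -/
theorem half_pow_tsum_lintegral_le {ι : Type*} [Fintype ι] (t : ℝ) {g : ℤ → ℝ → ℝ}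
    {w : ι → ℤ → ℝ → ℝ} {f : ι → ℤ → ℝ → ℂ} {c : ι → ℝ}
    (hwm : ∀ i k, Measurable (w i k)) (hfm : ∀ i k, Measurable (f i k)) (hw : ∀ i k ξ, 0 ≤ w i k ξ)
    (hc : ∀ i, 0 ≤ c i)
    (h : ∀ k : ℤ, ∀ᵐ ξ, g k (ξ - k * t) ≤ ∑ i, c i ^ 2 * (w i k ξ * ‖f i k ξ‖ ^ 2)) :
    (∑' k : ℤ, ∫⁻ ξ, ENNReal.ofReal (g k ξ)) ^ (1 / 2 : ℝ) ≤ ∑ i, ENNReal.ofReal (c i)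
      * (∑' k : ℤ, ∫⁻ ξ, ENNReal.ofReal (w i k ξ) * ‖f i k ξ‖ₑ ^ 2) ^ (1 / 2 : ℝ) := by
  refine le_trans ?_ (half_pow_sum_le _ _ _)
  refine ENNReal.rpow_le_rpow ?_ (by norm_num)
  simp_rw [← ENNReal.tsum_mul_left]
  rw [← Summable.tsum_finsetSum fun i _ => ENNReal.summable]
  refine ENNReal.tsum_le_tsum fun k => ?_
  have hm : ∀ i, Measurable fun ξ => ENNReal.ofReal (w i k ξ) * ‖f i k ξ‖ₑ ^ 2 := fun i =>
    (hwm i k).ennreal_ofReal.mul ((hfm i k).enorm.pow_const 2)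
  simp_rw [← lintegral_const_mul _ (hm _)]
  rw [← lintegral_finsetSum _ fun i _ => (hm i).const_mul _,
    ← lintegral_sub_right_eq_self (fun ξ => ENNReal.ofReal (g k ξ)) (k * t)]
  refine lintegral_mono_ae ?_
  filter_upwards [h k] with ξ hξ
  refine (ENNReal.ofReal_le_ofReal hξ).trans (le_of_eq ?_)
  rw [ENNReal.ofReal_sum_of_nonneg fun i _ => by have := hw i k ξ; positivity]
  refine Finset.sum_congr rfl fun i _ => ?_
  rw [ENNReal.ofReal_mul (by positivity), ENNReal.ofReal_mul (hw i k ξ),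
    ENNReal.ofReal_pow (hc i), ENNReal.ofReal_pow (norm_nonneg _), ofReal_norm]

theorem one_add_sq_rpow (x r : ℝ) : (1 + x ^ 2) ^ r = bracket x ^ (2 * r) := by
  rw [bracket, Real.sqrt_eq_rpow, ← Real.rpow_mul (by positivity)]
  congr 1; ring

theorem half_pow_le_anisoNorm {ι : Type*} [Fintype ι] (t : ℝ) {g : ℤ → ℝ → ℝ} (c r s : ι → ℝ)
    (f : ι → ℝ → ℝ → ℝ) (hf : ∀ i, HasL2Modes (f i)) (hc : ∀ i, 0 ≤ c i)
    (h : ∀ k : ℤ, ∀ᵐ ξ, g k (ξ - k * t) ≤ ∑ i, c i ^ 2 * ((1 + (k : ℝ) ^ 2) ^ r i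
      * (1 + ξ ^ 2) ^ s i * ‖fourierHat (f i) k ξ‖ ^ 2)) :
    (∑' k : ℤ, ∫⁻ ξ, ENNReal.ofReal (g k ξ)) ^ (1 / 2 : ℝ)
      ≤ ∑ i, ENNReal.ofReal (c i) * anisoNorm (r i) (s i) (f i) := by
  refine (half_pow_tsum_lintegral_le t (fun i k => ?_) (fun i k => measurable_fourierHat (f i) k)
    (fun i k ξ => by positivity) hc h).trans (le_of_eq ?_)
  · fun_prop
  · exact Finset.sum_congr rfl fun i _ => by rw [anisoNorm, if_pos (hf i)]

theorem half_pow_le_sobolevNorm {ι : Type*} [Fintype ι] (t : ℝ) {g : ℤ → ℝ → ℝ} (c s : ι → ℝ)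
    (f : ι → ℝ → ℝ → ℝ) (hf : ∀ i, HasL2Modes (f i)) (hc : ∀ i, 0 ≤ c i)
    (h : ∀ k : ℤ, ∀ᵐ ξ, g k (ξ - k * t) ≤ ∑ i, c i ^ 2 * ((1 + (k : ℝ) ^ 2 + ξ ^ 2) ^ s i
      * ‖fourierHat (f i) k ξ‖ ^ 2)) :
    (∑' k : ℤ, ∫⁻ ξ, ENNReal.ofReal (g k ξ)) ^ (1 / 2 : ℝ)
      ≤ ∑ i, ENNReal.ofReal (c i) * sobolevNorm (s i) (f i) := by
  refine (half_pow_tsum_lintegral_le t (fun i k => ?_) (fun i k => measurable_fourierHat (f i) k)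
    (fun i k ξ => by positivity) hc h).trans (le_of_eq ?_)
  · fun_prop
  · exact Finset.sum_congr rfl fun i _ => by rw [sobolevNorm, if_pos (hf i)]

theorem l2Norm_eq_half_pow {G : ℝ → ℝ → ℝ} (hG : Continuous fun p : ℝ × ℝ => G p.1 p.2)
    (h : l2Norm G < ⊤) :
    l2Norm G = (∑' k : ℤ, ∫⁻ ξ, ENNReal.ofReal (‖fourierHat G k ξ‖ ^ 2)) ^ (1 / 2 : ℝ) := by
  simp_rw [ENNReal.ofReal_pow (norm_nonneg _), ofReal_norm]
  rw [← l2Norm_sq_eq_tsum hG h, ← ENNReal.rpow_natCast, ← ENNReal.rpow_mul]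
  norm_num

theorem l2Norm_eq_sobolevNorm {G : ℝ → ℝ → ℝ} (hG : Continuous fun p : ℝ × ℝ => G p.1 p.2)
    (h : l2Norm G < ⊤) : l2Norm G = sobolevNorm 0 G := by
  rw [l2Norm_eq_half_pow hG h, sobolevNorm, if_pos (hasL2Modes_of_l2Norm hG h)]
  simp [ENNReal.ofReal_pow (norm_nonneg _), ofReal_norm]

theorem MemAniso.hasL2Modes {r s : ℝ} {f : ℝ → ℝ → ℝ} (h : MemAniso r s f) : HasL2Modes f := by
  by_contra hn
  rw [MemAniso, anisoNorm, if_neg hn] at h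
  exact lt_irrefl _ h

/-! ### Symbols of the Helmholtz projections -/

theorem norm_invLaplaceSymbol (k : ℤ) (q : ℝ) :
    ‖invLaplaceSymbol k q‖ = 1 / ((k : ℝ) ^ 2 + q ^ 2) := by
  have : (k : ℂ) ^ 2 + (q : ℂ) ^ 2 = (((k : ℝ) ^ 2 + q ^ 2 : ℝ) : ℂ) := by push_cast; rfl
  rw [invLaplaceSymbol, this, norm_div, norm_neg, norm_one, Complex.norm_real, Real.norm_eq_abs,
    abs_of_nonneg (by positivity)]

theorem norm_solenoidalXHat_sq (v w : ℝ → ℝ → ℝ) (k : ℤ) (q : ℝ) :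
    ‖solenoidalXHat v w k q‖ ^ 2 = q ^ 2 * ‖vortHat v w k q‖ ^ 2 / ((k : ℝ) ^ 2 + q ^ 2) ^ 2 := by
  simp only [solenoidalXHat, norm_mul, norm_invLaplaceSymbol, norm_neg, Complex.norm_I,
    Complex.norm_real, Real.norm_eq_abs, one_mul, mul_pow, sq_abs, div_pow, one_pow]
  ring_nf

theorem norm_solenoidalYHat_sq (v w : ℝ → ℝ → ℝ) (k : ℤ) (q : ℝ) :
    ‖solenoidalYHat v w k q‖ ^ 2
      = (k : ℝ) ^ 2 * ‖vortHat v w k q‖ ^ 2 / ((k : ℝ) ^ 2 + q ^ 2) ^ 2 := by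
  simp only [solenoidalYHat, norm_mul, norm_invLaplaceSymbol, Complex.norm_I,
    Complex.norm_intCast, one_mul, mul_pow, sq_abs, div_pow, one_pow]
  ring_nf

theorem norm_compressibleHat_sq (v w : ℝ → ℝ → ℝ) (k : ℤ) (q : ℝ) :
    ‖compressibleXHat v w k q‖ ^ 2 + ‖compressibleYHat v w k q‖ ^ 2
      = ‖divHat v w k q‖ ^ 2 / ((k : ℝ) ^ 2 + q ^ 2) := by
  simp only [compressibleXHat, compressibleYHat, norm_mul, norm_invLaplaceSymbol, Complex.norm_I,
    Complex.norm_intCast, Complex.norm_real, Real.norm_eq_abs, one_mul, mul_pow, sq_abs, div_pow,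
    one_pow]
  rw [← add_mul]
  rcases eq_or_ne ((k : ℝ) ^ 2 + q ^ 2) 0 with h | h
  · rw [h]; simp
  · field_simp

/-! ### Decay and growth of the modes -/

theorem rpow_neg_three_halves {p : ℝ} (hp : 0 ≤ p) : p ^ (-3 / 2 : ℝ) = (√p ^ 3)⁻¹ := by
  rw [Real.sqrt_eq_rpow, ← Real.rpow_natCast, ← Real.rpow_mul hp, ← Real.rpow_neg hp]
  norm_num

theorem weighted_energy_eq {p : ℝ} (hp : 0 < p) (N Ψ : ℝ) :
    p ^ (-3 / 2 : ℝ) * (p * N + Ψ) = N / √p + Ψ / √p ^ 3 := by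
  have h : 0 < √p := Real.sqrt_pos.2 hp
  rw [rpow_neg_three_halves hp.le]
  nth_rewrite 2 [← Real.sq_sqrt hp.le]
  field_simp

namespace IsSmoothSolution

variable {e m Tp Tm : ℝ}

/-- Bounds for the modes of a solution with vanishing initial averages: inviscid damping of the
electric potential and of the solenoidal velocity, growth of the compressible part. -/
theorem mode_decay_ae (he : 0 < e) (hm : 0 < m) (hTp : 0 < Tp) (hTm : 0 < Tm) :
    ∃ C : ℝ, 0 < C ∧ ∀ η ux uy φ : ℝ → ℝ → ℝ → ℝ, IsSmoothSolution e m Tp Tm η ux uy φ →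
      (∀ y, xAverage (η 0) y = 0) → (∀ y, xAverage (divergence (ux 0) (uy 0)) y = 0) →
      (∀ y, xAverage (vorticity (ux 0) (uy 0)) y = 0) →
      ∀ (t : ℝ), 0 ≤ t → ∀ k : ℤ, ∀ᵐ ξ : ℝ, ∀ N₀ Ψ₀ Γ₀ : ℝ,
        N₀ = ‖fourierHat (η 0) k ξ‖ ^ 2 → Ψ₀ = ‖divHat (ux 0) (uy 0) k ξ‖ ^ 2 →
        Γ₀ = ‖fourierHat (η 0) k ξ + vortHat (ux 0) (uy 0) k ξ‖ ^ 2 →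
        ‖solenoidalXHat (ux t) (uy t) k (ξ - k * t)‖ ^ 2 ≤ C * (N₀ / (bracket k * bracket t)
          + bracket ξ * Γ₀ / (bracket k * bracket t)
          + bracket ξ ^ 2 * Γ₀ / (bracket k ^ 2 * bracket t ^ 2)
          + Ψ₀ / (bracket k * bracket t * bracket ξ ^ 2)) ∧
        ‖fourierHat (φ t) k (ξ - k * t)‖ ^ 2 ≤ C * (N₀ / (bracket k * bracket t)
          + bracket ξ * Γ₀ / (bracket k * bracket t)
          + bracket ξ ^ 2 * Γ₀ / (bracket k ^ 2 * bracket t ^ 2)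
          + Ψ₀ / (bracket k * bracket t * bracket ξ ^ 2)) ∧
        ‖solenoidalYHat (ux t) (uy t) k (ξ - k * t)‖ ^ 2
          ≤ C * (bracket ξ ^ 2 * N₀ / (bracket k * bracket t ^ 3)
          + bracket ξ ^ 3 * Γ₀ / (bracket k * bracket t ^ 3)
          + bracket ξ ^ 4 * Γ₀ / (bracket k ^ 2 * bracket t ^ 4)
          + Ψ₀ / (bracket k * bracket t ^ 3)) ∧
        ‖compressibleXHat (ux t) (uy t) k (ξ - k * t)‖ ^ 2
          + ‖compressibleYHat (ux t) (uy t) k (ξ - k * t)‖ ^ 2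
          + ‖fourierHat (η t) k (ξ - k * t)‖ ^ 2
          ≤ C * (bracket t * N₀ + bracket t * (Ψ₀ / (1 + (k : ℝ) ^ 2 + ξ ^ 2))
          + bracket t * ((1 + (k : ℝ) ^ 2 + ξ ^ 2) * Γ₀)) := by
  obtain ⟨C, hC, H⟩ := mode_estimate_ae he hm hTp hTm
  have hd : 0 < 4 * Real.pi * e ^ 2 / Tm := by positivity
  refine ⟨256 + 32 * C + (4 * Real.pi * e) ^ 2 * (4 * C), by positivity,
    fun η ux uy φ h h1 h2 h3 t ht k => ?_⟩
  have hKC : 0 ≤ (4 * Real.pi * e) ^ 2 * (4 * C) := by positivity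
  have c1 : 64 + 8 * C ≤ 256 + 32 * C + (4 * Real.pi * e) ^ 2 * (4 * C) := by linarith
  have c2 : 256 + 32 * C ≤ 256 + 32 * C + (4 * Real.pi * e) ^ 2 * (4 * C) := by linarith
  have c3 : (4 * Real.pi * e) ^ 2 * (4 * C)
      ≤ 256 + 32 * C + (4 * Real.pi * e) ^ 2 * (4 * C) := by linarith
  have c4 : 4 * C ≤ 256 + 32 * C + (4 * Real.pi * e) ^ 2 * (4 * C) := by linarith
  have hP := (measurePreserving_sub_right (volume : Measure ℝ) (k * t)).quasiMeasurePreserving.ae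
    (h.poisson_fourierHat_ae ht k)
  have bt := bracket_pos t
  rcases eq_or_ne k 0 with rfl | hk
  · have hz := h.zero_mode_ae he hTm h1 h2 h3 ht
    filter_upwards [hz, hP] with ξ ⟨z1, z2, z3⟩ hφ N₀ Ψ₀ Γ₀ hN hΨ hΓ
    have bk := bracket_pos ((0 : ℤ) : ℝ)
    have bξ := bracket_pos ξ
    have hN0 : 0 ≤ N₀ := by rw [hN]; positivity
    have hΨ0 : 0 ≤ Ψ₀ := by rw [hΨ]; positivity
    have hΓ0 : 0 ≤ Γ₀ := by rw [hΓ]; positivity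
    simp only [Int.cast_zero, zero_mul, sub_zero] at hφ ⊢
    rw [z1, mul_zero] at hφ
    have hφ0 : fourierHat (φ t) 0 ξ = 0 := by
      refine (mul_eq_zero.1 hφ).resolve_left ?_
      have : (0 : ℝ) < 0 ^ 2 + ξ ^ 2 + 4 * Real.pi * e ^ 2 / Tm := by positivity
      exact_mod_cast this.ne'
    simp only [Int.cast_zero] at bk
    refine ⟨?_, ?_, ?_, ?_⟩
    · rw [solenoidalXHat, vortHat, z2, z3]
      simp only [mul_zero, add_zero, norm_zero, ne_eq, OfNat.ofNat_ne_zero, not_false_eq_true,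
        zero_pow]
      positivity
    · rw [hφ0]
      simp only [norm_zero, ne_eq, OfNat.ofNat_ne_zero, not_false_eq_true, zero_pow]
      positivity
    · rw [solenoidalYHat, vortHat, z2, z3]
      simp only [mul_zero, add_zero, norm_zero, ne_eq, OfNat.ofNat_ne_zero, not_false_eq_true,
        zero_pow]
      positivity
    · rw [compressibleXHat, compressibleYHat, divHat, z1, z2, z3]
      simp only [mul_zero, add_zero, norm_zero, ne_eq, OfNat.ofNat_ne_zero, not_false_eq_true,
        zero_pow]
      positivity
  · filter_upwards [H η ux uy φ h k t hk ht, hP] with ξ ⟨hE, hΓ⟩ hφ N₀ Ψ₀ Γ₀ hN hΨ hΓ₀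
    have hk1 : (1 : ℝ) ≤ (k : ℝ) ^ 2 := by
      have : 1 ≤ k ^ 2 := Int.one_le_abs hk |> fun h => by nlinarith [sq_abs k]
      exact_mod_cast this
    have hp := shearSq_pos (ξ := ξ) (s := t) hk1
    have hp0 := shearSq_pos (ξ := ξ) (s := 0) hk1
    have hW := weightRelations hk ξ t
    have bk := bracket_pos (k : ℝ)
    have bξ := bracket_pos ξ
    have hN0 : 0 ≤ N₀ := by rw [hN]; positivity
    have hΨ0 : 0 ≤ Ψ₀ := by rw [hΨ]; positivity
    have hΓ0 : 0 ≤ Γ₀ := by rw [hΓ₀]; positivity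
    rw [weighted_energy_eq hp, weighted_energy_eq hp0, rpow_neg_three_halves (sq_nonneg _),
      Real.sqrt_sq_eq_abs, ← hN, ← hΨ, ← hΓ₀, inv_mul_eq_div] at hE
    rw [← hΓ₀] at hΓ
    set q := ξ - k * t with hq
    set N := ‖fourierHat (η t) k q‖ ^ 2 with hNt
    set Ψ := ‖divHat (ux t) (uy t) k q‖ ^ 2 with hΨt
    set Ω := ‖vortHat (ux t) (uy t) k q‖ ^ 2 with hΩt
    set Γ := ‖fourierHat (η t) k q + vortHat (ux t) (uy t) k q‖ ^ 2 with hΓt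
    have pN : 0 ≤ N := sq_nonneg _
    have pΨ : 0 ≤ Ψ := sq_nonneg _
    have pΩ : 0 ≤ Ω := sq_nonneg _
    have hΩ : Ω ≤ 2 * (Γ + N) := by
      have := norm_sub_sq_le (fourierHat (η t) k q + vortHat (ux t) (uy t) k q)
        (fourierHat (η t) k q)
      rw [add_sub_cancel_left] at this
      linarith
    have hpq : (k : ℝ) ^ 2 + q ^ 2 = shearSq k ξ t := rfl
    have sp := Real.sq_sqrt hp.le
    have r1 := hW.solenoidalX_decay hC.le hN0 hΨ0 hΓ0 pΨ hE hΓ hΩ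
    have r2 := hW.solenoidalY_decay hC.le hN0 hΨ0 hΓ0 pΨ hE hΓ hΩ
    have r3 := hW.density_decay hC.le hN0 hΨ0 hΓ0 pΨ hE
    have r4 := hW.compressible_growth hC.le hN0 hΨ0 hΓ0 hE
    have sp4 : √(shearSq k ξ t) ^ 4 = shearSq k ξ t ^ 2 := by
      rw [← sp, ← pow_mul, Real.sqrt_sq (Real.sqrt_nonneg _)]
    rw [sp] at r1 r3 r4
    rw [sp4, sq_abs] at r2
    refine ⟨?_, ?_, ?_, ?_⟩
    · rw [norm_solenoidalXHat_sq, hpq]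
      calc q ^ 2 * Ω / shearSq k ξ t ^ 2 ≤ shearSq k ξ t * Ω / shearSq k ξ t ^ 2 := by
            gcongr
            rw [← hpq]
            linarith [sq_nonneg (k : ℝ)]
        _ = Ω / shearSq k ξ t := by field_simp
        _ ≤ _ := r1
        _ ≤ _ := mul_le_mul_of_nonneg_right c1 (by positivity)
    · have n1 := congrArg (fun z => ‖z‖ ^ 2) hφ
      simp only [norm_mul, Complex.norm_real, Real.norm_eq_abs, mul_pow, sq_abs] at n1
      rw [hpq, ← hNt] at n1
      set Φ := ‖fourierHat (φ t) k q‖ ^ 2 with hΦ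
      have pΦ : 0 ≤ Φ := sq_nonneg _
      have p1 : 1 ≤ shearSq k ξ t := hk1.trans (shearSq_ge k ξ t)
      have n2 : Φ ≤ (4 * Real.pi * e) ^ 2 * (N / shearSq k ξ t) := by
        rw [← mul_div_assoc, le_div_iff₀ hp, mul_pow, mul_pow, ← n1, mul_comm Φ]
        refine mul_le_mul_of_nonneg_right ?_ pΦ
        exact (le_self_pow₀ p1 two_ne_zero).trans (pow_le_pow_left₀ hp.le (by linarith) 2)
      calc Φ ≤ (4 * Real.pi * e) ^ 2 * (N / shearSq k ξ t) := n2
        _ ≤ (4 * Real.pi * e) ^ 2 * (4 * C * _) := by gcongr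
        _ = (4 * Real.pi * e) ^ 2 * (4 * C) * _ := by rw [← mul_assoc]
        _ ≤ (256 + 32 * C + (4 * Real.pi * e) ^ 2 * (4 * C)) * _ := by
            refine mul_le_mul c3 ?_ (by positivity) (by positivity)
            exact add_le_add_left (le_add_of_nonneg_right (by positivity)) _
    · rw [norm_solenoidalYHat_sq, hpq]
      exact r2.trans (mul_le_mul_of_nonneg_right c2 (by positivity))
    · rw [norm_compressibleHat_sq, hpq, add_comm]
      have := hW.J_pos
      exact r4.trans (mul_le_mul_of_nonneg_right c4 (by positivity))

end IsSmoothSolution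

theorem bracket_rpow_sq (x r : ℝ) : (bracket x ^ r) ^ 2 = bracket x ^ (2 * r) := by
  rw [← Real.rpow_natCast, ← Real.rpow_mul (bracket_pos x).le]
  congr 1; push_cast; ring

namespace IsSmoothSolution

variable {e m Tp Tm : ℝ} {η ux uy φ : ℝ → ℝ → ℝ → ℝ}

/-- The Fourier transforms of the data in terms of the density and the velocity. -/
theorem initial_fourierHat_ae (h : IsSmoothSolution e m Tp Tm η ux uy φ) (σ : ℝ)
    (hψ : HasL2Modes (divergence (ux 0) (uy 0))) (hω : HasL2Modes (vorticity (ux 0) (uy 0)))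
    (k : ℤ) : ∀ᵐ ξ,
      fourierHat (fun x y => σ * η 0 x y) k ξ = σ * fourierHat (η 0) k ξ ∧
      fourierHat (divergence (ux 0) (uy 0)) k ξ = divHat (ux 0) (uy 0) k ξ ∧
      fourierHat (fun x y => η 0 x y + vorticity (ux 0) (uy 0) x y) k ξ
        = fourierHat (η 0) k ξ + vortHat (ux 0) (uy 0) k ξ := by
  have s1 := h.smooth_η.isCylSmooth le_rfl
  have s2 := h.smooth_ux.isCylSmooth le_rfl
  have s3 := h.smooth_uy.isCylSmooth le_rfl
  have p1 := h.smooth_η.memLp_xMode h.l2_η le_rfl k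
  have p2 := h.smooth_ux.memLp_xMode h.l2_ux le_rfl k
  have p3 := h.smooth_uy.memLp_xMode h.l2_uy le_rfl k
  filter_upwards [fourierHat_const_mul_ae s1 σ p1, fourierHat_divergence_ae s2 s3 p2 p3 (hψ k),
    fourierHat_vorticity_ae s2 s3 p2 p3 (hω k),
    fourierHat_add_ae s1 (s2.vorticity s3) p1 (hω k)] with ξ e1 e2 e3 e4
  exact ⟨e1, e2, by rw [e4, e3]⟩

end IsSmoothSolution

/-- Four-term form of the bound by anisotropic norms. -/
theorem half_pow_le_anisoNorm_four (t : ℝ) {g : ℤ → ℝ → ℝ} {c₁ c₂ r₁ s₁ s₂ s₃ s₄ : ℝ}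
    {F G H : ℝ → ℝ → ℝ} (hF : HasL2Modes F) (hG : HasL2Modes G) (hH : HasL2Modes H)
    (hc₁ : 0 ≤ c₁) (hc₂ : 0 ≤ c₂) {r₂ : ℝ}
    (h : ∀ k : ℤ, ∀ᵐ ξ, g k (ξ - k * t) ≤
      c₁ ^ 2 * ((1 + (k : ℝ) ^ 2) ^ r₁ * (1 + ξ ^ 2) ^ s₁ * ‖fourierHat F k ξ‖ ^ 2)
      + c₁ ^ 2 * ((1 + (k : ℝ) ^ 2) ^ r₁ * (1 + ξ ^ 2) ^ s₂ * ‖fourierHat G k ξ‖ ^ 2)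
      + c₂ ^ 2 * ((1 + (k : ℝ) ^ 2) ^ r₂ * (1 + ξ ^ 2) ^ s₃ * ‖fourierHat G k ξ‖ ^ 2)
      + c₁ ^ 2 * ((1 + (k : ℝ) ^ 2) ^ r₁ * (1 + ξ ^ 2) ^ s₄ * ‖fourierHat H k ξ‖ ^ 2)) :
    (∑' k : ℤ, ∫⁻ ξ, ENNReal.ofReal (g k ξ)) ^ (1 / 2 : ℝ)
      ≤ ENNReal.ofReal c₁ * (anisoNorm r₁ s₁ F + anisoNorm r₁ s₂ G)
        + ENNReal.ofReal c₂ * anisoNorm r₂ s₃ G + ENNReal.ofReal c₁ * anisoNorm r₁ s₄ H := by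
  have := half_pow_le_anisoNorm t (g := g) ![c₁, c₁, c₂, c₁] ![r₁, r₁, r₂, r₁] ![s₁, s₂, s₃, s₄]
    ![F, G, G, H] (by simp [Fin.forall_fin_succ, hF, hG, hH])
    (by simp [Fin.forall_fin_succ, hc₁, hc₂])
    (fun k => by
      filter_upwards [h k] with ξ hξ
      simpa [Fin.sum_univ_four] using hξ)
  rw [mul_add]
  simpa [Fin.sum_univ_four] using this

theorem half_pow_le_sobolevNorm_three (t : ℝ) {g : ℤ → ℝ → ℝ} {c s₁ s₂ s₃ : ℝ}
    {F G H : ℝ → ℝ → ℝ} (hF : HasL2Modes F) (hG : HasL2Modes G) (hH : HasL2Modes H) (hc : 0 ≤ c)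
    (h : ∀ k : ℤ, ∀ᵐ ξ, g k (ξ - k * t) ≤
      c ^ 2 * ((1 + (k : ℝ) ^ 2 + ξ ^ 2) ^ s₁ * ‖fourierHat F k ξ‖ ^ 2)
      + c ^ 2 * ((1 + (k : ℝ) ^ 2 + ξ ^ 2) ^ s₂ * ‖fourierHat G k ξ‖ ^ 2)
      + c ^ 2 * ((1 + (k : ℝ) ^ 2 + ξ ^ 2) ^ s₃ * ‖fourierHat H k ξ‖ ^ 2)) :
    (∑' k : ℤ, ∫⁻ ξ, ENNReal.ofReal (g k ξ)) ^ (1 / 2 : ℝ)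
      ≤ ENNReal.ofReal c * (sobolevNorm s₁ F + sobolevNorm s₂ G + sobolevNorm s₃ H) := by
  have := half_pow_le_sobolevNorm t (g := g) ![c, c, c] ![s₁, s₂, s₃] ![F, G, H]
    (by simp [Fin.forall_fin_succ, hF, hG, hH]) (by simp [Fin.forall_fin_succ, hc])
    (fun k => by
      filter_upwards [h k] with ξ hξ
      simpa [Fin.sum_univ_three] using hξ)
  rw [mul_add, mul_add]
  simpa [Fin.sum_univ_three] using this

/-! ### Decay and growth of the norms -/

section weights

variable {C M σ τ t N₀ Γ₀ Ψ₀ : ℝ} (k : ℤ) (ξ : ℝ)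

/-- The right-hand side of `WeightRelations.solenoidalX_decay`, in terms of the weights of the
anisotropic norms and of the normalizing factors `σ`, `τ = 1 / σ` of the data. -/
theorem solenoidalX_weight_le (hM1 : C ≤ M ^ 2) (hM2 : C ≤ M ^ 2 * σ ^ 2)
    (hM4 : M ^ 2 * σ ^ 2 * τ ^ 2 = M ^ 2)
    (hN : 0 ≤ N₀) (hΓ : 0 ≤ Γ₀) (hΨ : 0 ≤ Ψ₀) :
    C * (N₀ / (bracket k * bracket t) + bracket ξ * Γ₀ / (bracket k * bracket t)
        + bracket ξ ^ 2 * Γ₀ / (bracket k ^ 2 * bracket t ^ 2)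
        + Ψ₀ / (bracket k * bracket t * bracket ξ ^ 2))
      ≤ (M * σ * bracket t ^ (-1 / 2 : ℝ)) ^ 2
          * ((1 + (k : ℝ) ^ 2) ^ (-1 / 2 : ℝ) * (1 + ξ ^ 2) ^ (0 : ℝ) * (τ ^ 2 * N₀))
        + (M * σ * bracket t ^ (-1 / 2 : ℝ)) ^ 2
          * ((1 + (k : ℝ) ^ 2) ^ (-1 / 2 : ℝ) * (1 + ξ ^ 2) ^ (1 / 2 : ℝ) * Γ₀)
        + (M * bracket t ^ (-1 : ℝ)) ^ 2
          * ((1 + (k : ℝ) ^ 2) ^ (-1 : ℝ) * (1 + ξ ^ 2) ^ (1 : ℝ) * Γ₀)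
        + (M * σ * bracket t ^ (-1 / 2 : ℝ)) ^ 2
          * ((1 + (k : ℝ) ^ 2) ^ (-1 / 2 : ℝ) * (1 + ξ ^ 2) ^ (-1 : ℝ) * Ψ₀) := by
  have bt := bracket_pos t
  have bk := bracket_pos (k : ℝ)
  have bξ := bracket_pos ξ
  simp only [mul_pow, bracket_rpow_sq, one_add_sq_rpow]
  rw [show (2 * (-1 / 2) : ℝ) = -1 by norm_num, show (2 * (-1) : ℝ) = -(2 : ℕ) by norm_num,
    show (2 * (1 / 2) : ℝ) = 1 by norm_num, show (2 * 1 : ℝ) = (2 : ℕ) by norm_num, mul_zero,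
    Real.rpow_neg_one, Real.rpow_neg_one, Real.rpow_neg bt.le, Real.rpow_neg bk.le,
    Real.rpow_neg bξ.le, Real.rpow_natCast, Real.rpow_natCast, Real.rpow_natCast,
    Real.rpow_one, Real.rpow_zero]
  have q1 := mul_le_mul_of_nonneg_right hM1
    (by positivity : 0 ≤ N₀ / (bracket k * bracket t))
  have q2 := mul_le_mul_of_nonneg_right hM2
    (by positivity : 0 ≤ bracket ξ * Γ₀ / (bracket k * bracket t))
  have q3 := mul_le_mul_of_nonneg_right hM1
    (by positivity : 0 ≤ bracket ξ ^ 2 * Γ₀ / (bracket k ^ 2 * bracket t ^ 2))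
  have q4 := mul_le_mul_of_nonneg_right hM2
    (by positivity : 0 ≤ Ψ₀ / (bracket k * bracket t * bracket ξ ^ 2))
  rw [← hM4] at q1
  rw [mul_add, mul_add, mul_add]
  refine (add_le_add (add_le_add (add_le_add q1 q2) q3) q4).trans (le_of_eq ?_)
  field_simp

theorem solenoidalY_weight_le (hM1 : C ≤ M ^ 2) (hM2 : C ≤ M ^ 2 * σ ^ 2)
    (hM4 : M ^ 2 * σ ^ 2 * τ ^ 2 = M ^ 2)
    (hN : 0 ≤ N₀) (hΓ : 0 ≤ Γ₀) (hΨ : 0 ≤ Ψ₀) :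
    C * (bracket ξ ^ 2 * N₀ / (bracket k * bracket t ^ 3)
        + bracket ξ ^ 3 * Γ₀ / (bracket k * bracket t ^ 3)
        + bracket ξ ^ 4 * Γ₀ / (bracket k ^ 2 * bracket t ^ 4)
        + Ψ₀ / (bracket k * bracket t ^ 3))
      ≤ (M * σ * bracket t ^ (-3 / 2 : ℝ)) ^ 2
          * ((1 + (k : ℝ) ^ 2) ^ (-1 / 2 : ℝ) * (1 + ξ ^ 2) ^ (1 : ℝ) * (τ ^ 2 * N₀))
        + (M * σ * bracket t ^ (-3 / 2 : ℝ)) ^ 2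
          * ((1 + (k : ℝ) ^ 2) ^ (-1 / 2 : ℝ) * (1 + ξ ^ 2) ^ (3 / 2 : ℝ) * Γ₀)
        + (M * bracket t ^ (-2 : ℝ)) ^ 2
          * ((1 + (k : ℝ) ^ 2) ^ (-1 : ℝ) * (1 + ξ ^ 2) ^ (2 : ℝ) * Γ₀)
        + (M * σ * bracket t ^ (-3 / 2 : ℝ)) ^ 2
          * ((1 + (k : ℝ) ^ 2) ^ (-1 / 2 : ℝ) * (1 + ξ ^ 2) ^ (0 : ℝ) * Ψ₀) := by
  have bt := bracket_pos t
  have bk := bracket_pos (k : ℝ)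
  have bξ := bracket_pos ξ
  simp only [mul_pow, bracket_rpow_sq, one_add_sq_rpow]
  rw [show (2 * (-3 / 2) : ℝ) = -(3 : ℕ) by norm_num, show (2 * (-1 / 2) : ℝ) = -1 by norm_num,
    show (2 * (-1) : ℝ) = -(2 : ℕ) by norm_num, show (2 * (-2) : ℝ) = -(4 : ℕ) by norm_num,
    show (2 * (3 / 2) : ℝ) = (3 : ℕ) by norm_num, show (2 * 1 : ℝ) = (2 : ℕ) by norm_num,
    show (2 * 2 : ℝ) = (4 : ℕ) by norm_num, mul_zero,
    Real.rpow_neg_one, Real.rpow_neg bt.le, Real.rpow_neg bt.le, Real.rpow_neg bk.le,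
    Real.rpow_natCast, Real.rpow_natCast, Real.rpow_natCast, Real.rpow_natCast,
    Real.rpow_natCast, Real.rpow_natCast, Real.rpow_zero]
  have q1 := mul_le_mul_of_nonneg_right hM1
    (by positivity : 0 ≤ bracket ξ ^ 2 * N₀ / (bracket k * bracket t ^ 3))
  have q2 := mul_le_mul_of_nonneg_right hM2
    (by positivity : 0 ≤ bracket ξ ^ 3 * Γ₀ / (bracket k * bracket t ^ 3))
  have q3 := mul_le_mul_of_nonneg_right hM1
    (by positivity : 0 ≤ bracket ξ ^ 4 * Γ₀ / (bracket k ^ 2 * bracket t ^ 4))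
  have q4 := mul_le_mul_of_nonneg_right hM2
    (by positivity : 0 ≤ Ψ₀ / (bracket k * bracket t ^ 3))
  rw [← hM4] at q1
  rw [mul_add, mul_add, mul_add]
  refine (add_le_add (add_le_add (add_le_add q1 q2) q3) q4).trans (le_of_eq ?_)
  field_simp

theorem compressible_weight_le (hM1 : C ≤ M ^ 2) (hM3 : C ≤ M ^ 2 * τ ^ 2)
    (hN : 0 ≤ N₀) (hΓ : 0 ≤ Γ₀) (hΨ : 0 ≤ Ψ₀) :
    C * (bracket t * N₀ + bracket t * (Ψ₀ / (1 + (k : ℝ) ^ 2 + ξ ^ 2))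
        + bracket t * ((1 + (k : ℝ) ^ 2 + ξ ^ 2) * Γ₀))
      ≤ (M * bracket t ^ (1 / 2 : ℝ)) ^ 2
          * ((1 + (k : ℝ) ^ 2 + ξ ^ 2) ^ (0 : ℝ) * (τ ^ 2 * N₀))
        + (M * bracket t ^ (1 / 2 : ℝ)) ^ 2 * ((1 + (k : ℝ) ^ 2 + ξ ^ 2) ^ (-1 : ℝ) * Ψ₀)
        + (M * bracket t ^ (1 / 2 : ℝ)) ^ 2 * ((1 + (k : ℝ) ^ 2 + ξ ^ 2) ^ (1 : ℝ) * Γ₀) := by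
  have bt := bracket_pos t
  simp only [mul_pow, bracket_rpow_sq]
  have hJ : 0 < 1 + (k : ℝ) ^ 2 + ξ ^ 2 := by positivity
  rw [show (2 * (1 / 2) : ℝ) = 1 by norm_num, Real.rpow_neg_one, Real.rpow_one, Real.rpow_one,
    Real.rpow_zero]
  have q1 := mul_le_mul_of_nonneg_right hM3 (by positivity : 0 ≤ bracket t * N₀)
  have q2 := mul_le_mul_of_nonneg_right hM1
    (by positivity : 0 ≤ bracket t * (Ψ₀ / (1 + (k : ℝ) ^ 2 + ξ ^ 2)))
  have q3 := mul_le_mul_of_nonneg_right hM1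
    (by positivity : 0 ≤ bracket t * ((1 + (k : ℝ) ^ 2 + ξ ^ 2) * Γ₀))
  rw [mul_add, mul_add]
  refine (add_le_add (add_le_add q1 q2) q3).trans (le_of_eq ?_)
  field_simp

end weights

theorem solenoidalXNorm_eq (v w : ℝ → ℝ → ℝ) : solenoidalXNorm v w
    = (∑' k : ℤ, ∫⁻ ξ, ENNReal.ofReal (‖solenoidalXHat v w k ξ‖ ^ 2)) ^ (1 / 2 : ℝ) := by
  simp only [solenoidalXNorm, ENNReal.ofReal_pow (norm_nonneg _), ofReal_norm]

theorem solenoidalYNorm_eq (v w : ℝ → ℝ → ℝ) : solenoidalYNorm v w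
    = (∑' k : ℤ, ∫⁻ ξ, ENNReal.ofReal (‖solenoidalYHat v w k ξ‖ ^ 2)) ^ (1 / 2 : ℝ) := by
  simp only [solenoidalYNorm, ENNReal.ofReal_pow (norm_nonneg _), ofReal_norm]

theorem compressibleNorm_eq (v w : ℝ → ℝ → ℝ) : compressibleNorm v w
    = (∑' k : ℤ, ∫⁻ ξ, ENNReal.ofReal (‖compressibleXHat v w k ξ‖ ^ 2
      + ‖compressibleYHat v w k ξ‖ ^ 2)) ^ (1 / 2 : ℝ) := by
  simp only [compressibleNorm, ENNReal.ofReal_add (sq_nonneg _) (sq_nonneg _),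
    ENNReal.ofReal_pow (norm_nonneg _), ofReal_norm]

end EulerPoisson

open EulerPoisson in
theorem theorem1p1 (e m Tp Tm : ℝ) (he : 0 < e) (hm : 0 < m) (hTp : 0 < Tp) (hTm : 0 < Tm) :
    ∃ C : ℝ, 0 < C ∧
      ∀ (ηin ψin ωin : ℝ → ℝ → ℝ) (η ux uy φ : ℝ → ℝ → ℝ → ℝ),
        EulerPoisson.MemAniso 1 2 ηin →
        EulerPoisson.MemAniso 1 2 ωin →
        EulerPoisson.MemAniso (-1 / 2) 0 ψin →
        (∀ y, EulerPoisson.xAverage ηin y = 0) →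
        (∀ y, EulerPoisson.xAverage ψin y = 0) →
        (∀ y, EulerPoisson.xAverage ωin y = 0) →
        EulerPoisson.IsSmoothSolution e m Tp Tm η ux uy φ →
        η 0 = ηin →
        EulerPoisson.divergence (ux 0) (uy 0) = ψin →
        EulerPoisson.vorticity (ux 0) (uy 0) = ωin →
        ∀ t : ℝ, 0 ≤ t →
          (EulerPoisson.solenoidalXNorm (ux t) (uy t) + EulerPoisson.l2Norm (φ t) ≤
            ENNReal.ofReal C *
              (ENNReal.ofReal (Real.sqrt (m / Tp)) * EulerPoisson.bracketPow t (-1 / 2) *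
                  (EulerPoisson.anisoNorm (-1 / 2) 0 (fun x y => Real.sqrt (Tp / m) * ηin x y)
                    + EulerPoisson.anisoNorm (-1 / 2) (1 / 2) (fun x y => ηin x y + ωin x y))
                + EulerPoisson.bracketPow t (-1) *
                  EulerPoisson.anisoNorm (-1) 1 (fun x y => ηin x y + ωin x y)
                + ENNReal.ofReal (Real.sqrt (m / Tp)) * EulerPoisson.bracketPow t (-1 / 2) *
                  EulerPoisson.anisoNorm (-1 / 2) (-1) ψin)) ∧
          (EulerPoisson.solenoidalYNorm (ux t) (uy t) ≤
            ENNReal.ofReal C *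
              (ENNReal.ofReal (Real.sqrt (m / Tp)) * EulerPoisson.bracketPow t (-3 / 2) *
                  (EulerPoisson.anisoNorm (-1 / 2) 1 (fun x y => Real.sqrt (Tp / m) * ηin x y)
                    + EulerPoisson.anisoNorm (-1 / 2) (3 / 2) (fun x y => ηin x y + ωin x y))
                + EulerPoisson.bracketPow t (-2) *
                  EulerPoisson.anisoNorm (-1) 2 (fun x y => ηin x y + ωin x y)
                + ENNReal.ofReal (Real.sqrt (m / Tp)) * EulerPoisson.bracketPow t (-3 / 2) *
                  EulerPoisson.anisoNorm (-1 / 2) 0 ψin)) ∧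
          (EulerPoisson.compressibleNorm (ux t) (uy t)
              + ENNReal.ofReal (Real.sqrt (Tp / m)) * EulerPoisson.l2Norm (η t) ≤
            ENNReal.ofReal C *
              (EulerPoisson.bracketPow t (1 / 2) *
                (EulerPoisson.l2Norm (fun x y => Real.sqrt (Tp / m) * ηin x y)
                  + EulerPoisson.sobolevNorm (-1) ψin
                  + EulerPoisson.sobolevNorm 1 (fun x y => ηin x y + ωin x y)))) := by
  obtain ⟨C, hC, H⟩ := IsSmoothSolution.mode_decay_ae he hm hTp hTm
  have hσ : 0 < √(m / Tp) := by positivity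
  have hτ : 0 < √(Tp / m) := by positivity
  have hστ : √(m / Tp) * √(Tp / m) = 1 := by
    rw [← Real.sqrt_mul (by positivity), div_mul_div_comm, mul_comm Tp m, div_self (by positivity),
      Real.sqrt_one]
  generalize √(m / Tp) = σ at *
  generalize √(Tp / m) = τ at *
  -- a constant that dominates `√C`, `√C / σ` and `√C / τ`
  set M : ℝ := √C * (1 + σ + τ) with hM
  have hsC : 0 < √C := Real.sqrt_pos.2 hC
  have hM0 : 0 < M := by positivity
  have hM1 : C ≤ M ^ 2 := by
    rw [hM, mul_pow, Real.sq_sqrt hC.le]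
    exact le_mul_of_one_le_right hC.le (by nlinarith)
  have hM2 : C ≤ M ^ 2 * σ ^ 2 := by
    have : 1 ≤ ((1 + σ + τ) * σ) ^ 2 := one_le_pow₀ (by nlinarith)
    rw [hM, mul_pow, Real.sq_sqrt hC.le, mul_assoc, ← mul_pow]
    exact le_mul_of_one_le_right hC.le this
  have hM3 : C ≤ M ^ 2 * τ ^ 2 := by
    have : 1 ≤ ((1 + σ + τ) * τ) ^ 2 := one_le_pow₀ (by nlinarith)
    rw [hM, mul_pow, Real.sq_sqrt hC.le, mul_assoc, ← mul_pow]
    exact le_mul_of_one_le_right hC.le this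
  have hM4 : M ^ 2 * σ ^ 2 * τ ^ 2 = M ^ 2 := by
    rw [mul_assoc, ← mul_pow, hστ]; ring
  refine ⟨M * (2 + τ), by positivity, ?_⟩
  intro ηin ψin ωin η ux uy φ hη hω hψ a1 a2 a3 h e1 e2 e3 t ht
  subst e1 e2 e3
  have hψ' := hψ.hasL2Modes
  have hω' := hω.hasL2Modes
  have H := H η ux uy φ h a1 a2 a3 t ht
  have hI := h.initial_fourierHat_ae τ hψ' hω'
  have s1 := fun {t} (ht : 0 ≤ t) => h.smooth_η.isCylSmooth ht
  have sω := (h.smooth_ux.isCylSmooth le_rfl).vorticity (h.smooth_uy.isCylSmooth le_rfl)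
  have L1 : HasL2Modes fun x y => τ * η 0 x y :=
    fun k => memLp_xMode_const_mul τ (hη.hasL2Modes k)
  have L2 : HasL2Modes fun x y => η 0 x y + vorticity (ux 0) (uy 0) x y :=
    fun k => memLp_xMode_add (s1 le_rfl) sω (hη.hasL2Modes k) (hω' k)
  have bt := bracket_pos t
  have hτn : ∀ z : ℂ, ‖(τ : ℂ) * z‖ ^ 2 = τ ^ 2 * ‖z‖ ^ 2 := fun z => by
    rw [norm_mul, mul_pow, Complex.norm_real, Real.norm_eq_abs, sq_abs]
  refine ⟨?_, ?_, ?_⟩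
  · have B : ∀ g : ℤ → ℝ → ℝ, (∀ k : ℤ, ∀ᵐ ξ, g k (ξ - k * t)
        ≤ C * (‖fourierHat (η 0) k ξ‖ ^ 2 / (bracket k * bracket t)
          + bracket ξ * ‖fourierHat (η 0) k ξ + vortHat (ux 0) (uy 0) k ξ‖ ^ 2
            / (bracket k * bracket t)
          + bracket ξ ^ 2 * ‖fourierHat (η 0) k ξ + vortHat (ux 0) (uy 0) k ξ‖ ^ 2
            / (bracket k ^ 2 * bracket t ^ 2)
          + ‖divHat (ux 0) (uy 0) k ξ‖ ^ 2 / (bracket k * bracket t * bracket ξ ^ 2))) →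
        (∑' k : ℤ, ∫⁻ ξ, ENNReal.ofReal (g k ξ)) ^ (1 / 2 : ℝ) ≤ _ := fun g hg =>
      half_pow_le_anisoNorm_four t
        (c₁ := M * σ * bracket t ^ (-1 / 2 : ℝ)) (c₂ := M * bracket t ^ (-1 : ℝ)) (r₁ := -1 / 2)
        (r₂ := -1) (s₁ := 0) (s₂ := 1 / 2) (s₃ := 1) (s₄ := -1) L1 L2 hψ' (by positivity)
        (by positivity) fun k => by
          filter_upwards [hg k, hI k] with ξ hξ ⟨i1, i2, i3⟩
          rw [i1, i2, i3, hτn]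
          exact hξ.trans (solenoidalX_weight_le k ξ hM1 hM2 hM4 (sq_nonneg _) (sq_nonneg _)
            (sq_nonneg _))
    rw [solenoidalXNorm_eq, l2Norm_eq_half_pow (h.smooth_φ.isCylSmooth ht).continuous
        (h.l2_φ.l2Norm_lt_top ht)]
    refine (add_le_add (B _ fun k => (H k).mono fun ξ hξ => (hξ _ _ _ rfl rfl rfl).1)
      (B _ fun k => (H k).mono fun ξ hξ => (hξ _ _ _ rfl rfl rfl).2.1)).trans ?_
    have hle : ENNReal.ofReal M + ENNReal.ofReal M ≤ ENNReal.ofReal (M * (2 + τ)) := by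
      rw [← ENNReal.ofReal_add hM0.le hM0.le]
      exact ENNReal.ofReal_le_ofReal (by nlinarith)
    rw [ENNReal.ofReal_mul (by positivity), ENNReal.ofReal_mul hM0.le, ENNReal.ofReal_mul hM0.le]
    simp only [bracketPow]
    refine le_trans (le_of_eq ?_) (mul_le_mul_left hle _)
    ring
  · rw [solenoidalYNorm_eq]
    refine (half_pow_le_anisoNorm_four t
        (c₁ := M * σ * bracket t ^ (-3 / 2 : ℝ)) (c₂ := M * bracket t ^ (-2 : ℝ)) (r₁ := -1 / 2)
        (r₂ := -1) (s₁ := 1) (s₂ := 3 / 2) (s₃ := 2) (s₄ := 0) L1 L2 hψ' (by positivity)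
        (by positivity) fun k => ?_).trans ?_
    · filter_upwards [H k, hI k] with ξ hξ ⟨i1, i2, i3⟩
      rw [i1, i2, i3, hτn]
      exact ((hξ _ _ _ rfl rfl rfl).2.2.1).trans (solenoidalY_weight_le k ξ hM1 hM2 hM4
        (sq_nonneg _) (sq_nonneg _) (sq_nonneg _))
    have hle : ENNReal.ofReal M ≤ ENNReal.ofReal (M * (2 + τ)) :=
      ENNReal.ofReal_le_ofReal (le_mul_of_one_le_right hM0.le (by linarith))
    rw [ENNReal.ofReal_mul (by positivity), ENNReal.ofReal_mul hM0.le, ENNReal.ofReal_mul hM0.le]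
    simp only [bracketPow]
    refine le_trans (le_of_eq ?_) (mul_le_mul_left hle _)
    ring
  · have B : ∀ g : ℤ → ℝ → ℝ, (∀ k : ℤ, ∀ᵐ ξ, g k (ξ - k * t)
        ≤ C * (bracket t * ‖fourierHat (η 0) k ξ‖ ^ 2
          + bracket t * (‖divHat (ux 0) (uy 0) k ξ‖ ^ 2 / (1 + (k : ℝ) ^ 2 + ξ ^ 2))
          + bracket t * ((1 + (k : ℝ) ^ 2 + ξ ^ 2)
            * ‖fourierHat (η 0) k ξ + vortHat (ux 0) (uy 0) k ξ‖ ^ 2))) →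
        (∑' k : ℤ, ∫⁻ ξ, ENNReal.ofReal (g k ξ)) ^ (1 / 2 : ℝ) ≤ _ := fun g hg =>
      half_pow_le_sobolevNorm_three t
        (c := M * bracket t ^ (1 / 2 : ℝ)) (s₁ := 0) (s₂ := -1) (s₃ := 1) L1 hψ' L2
        (by positivity) fun k => by
          filter_upwards [hg k, hI k] with ξ hξ ⟨i1, i2, i3⟩
          rw [i1, i2, i3, hτn]
          exact hξ.trans (compressible_weight_le k ξ hM1 hM3 (sq_nonneg _) (sq_nonneg _)
            (sq_nonneg _))
    have hL : l2Norm (fun x y => τ * η 0 x y) < ⊤ :=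
      (eLpNorm_const_smul_le (c := τ) (f := fun p : ℝ × ℝ => η 0 p.1 p.2) (p := 2)
        (μ := cylMeasure)).trans_lt
        (ENNReal.mul_lt_top (by simp) (h.l2_η.l2Norm_lt_top le_rfl))
    rw [l2Norm_eq_sobolevNorm ((s1 le_rfl).const_mul τ).continuous hL, compressibleNorm_eq,
      l2Norm_eq_half_pow (s1 ht).continuous (h.l2_η.l2Norm_lt_top ht)]
    refine (add_le_add (B _ fun k => (H k).mono fun ξ hξ =>
      (le_add_of_nonneg_right (sq_nonneg _)).trans (hξ _ _ _ rfl rfl rfl).2.2.2)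
      (mul_le_mul_right (B _ fun k => (H k).mono fun ξ hξ =>
        (le_add_of_nonneg_left (by positivity)).trans (hξ _ _ _ rfl rfl rfl).2.2.2) _)).trans ?_
    have hle : ENNReal.ofReal M + ENNReal.ofReal τ * ENNReal.ofReal M
        ≤ ENNReal.ofReal (M * (2 + τ)) := by
      rw [← ENNReal.ofReal_mul hτ.le, ← ENNReal.ofReal_add hM0.le (by positivity)]
      exact ENNReal.ofReal_le_ofReal (by nlinarith)
    rw [ENNReal.ofReal_mul hM0.le]
    simp only [bracketPow]
    refine le_trans (le_of_eq ?_) (mul_le_mul_left hle _)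
    ring
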